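/- \textbf{Setting.} Let $T>0$, $m>0$, and let $\mathcal M(X)$, resp. $\mathcal M^+(X)$, be the finite signed, resp. nonnegative, Borel measures on $X$, with the weak-$*$ topology in duality with $C_0(X)$. Assume: (In1) $\bar\rho\in BV(\mathbb R)\cap L^\infty(\mathbb R)$, $\bar\rho\ge 0$, $\int_{\mathbb R}\bar\rho\,dx=m$, and $\bar\rho$ has compact (essential) support; (A-$\beta$) $\beta:[0,\infty)\to[0,\infty)$ is Lipschitz and nonincreasing, $\beta(0)=\beta_{max}>0$, and $\beta\equiv 0$ on $[M_\beta,\infty)$ for some $M_\beta>0$; (A-V) $V\in C^2(\mathbb R)$ and $|V'(r)|\le c_V(1+|r|)$ for some $c_V>0$; (A-Wm) $W:\mathbb R\to\mathbb R$ is even and locally Lipschitz, $W'\in W^{2,\infty}(\mathbb R\setminus\{0\})$, and $|W'(r)|\le c_W(1+|r|)$ for $r\neq 0$ and some $c_W>0$. \textbf{Particles.} For $N\in\mathbb N$ put $h=m/N$. Let $\bar x_0=\min\operatorname{supp}\bar\rho$, $\bar x_N=\max\operatorname{supp}\bar\rho$ and $\bar x_i=\sup\{x:\int_{\bar x_{i-1}}^x\bar\rho\,dy<h\}$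 for $1\le i\le N-1$. For every $N$ with $h\in(0,1)$ let $\mathbf x^h=(x_0,\dots,x_N)$, $x_0(t)<\dots<x_N(t)$ for $t\in[0,T]$, be a solution on $[0,T]$, with $x_i(0)=\bar x_i$, of \[ \dot x_i=-\beta(\rho_i)f_i^- -\beta(\rho_{i-1})f_i^+,\quad i=0,\dots,N,\qquad \rho_i=\frac{h}{x_{i+1}-x_i}\ (0\le i\le N-1), \] where $\beta(\rho_{-1})$ and $\beta(\rho_N)$ are understood as $\beta_{max}$, $f_i=V'(x_i)+\sum_{j\ne i}hW'(x_i-x_j)$, $f_i^+=\max(f_i,0)$ and $f_i^-=\min(f_i,0)$. With $K_i(t)=(x_i(t),x_{i+1}(t))$ define \[ \hat\rho^h_t(x)=\sum_{i=0}^{N-1}\rho_i(t)\mathbf 1_{K_i(t)}(x),\qquad \hat\jmath^h_t(x)=\sum_{i=0}^{N-1}\rho_i(t)\Bigl(\tfrac{x_{i+1}(t)-x}{|K_i(t)|}\dot x_i(t)+\tfrac{x-x_i(t)}{|K_i(t)|}\dot x_{i+1}(t)\Bigr)\mathbf 1_{K_i(t)}(x). \] \textbf{Continuity equation.} $\mathcal{CE}(0,T)$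 is the set of pairs $(\rho,j)$ of a weakly-$*$ continuous curve $[0,T]\ni t\mapsto\rho_t\in\mathcal M^+(\mathbb R)$ and a measurable family $(j_t)_{t\in[0,T]}\subset\mathcal M(\mathbb R)$ with $\int_0^T|j_t|(\mathbb R)\,dt<\infty$, such that $\langle\varphi,\rho_t\rangle-\langle\varphi,\rho_s\rangle=\int_s^t\langle\partial_x\varphi,j_r\rangle\,dr$ for all $0\le s<t\le T$ and all bounded Lipschitz $\varphi:\mathbb R\to\mathbb R$ (with $\partial_x\varphi$ the classical derivative, set to $0$ where it does not exist). \textbf{Theorem.} There exist a pair $(\rho,j)\in\mathcal{CE}(0,T)$ and a subsequence $h=h_k=m/N_k\to 0$ such that $\rho_t$ has a density with respect to Lebesgue measure for a.e. $t\in[0,T]$, these densities define a function (again denoted $\rho$) in $L^1([0,T]\times\mathbb R)$, and, along the subsequence, \[ \hat\rho^h\to\rho\ \text{ in } L^1([0,T]\times\mathbb R),\qquad \hat\rho^h_t\rightharpoonup^*\rho_t\ \text{ weakly-$*$ in }\mathcal M^+(\mathbb R)\text{ for every }t\in[0,T], \] \[ \hat\jmath^h_t(x)\,dx\,dt\rightharpoonup^*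 j_t(dx)\,dt\ \text{ weakly-$*$ in }\mathcal M([0,T]\times\mathbb R). \] -/

import Mathlib

open Set Filter Topology MeasureTheory
open scoped ENNReal NNReal ZeroAtInfty ContDiff

noncomputable section

namespace ParticleApprox

/-- `f` is (the representative of) an element of `BV(ℝ)`: it is integrable and its distributional
derivative is a finite signed measure. -/
def IsBV (f : ℝ → ℝ) : Prop :=
  Integrable f volume ∧
    ∃ Df : SignedMeasure ℝ, ∀ φ : ℝ → ℝ, ContDiff ℝ ∞ φ → HasCompactSupport φ →
      ∫ x, f x * deriv φ x = - ∫ᵛ x, φ x ∂•Df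

/-- The (essential) support of a function defined up to null sets: the support of the measure
`|f(x)| dx`. -/
def essSupport (f : ℝ → ℝ) : Set ℝ :=
  (volume.withDensity (fun x => ‖f x‖ₑ)).support

/-- Admissible initial densities of mass `m`. -/
structure IsInitialDatum (ρbar : ℝ → ℝ) (m : ℝ) : Prop where
  bv : IsBV ρbar
  bounded : MemLp ρbar ⊤ volume
  nonneg : ∀ᵐ x, 0 ≤ ρbar x
  mass_pos : 0 < m
  mass : ∫ x, ρbar x = m
  compact_support : IsCompact (essSupport ρbar)

/-- Admissible maps `β : [0, ∞) → [0, ∞)`; only the values on `[0, ∞)` matter. -/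
structure IsMobilityFactor (β : ℝ → ℝ) : Prop where
  lipschitz : ∃ K : ℝ≥0, LipschitzOnWith K β (Ici 0)
  decreasing : AntitoneOn β (Ici 0)
  pos_zero : 0 < β 0
  vanishes : ∃ Mβ : ℝ, 0 < Mβ ∧ ∀ s, Mβ ≤ s → β s = 0

/-- Linear growth `|g(r)| ≤ c (1 + |r|)` for `|r| > 0`. -/
def LinearGrowth (g : ℝ → ℝ) : Prop :=
  ∃ c : ℝ, 0 < c ∧ ∀ r : ℝ, 0 < |r| → |g r| ≤ c * (1 + |r|)

/-- Admissible external potentials. -/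
structure IsExternalPotential (V : ℝ → ℝ) : Prop where
  contDiff : ContDiff ℝ 2 V
  growth : LinearGrowth (deriv V)

/-- `g` is the weak derivative of `f` on the open set `U`. -/
def HasWeakDerivOn (U : Set ℝ) (f g : ℝ → ℝ) : Prop :=
  ∀ φ : ℝ → ℝ, ContDiff ℝ ∞ φ → HasCompactSupport φ → tsupport φ ⊆ U →
    ∫ x in U, f x * deriv φ x = - ∫ x in U, g x * φ x

/-- The Sobolev space `W^{2,∞}(U)`: `f` and its first two weak derivatives are in `L^∞(U)`. -/
def MemSobolevTwoInfty (U : Set ℝ) (f : ℝ → ℝ) : Prop :=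
  MemLp f ⊤ (volume.restrict U) ∧
    ∃ f₁ f₂ : ℝ → ℝ,
      MemLp f₁ ⊤ (volume.restrict U) ∧ MemLp f₂ ⊤ (volume.restrict U) ∧
      HasWeakDerivOn U f f₁ ∧ HasWeakDerivOn U f₁ f₂

/-- Mild interaction potentials: radially symmetric, locally Lipschitz, with
`W' ∈ W^{2,∞}(ℝ ∖ {0})` of linear growth. (Such a `W` is continuously differentiable off `0`, so
that `deriv W` is `W'` at every point of `ℝ ∖ {0}`.) -/
structure IsMildPotential (W : ℝ → ℝ) : Prop where
  symmetric : ∀ x, W (-x) = W x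
  locallyLipschitz : LocallyLipschitz W
  sobolev : MemSobolevTwoInfty {0}ᶜ (deriv W)
  growth : LinearGrowth (deriv W)

/-! ### The deterministic particle approximation

A configuration of the `N + 1` particles `x₀ < x₁ < ⋯ < x_N` is written as a function
`y : ℕ → ℝ`, of which only the values at `0, …, N` are ever used. -/

/-- The density `ρ_i = h / (x_{i+1} - x_i)` of the cell `K_i = (x_i, x_{i+1})`. -/
def cellDensity (h : ℝ) (y : ℕ → ℝ) (i : ℕ) : ℝ :=
  h / (y (i + 1) - y i)

/-- The force `f_i = V'(x_i) + ∑_{j ≠ i} h W'(x_i - x_j)`. -/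
def force (V W : ℝ → ℝ) (N : ℕ) (h : ℝ) (y : ℕ → ℝ) (i : ℕ) : ℝ :=
  deriv V (y i) + ∑ j ∈ (Finset.range (N + 1)).erase i, h * deriv W (y i - y j)

/-- The right-hand side `-β(ρ_i) f_i⁻ - β(ρ_{i-1}) f_i⁺` of the particle system, where
`f_i⁺ = max f_i 0`, `f_i⁻ = min f_i 0` (so that `f_i = f_i⁺ + f_i⁻`), and where the missing
densities `ρ_N` and `ρ_{-1}` at the two ends are replaced by `0`, i.e. `β` by `β(0) = β_max`. -/
def velocity (β V W : ℝ → ℝ) (N : ℕ) (h : ℝ) (y : ℕ → ℝ) (i : ℕ) : ℝ :=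
  - β (if i = N then 0 else cellDensity h y i) * min (force V W N h y i) 0
  - β (if i = 0 then 0 else cellDensity h y (i - 1)) * max (force V W N h y i) 0

/-- `y` is the initial configuration associated with `ρbar`: the end particles sit at the minimum
and the maximum of the support and
`y_i = sup {x | ∫_{y_{i-1}}^x ρbar < h}` for `i = 1, …, N - 1`. -/
structure IsInitialConfiguration (ρbar : ℝ → ℝ) (N : ℕ) (h : ℝ) (y : ℕ → ℝ) : Prop where
  first : IsLeast (essSupport ρbar) (y 0)
  last : IsGreatest (essSupport ρbar) (y N)
  step : ∀ i, 1 ≤ i → i < N → y i = sSup {x : ℝ | ∫ z in (y (i - 1))..x, ρbar z < h}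

/-- `x` is a solution on `[0, T]` of the particle system with `N + 1` particles and `h = m / N`,
started from the initial configuration associated with `ρbar`. The particles stay ordered, which
is what makes the densities and the right-hand side meaningful. -/
structure IsParticleSolution (ρbar β V W : ℝ → ℝ) (T m : ℝ) (N : ℕ) (x : ℝ → ℕ → ℝ) : Prop where
  initial : IsInitialConfiguration ρbar N (m / N) (x 0)
  ordered : ∀ t ∈ Icc 0 T, ∀ i < N, x t i < x t (i + 1)
  ode : ∀ t ∈ Icc 0 T, ∀ i ≤ N,
    HasDerivWithinAt (fun s => x s i) (velocity β V W N (m / N) (x t) i) (Icc 0 T) t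

/-- The piecewise constant density reconstruction `∑_i ρ_i 1_{K_i}` of a configuration. -/
def densityReconstruction (N : ℕ) (h : ℝ) (y : ℕ → ℝ) (z : ℝ) : ℝ :=
  ∑ i ∈ Finset.range N, (Ioo (y i) (y (i + 1))).indicator (fun _ => cellDensity h y i) z

/-- The flux reconstruction `∑_i ρ_i u_i 1_{K_i}` of a configuration `y` with velocities `v`,
where `u_i` interpolates linearly between `v_i` at `y_i` and `v_{i+1}` at `y_{i+1}`. -/
def fluxReconstruction (N : ℕ) (h : ℝ) (y v : ℕ → ℝ) (z : ℝ) : ℝ :=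
  ∑ i ∈ Finset.range N, (Ioo (y i) (y (i + 1))).indicator
    (fun z => cellDensity h y i *
      ((y (i + 1) - z) / (y (i + 1) - y i) * v i + (z - y i) / (y (i + 1) - y i) * v (i + 1))) z

/-- The reconstructed density `ρ̂ᴺ_t(z)` of a trajectory `x` with `N + 1` particles. -/
def rhoHat (m : ℝ) (N : ℕ) (x : ℝ → ℕ → ℝ) (t z : ℝ) : ℝ :=
  densityReconstruction N (m / N) (x t) z

/-- The reconstructed flux `ĵᴺ_t(z)` of a trajectory `x` on `[0, T]` with `N + 1` particles. -/
def fluxHat (T m : ℝ) (N : ℕ) (x : ℝ → ℕ → ℝ) (t z : ℝ) : ℝ :=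
  fluxReconstruction N (m / N) (x t) (fun i => derivWithin (fun s => x s i) (Icc 0 T) t) z

/-! ### The continuity equation -/

/-- The pair `(ρ, j)` belongs to `𝓒𝓔(0, T)`. Only times in `[0, T]` matter. -/
structure IsContinuityPair (T : ℝ) (ρ : ℝ → FiniteMeasure ℝ) (j : ℝ → SignedMeasure ℝ) :
    Prop where
  /-- `t ↦ ρ_t` is weakly-* continuous, i.e. tested against `C₀(ℝ)`. -/
  weakStar_continuous : ∀ φ : C₀(ℝ, ℝ), ContinuousOn (fun t => ∫ x, φ x ∂(ρ t : Measure ℝ)) (Icc 0 T)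
  /-- `(j_t)` is a measurable family. -/
  flux_measurable : ∀ A : Set ℝ, MeasurableSet A → Measurable (fun t : Icc (0 : ℝ) T => j t A)
  /-- `∫_0^T |j_t|(ℝ) dt < ∞`. -/
  flux_finite : ∫⁻ t in Icc 0 T, (j t).variation univ < ⊤
  /-- The continuity equation, tested against bounded Lipschitz functions. -/
  equation : ∀ s t : ℝ, 0 ≤ s → s < t → t ≤ T → ∀ φ : ℝ → ℝ,
    (∃ K : ℝ≥0, LipschitzWith K φ) → (∃ C : ℝ, ∀ x, |φ x| ≤ C) →
      ∫ x, φ x ∂(ρ t : Measure ℝ) - ∫ x, φ x ∂(ρ s : Measure ℝ)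
        = ∫ r in s..t, ∫ᵛ x, deriv φ x ∂•(j r)

end ParticleApprox

end

/-!
The particle approximation is read off its distribution functions `F(t, z) = ∫_{-∞}^z ρ̂_t`. If the
positions, velocities and densities of the particles are bounded uniformly in `N`, these functions
are equi-Lipschitz in `t` and `z`, so a subsequence converges pointwise. The limit `F` is again a
Lipschitz curve of distribution functions, `ρ_t = ∂_z F(t, ·) dz` and `j_t = -∂_t F(t, ·) dz` solve
the continuity equation, and densities and fluxes converge weakly because they are derivatives of
uniformly Lipschitz functions (`IsCDFCurve.isContinuityPair`, `IsCDFCurve.tendsto_integral_density`,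
`IsCDFCurve.tendsto_integral_flux`). The uniform bounds (`exists_apriori_bounds`) come from
Grönwall's inequality and from `β = 0` at large densities, which stops a saturated cell from
shrinking.

Strong convergence of the densities needs compactness in space. It follows once the densities are
close to their averages over intervals of length `δ`, uniformly in `N`
(`IsCDFCurve.tendsto_integral_abs_density_sub`). A bound on the total variation would give this, but
none is available: the force differences over a cell are integrals of the compression
`p + ∑_j h q(· - x_j)` with `p = V''` only continuous and `q`, the absolutely continuous part of
`W''`, only bounded, apart from the contribution of the jump of `W'` at the origin, which is the
same in each cell (`IsMildPotential.exists_decomposition`, `force_sub_force`).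

Therefore the densities are compared with the solution `σ` of a regularised system
(`exists_regularised_solution`), driven by the forces of the true trajectory in the upwind terms,
but with a Lipschitz approximation of the compression. For it the total variation grows in a
controlled way, since the upwind terms have the right sign at local extrema (`totalVariation_le`).
On the other hand the lengths `h / σ_i` stay close to the true lengths of the cells in `ℓ¹`, with an
error proportional to the `L¹` distance of the two compressions, by the `L¹` contraction property of
upwinding (`sum_abs_length_sub_le`). At time zero the total variation of the densities is at most
that of `ρbar` (`exists_initial_variation_bound`). Together this gives
`exists_uniform_boxAverage_bound`.
-/


namespace ParticleApprox

/-! ### Integration tools -/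

lemma integral_toSignedMeasure_smul {μ : Measure ℝ} [IsFiniteMeasure μ] (φ : ℝ → ℝ) :
    ∫ᵛ x, φ x ∂•μ.toSignedMeasure = ∫ x, φ x ∂μ := by
  rw [← VectorMeasure.integral_toSignedMeasure]
  congr 1
  ext
  simp

lemma integral_withDensityᵥ {J φ : ℝ → ℝ} (hJ : Integrable J) (hφ : Measurable φ)
    {C : ℝ} (hb : ∀ x, |φ x| ≤ C) :
    ∫ᵛ x, φ x ∂•(volume.withDensityᵥ J) = ∫ x, φ x * J x := by
  have := isFiniteMeasure_withDensity_ofReal hJ.2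
  have := isFiniteMeasure_withDensity_ofReal hJ.neg.2
  have hbdd : ∀ (μ : Measure ℝ) [IsFiniteMeasure μ], Integrable φ μ := fun μ _ =>
    Integrable.of_bound hφ.aestronglyMeasurable C (ae_of_all _ hb)
  rw [withDensityᵥ_eq_withDensity_pos_part_sub_withDensity_neg_part hJ,
    VectorMeasure.integral_sub_vectorMeasure, integral_toSignedMeasure_smul,
    integral_toSignedMeasure_smul]
  · rw [integral_withDensity_eq_integral_toReal_smul₀, integral_withDensity_eq_integral_toReal_smul₀,
      ← integral_sub]
    · refine integral_congr_ae (ae_of_all _ fun x => ?_)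
      simp only [smul_eq_mul]
      rw [ENNReal.toReal_ofReal', ENNReal.toReal_ofReal', ← sub_mul]
      rcases le_total 0 (J x) with h | h
      · rw [max_eq_left h, max_eq_right (by linarith)]; ring
      · rw [max_eq_right h, max_eq_left (by linarith)]; ring
    · simp only [smul_eq_mul, ENNReal.toReal_ofReal']
      exact hJ.pos_part.mul_bdd (c := C) hφ.aestronglyMeasurable (ae_of_all _ hb)
    · simp only [smul_eq_mul, ENNReal.toReal_ofReal']
      exact hJ.neg_part.mul_bdd (c := C) hφ.aestronglyMeasurable (ae_of_all _ hb)
    · exact hJ.neg.aestronglyMeasurable.aemeasurable.ennreal_ofReal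
    · exact ae_of_all _ fun _ => ENNReal.ofReal_lt_top
    · exact hJ.aestronglyMeasurable.aemeasurable.ennreal_ofReal
    · exact ae_of_all _ fun _ => ENNReal.ofReal_lt_top
  · rw [VectorMeasure.Integrable, Measure.variation_toSignedMeasure]; exact hbdd _
  · rw [VectorMeasure.Integrable, Measure.variation_toSignedMeasure]; exact hbdd _

lemma intervalIntegrable_mul_deriv {a b : ℝ} (hab : a ≤ b) {K : ℝ≥0} {g φ : ℝ → ℝ}
    (hg : LipschitzWith K g) (hφ : ContinuousOn φ (Icc a b)) :
    IntervalIntegrable (fun x => φ x * deriv g x) volume a b :=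
  ((hg.lipschitzOnWith (s := uIcc a b)).absolutelyContinuousOnInterval
    ).intervalIntegrable_deriv.continuousOn_mul (by rwa [uIcc_of_le hab])

/-- Weak convergence of derivatives: integration by parts against polynomials, which are dense. -/
lemma tendsto_integral_mul_deriv {a b : ℝ} (hab : a ≤ b) {K : ℝ≥0} {g : ℕ → ℝ → ℝ} {g₀ : ℝ → ℝ}
    (hg : ∀ k, LipschitzWith K (g k)) (h0 : LipschitzWith K g₀)
    (hlim : ∀ x, Tendsto (fun k => g k x) atTop (𝓝 (g₀ x))) {φ : ℝ → ℝ}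
    (hφ : ContinuousOn φ (Icc a b)) :
    Tendsto (fun k => ∫ x in a..b, φ x * deriv (g k) x) atTop
      (𝓝 (∫ x in a..b, φ x * deriv g₀ x)) := by
  have key : ∀ p : Polynomial ℝ, Tendsto (fun k => ∫ x in a..b, p.eval x * deriv (g k) x) atTop
      (𝓝 (∫ x in a..b, p.eval x * deriv g₀ x)) := by
    intro p
    have hp : AbsolutelyContinuousOnInterval (fun x => p.eval x) a b := by
      have := (p.contDiff_aeval (𝕜 := ℝ) 1).contDiffOn (s := uIcc a b)
      simpa [Polynomial.coe_aeval_eq_eval] using this.absolutelyContinuousOnInterval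
    have ibp : ∀ f : ℝ → ℝ, LipschitzWith K f → ∫ x in a..b, p.eval x * deriv f x
        = p.eval b * f b - p.eval a * f a - ∫ x in a..b, p.derivative.eval x * f x := by
      intro f hf
      rw [hp.integral_mul_deriv_eq_deriv_mul
        (hf.lipschitzOnWith (s := uIcc a b)).absolutelyContinuousOnInterval]
      simp
    rw [ibp g₀ h0]
    simp_rw [fun k => ibp (g k) (hg k)]
    refine (((hlim b).const_mul _).sub ((hlim a).const_mul _)).sub ?_
    -- the functions are uniformly bounded because they converge at `a`
    obtain ⟨C, hC⟩ := (hlim a).bddAbove_range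
    obtain ⟨C', hC'⟩ := (hlim a).bddBelow_range
    obtain ⟨D, hD⟩ := isCompact_Icc.exists_bound_of_continuousOn (s := Icc a b)
      (f := fun x => p.derivative.eval x) (by fun_prop)
    refine intervalIntegral.tendsto_integral_filter_of_dominated_convergence
      (fun _ => D * (|C| + |C'| + K * (b - a))) ?_ ?_ ?_ ?_
    · exact Eventually.of_forall fun k =>
        (by have := (hg k).continuous; fun_prop : Continuous _).aestronglyMeasurable
    · refine Eventually.of_forall fun k => ae_of_all _ fun x hx => ?_
      rw [uIoc_of_le hab] at hx
      have hx' : x ∈ Icc a b := ⟨hx.1.le, hx.2⟩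
      have h1 := hD x hx'
      have h2 := (hg k).dist_le_mul x a
      rw [Real.dist_eq, Real.dist_eq, abs_of_nonneg (sub_nonneg.2 hx'.1)] at h2
      have h3 : |g k a| ≤ |C| + |C'| := by
        have h4 := hC (mem_range_self k)
        have h5 := hC' (mem_range_self k)
        rw [abs_le]; constructor <;> cases abs_cases C <;> cases abs_cases C' <;> linarith
      have h4 : |g k x| ≤ |C| + |C'| + K * (b - a) := by
        have : (K : ℝ) * (x - a) ≤ K * (b - a) := by gcongr; exact hx'.2
        have := abs_sub_abs_le_abs_sub (g k x) (g k a)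
        linarith
      rw [norm_mul]
      exact mul_le_mul h1 h4 (abs_nonneg _) ((norm_nonneg _).trans h1)
    · exact intervalIntegrable_const
    · exact ae_of_all _ fun x _ => (hlim x).const_mul _
  rw [Metric.tendsto_nhds]
  intro ε hε
  set η : ℝ := ε / (4 * (K + 1) * (b - a + 1)) with hη
  have hba : 0 < b - a + 1 := by linarith
  have hK : (0 : ℝ) ≤ K := K.2
  have hηpos : 0 < η := by positivity
  obtain ⟨p, hp⟩ := exists_polynomial_near_of_continuousOn a b φ hφ η hηpos
  have hpc : ContinuousOn (fun x => p.eval x) (Icc a b) := by fun_prop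
  have hclose : ∀ f : ℝ → ℝ, LipschitzWith K f →
      |(∫ x in a..b, φ x * deriv f x) - ∫ x in a..b, p.eval x * deriv f x| ≤ ε / 4 := by
    intro f hf
    rw [← intervalIntegral.integral_sub (intervalIntegrable_mul_deriv hab hf hφ)
      (intervalIntegrable_mul_deriv hab hf hpc)]
    have : ∀ x ∈ uIoc a b, ‖φ x * deriv f x - p.eval x * deriv f x‖ ≤ η * K := by
      intro x hx
      rw [uIoc_of_le hab] at hx
      rw [← sub_mul, norm_mul]
      have h1 := (hp x ⟨hx.1.le, hx.2⟩).le
      rw [abs_sub_comm] at h1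
      exact mul_le_mul h1 (norm_deriv_le_of_lipschitz hf) (norm_nonneg _) hηpos.le
    have h2 := intervalIntegral.norm_integral_le_of_norm_le_const this
    rw [abs_of_nonneg (sub_nonneg.2 hab)] at h2
    refine h2.trans ?_
    calc η * K * (b - a) ≤ η * (K + 1) * (b - a + 1) := by gcongr <;> linarith
      _ = ε / 4 := by rw [hη]; field_simp
  filter_upwards [Metric.tendsto_nhds.1 (key p) (ε / 2) (by linarith)] with k hk
  rw [Real.dist_eq] at hk ⊢
  have h1 := hclose (g k) (hg k)
  have h2 := hclose g₀ h0
  rw [abs_lt] at *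
  rw [abs_le] at *
  constructor <;> linarith [hk.1, hk.2, h1.1, h1.2, h2.1, h2.2]

/-! ### Curves of measures through their distribution functions -/

/-- `F t` is the distribution function of a measure of mass `m` on `[-R, R]` whose density is
bounded by `M`, and the flux `-∂ₜF` is bounded by `L`. -/
structure IsCDFCurve (M L : ℝ≥0) (R m : ℝ) (F : ℝ → ℝ → ℝ) : Prop where
  radius_nonneg : 0 ≤ R
  lip_time : ∀ z, LipschitzWith L (fun t => F t z)
  lip_space : ∀ t, LipschitzWith M (F t)
  mono : ∀ t, Monotone (F t)
  left : ∀ t z, z ≤ -R → F t z = 0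
  right : ∀ t z, R ≤ z → F t z = m

/-- The flux `-∂ₜF` of a curve of distribution functions. -/
noncomputable def cdfFlux (F : ℝ → ℝ → ℝ) (t z : ℝ) : ℝ := -deriv (fun s => F s z) t

namespace IsCDFCurve

variable {M L : ℝ≥0} {R m : ℝ} {F : ℝ → ℝ → ℝ}

lemma continuous_uncurry (hF : IsCDFCurve M L R m F) : Continuous (Function.uncurry F) := by
  have := LipschitzWith.uncurry hF.lip_time hF.lip_space
  exact this.continuous

lemma measurable_density (hF : IsCDFCurve M L R m F) :
    Measurable (fun p : ℝ × ℝ => deriv (F p.1) p.2) :=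
  measurable_deriv_with_param hF.continuous_uncurry

lemma measurable_flux (hF : IsCDFCurve M L R m F) :
    Measurable (fun p : ℝ × ℝ => cdfFlux F p.1 p.2) := by
  have h : Continuous (Function.uncurry fun z s => F s z) :=
    hF.continuous_uncurry.comp continuous_swap
  exact ((measurable_deriv_with_param h).comp measurable_swap).neg

lemma density_nonneg (hF : IsCDFCurve M L R m F) (t z : ℝ) : 0 ≤ deriv (F t) z :=
  (hF.mono t).deriv_nonneg

lemma norm_density_le (hF : IsCDFCurve M L R m F) (t z : ℝ) : ‖deriv (F t) z‖ ≤ M :=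
  norm_deriv_le_of_lipschitz (hF.lip_space t)

lemma norm_flux_le (hF : IsCDFCurve M L R m F) (t z : ℝ) : ‖cdfFlux F t z‖ ≤ L := by
  rw [cdfFlux, norm_neg]
  exact norm_deriv_le_of_lipschitz (hF.lip_time z)

lemma density_eq_zero (hF : IsCDFCurve M L R m F) (t : ℝ) {z : ℝ} (hz : z ∉ Icc (-R) R) :
    deriv (F t) z = 0 := by
  rw [mem_Icc, not_and_or, not_le, not_le] at hz
  rcases hz with hz | hz
  · have : F t =ᶠ[𝓝 z] fun _ => 0 := by
      filter_upwards [Iio_mem_nhds hz] with w hw using hF.left t w (le_of_lt hw)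
    rw [this.deriv_eq, deriv_const]
  · have : F t =ᶠ[𝓝 z] fun _ => m := by
      filter_upwards [Ioi_mem_nhds hz] with w hw using hF.right t w (le_of_lt hw)
    rw [this.deriv_eq, deriv_const]

lemma flux_eq_zero (hF : IsCDFCurve M L R m F) (t : ℝ) {z : ℝ} (hz : z ∉ Icc (-R) R) :
    cdfFlux F t z = 0 := by
  rw [mem_Icc, not_and_or, not_le, not_le] at hz
  rcases hz with hz | hz
  · simp [cdfFlux, hF.left _ z hz.le]
  · simp [cdfFlux, hF.right _ z hz.le]

lemma integrable_density (hF : IsCDFCurve M L R m F) (t : ℝ) : Integrable (deriv (F t)) := by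
  rw [← integrableOn_iff_integrable_of_support_subset (s := Icc (-R) R)]
  · exact IntegrableOn.of_bound (by simp) (measurable_deriv _).aestronglyMeasurable M
      (ae_of_all _ (hF.norm_density_le t))
  · intro z hz
    by_contra h
    exact hz (hF.density_eq_zero t h)

lemma integrable_flux (hF : IsCDFCurve M L R m F) (t : ℝ) : Integrable (cdfFlux F t) := by
  rw [← integrableOn_iff_integrable_of_support_subset (s := Icc (-R) R)]
  · exact IntegrableOn.of_bound (by simp)
      (hF.measurable_flux.comp measurable_prodMk_left).aestronglyMeasurable L
      (ae_of_all _ (hF.norm_flux_le t))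
  · intro z hz
    by_contra h
    exact hz (hF.flux_eq_zero t h)

lemma integral_density_eq (hF : IsCDFCurve M L R m F) (t : ℝ) (φ : ℝ → ℝ) :
    ∫ z, φ z * deriv (F t) z = ∫ z in (-R)..R, φ z * deriv (F t) z := by
  rw [intervalIntegral.integral_of_le (by linarith [hF.radius_nonneg]),
    ← integral_Icc_eq_integral_Ioc]
  exact (setIntegral_eq_integral_of_forall_compl_eq_zero fun z hz => by
    rw [hF.density_eq_zero t hz, mul_zero]).symm

lemma integral_flux_eq (hF : IsCDFCurve M L R m F) (t : ℝ) (φ : ℝ → ℝ) :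
    ∫ z, φ z * cdfFlux F t z = ∫ z in (-R)..R, φ z * cdfFlux F t z := by
  rw [intervalIntegral.integral_of_le (by linarith [hF.radius_nonneg]),
    ← integral_Icc_eq_integral_Ioc]
  exact (setIntegral_eq_integral_of_forall_compl_eq_zero fun z hz => by
    rw [hF.flux_eq_zero t hz, mul_zero]).symm

/-- The measure with distribution function `F t`. -/
noncomputable def measureAt (hF : IsCDFCurve M L R m F) (t : ℝ) : FiniteMeasure ℝ :=
  ⟨volume.withDensity fun z => ENNReal.ofReal (deriv (F t) z),
    isFiniteMeasure_withDensity_ofReal (hF.integrable_density t).2⟩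

lemma integral_measureAt (hF : IsCDFCurve M L R m F) (t : ℝ) (φ : ℝ → ℝ) :
    ∫ z, φ z ∂(hF.measureAt t : Measure ℝ) = ∫ z, φ z * deriv (F t) z := by
  change ∫ z, φ z ∂(volume.withDensity fun z => ENNReal.ofReal (deriv (F t) z)) = _
  rw [integral_withDensity_eq_integral_toReal_smul (measurable_deriv _).ennreal_ofReal
    (ae_of_all _ fun _ => ENNReal.ofReal_lt_top)]
  refine integral_congr_ae (ae_of_all _ fun z => ?_)
  simp [ENNReal.toReal_ofReal (hF.density_nonneg t z), mul_comm]

/-- The signed measure with density `-∂ₜF`. -/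
noncomputable def fluxAt (F : ℝ → ℝ → ℝ) (t : ℝ) : SignedMeasure ℝ :=
  volume.withDensityᵥ (cdfFlux F t)

lemma integral_fluxAt (hF : IsCDFCurve M L R m F) (t : ℝ) {φ : ℝ → ℝ} (hφ : Measurable φ)
    {C : ℝ} (hb : ∀ x, |φ x| ≤ C) :
    ∫ᵛ z, φ z ∂•(fluxAt F t) = ∫ z, φ z * cdfFlux F t z :=
  integral_withDensityᵥ (hF.integrable_flux t) hφ hb

/-- The measure of the curve against a bounded Lipschitz function, by parts. -/
lemma integral_density_eq_sub (hF : IsCDFCurve M L R m F) (t : ℝ) {φ : ℝ → ℝ} {K : ℝ≥0}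
    (hφ : LipschitzWith K φ) :
    ∫ z, φ z * deriv (F t) z = φ R * m - ∫ z in (-R)..R, deriv φ z * F t z := by
  rw [hF.integral_density_eq,
    (hφ.lipschitzOnWith (s := uIcc (-R) R)).absolutelyContinuousOnInterval
      |>.integral_mul_deriv_eq_deriv_mul
      ((hF.lip_space t).lipschitzOnWith (s := uIcc (-R) R)).absolutelyContinuousOnInterval,
    hF.left t _ le_rfl, hF.right t _ le_rfl]
  ring

lemma sub_eq_integral_flux (hF : IsCDFCurve M L R m F) (s t z : ℝ) :
    F s z - F t z = ∫ r in s..t, cdfFlux F r z := by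
  simp only [cdfFlux]
  rw [intervalIntegral.integral_neg,
    ((hF.lip_time z).lipschitzOnWith (s := uIcc s t)).absolutelyContinuousOnInterval
      |>.integral_deriv_eq_sub]
  ring

/-- The continuity equation in integrated form. Density and flux are derivatives of `F`, so that an
integration by parts in space turns it into the fundamental theorem of calculus in time. -/
lemma continuity_equation (hF : IsCDFCurve M L R m F) {s t : ℝ} (hst : s ≤ t) {φ : ℝ → ℝ}
    {K : ℝ≥0} (hφ : LipschitzWith K φ) :
    (∫ z, φ z * deriv (F t) z) - ∫ z, φ z * deriv (F s) z
      = ∫ r in s..t, ∫ z, deriv φ z * cdfFlux F r z := by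
  have hR := hF.radius_nonneg
  have hR' : -R ≤ R := by linarith
  have hφ' : ∀ z, ‖deriv φ z‖ ≤ K := fun z => norm_deriv_le_of_lipschitz hφ
  have hint : ∀ r, IntervalIntegrable (fun z => deriv φ z * F r z) volume (-R) R := fun r =>
    ((hφ.lipschitzOnWith (s := uIcc (-R) R)).absolutelyContinuousOnInterval
      ).intervalIntegrable_deriv.mul_continuousOn (hF.lip_space r).continuous.continuousOn
  rw [hF.integral_density_eq_sub t hφ, hF.integral_density_eq_sub s hφ]
  have h1 : φ R * m - (∫ z in (-R)..R, deriv φ z * F t z)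
      - (φ R * m - ∫ z in (-R)..R, deriv φ z * F s z)
      = ∫ z in (-R)..R, ∫ r in s..t, deriv φ z * cdfFlux F r z := by
    have : ∀ z, ∫ r in s..t, deriv φ z * cdfFlux F r z = deriv φ z * F s z - deriv φ z * F t z := by
      intro z
      rw [intervalIntegral.integral_const_mul, ← hF.sub_eq_integral_flux, mul_sub]
    simp_rw [this]
    rw [intervalIntegral.integral_sub (hint s) (hint t)]
    ring
  rw [h1]
  simp_rw [fun r => hF.integral_flux_eq r (deriv φ)]
  simp_rw [intervalIntegral.integral_of_le hst, intervalIntegral.integral_of_le hR']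
  rw [integral_integral_swap]
  refine Integrable.of_bound (C := K * L) ?_ (ae_of_all _ fun p => ?_)
  · exact (((measurable_deriv φ).comp measurable_fst).mul
      (hF.measurable_flux.comp measurable_swap)).aestronglyMeasurable
  · rw [Function.uncurry, norm_mul]
    exact mul_le_mul (hφ' _) (hF.norm_flux_le _ _) (norm_nonneg _) K.2

/-- Pointwise convergence of distribution functions with bounded densities gives convergence
of the measures, tested against continuous functions. -/
lemma tendsto_integral_density {Fk : ℕ → ℝ → ℝ} {F₀ : ℝ → ℝ} {tk : ℕ → ℝ} {t : ℝ}
    {Gk : ℕ → ℝ → ℝ → ℝ} (hG : ∀ k, IsCDFCurve M L R m (Gk k)) (hF : IsCDFCurve M L R m F)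
    (hk : ∀ k, Fk k = Gk k (tk k)) (h0 : F₀ = F t)
    (hlim : ∀ z, Tendsto (fun k => Fk k z) atTop (𝓝 (F₀ z))) {φ : ℝ → ℝ} (hφ : Continuous φ) :
    Tendsto (fun k => ∫ z, φ z * deriv (Fk k) z) atTop (𝓝 (∫ z, φ z * deriv F₀ z)) := by
  subst h0
  obtain rfl : Fk = fun k => Gk k (tk k) := funext hk
  simp_rw [fun k => (hG k).integral_density_eq (tk k) φ, hF.integral_density_eq t φ]
  exact tendsto_integral_mul_deriv (by linarith [hF.radius_nonneg])
    (fun k => (hG k).lip_space (tk k)) (hF.lip_space t) hlim hφ.continuousOn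

lemma isContinuityPair (hF : IsCDFCurve M L R m F) (T : ℝ) :
    IsContinuityPair T hF.measureAt (fluxAt F) where
  weakStar_continuous φ := by
    refine Continuous.continuousOn (continuous_iff_seqContinuous.2 fun tk t htk => ?_)
    simp_rw [Function.comp_def, hF.integral_measureAt]
    refine tendsto_integral_density (fun _ => hF) hF (fun k => rfl) rfl (fun z => ?_) φ.continuous
    exact ((hF.lip_time z).continuous.tendsto t).comp htk
  flux_measurable A hA := by
    have : (fun t : Icc (0 : ℝ) T => fluxAt F t A)
        = fun t : Icc (0 : ℝ) T => ∫ z in A, cdfFlux F t z := by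
      ext t
      rw [fluxAt, withDensityᵥ_apply (hF.integrable_flux t) hA]
    rw [this]
    exact ((hF.measurable_flux.stronglyMeasurable.integral_prod_right
      (f := fun t z => cdfFlux F t z) (ν := volume.restrict A)).measurable).comp
        measurable_subtype_coe
  flux_finite := by
    have hle : ∀ t, (fluxAt F t).variation univ ≤ L * volume (Icc (-R) R) := by
      intro t
      rw [fluxAt, Measure.variation_withDensityᵥ (hF.integrable_flux t), withDensity_apply _ .univ,
        Measure.restrict_univ]
      calc ∫⁻ z, ‖cdfFlux F t z‖ₑ ≤ ∫⁻ z, (Icc (-R) R).indicator (fun _ => (L : ℝ≥0∞)) z := by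
            refine lintegral_mono fun z => ?_
            by_cases hz : z ∈ Icc (-R) R
            · rw [indicator_of_mem hz]
              have := hF.norm_flux_le t z
              exact enorm_le_coe.2 this
            · simp [hF.flux_eq_zero t hz]
        _ = L * volume (Icc (-R) R) := by
            rw [lintegral_indicator measurableSet_Icc, setLIntegral_const]
    calc ∫⁻ t in Icc 0 T, (fluxAt F t).variation univ
        ≤ ∫⁻ _ in Icc 0 T, L * volume (Icc (-R) R) := lintegral_mono hle
      _ < ⊤ := by
          rw [setLIntegral_const]
          exact ENNReal.mul_lt_top (ENNReal.mul_lt_top ENNReal.coe_lt_top (by simp)) (by simp)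
  equation s t _ hst _ φ hφ hb := by
    obtain ⟨K, hK⟩ := hφ
    rw [hF.integral_measureAt, hF.integral_measureAt, hF.continuity_equation hst.le hK]
    refine intervalIntegral.integral_congr fun r _ => ?_
    exact (hF.integral_fluxAt r (measurable_deriv φ)
      (fun z => norm_deriv_le_of_lipschitz hK)).symm

/-- Curves of distribution functions with common bounds are compact for pointwise convergence: a
subsequence converges at all rational points, hence everywhere. -/
lemma exists_subseq_tendsto (Fk : ℕ → ℝ → ℝ → ℝ) (hk : ∀ k, IsCDFCurve M L R m (Fk k)) :
    ∃ F, IsCDFCurve M L R m F ∧ ∃ n : ℕ → ℕ, StrictMono n ∧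
      ∀ t z, Tendsto (fun k => Fk (n k) t z) atTop (𝓝 (F t z)) := by
  have hbd : ∀ k t z, Fk k t z ∈ Icc 0 m := by
    intro k t z
    have h1 := (hk k).mono t (min_le_left z (-R))
    have h2 := (hk k).mono t (le_max_left z R)
    rw [(hk k).left t _ (min_le_right _ _)] at h1
    rw [(hk k).right t _ (le_max_right _ _)] at h2
    exact ⟨h1, h2⟩
  have hcomp : IsCompact (univ.pi fun _ : ℚ × ℚ => Icc 0 m) :=
    isCompact_univ_pi fun _ => isCompact_Icc
  obtain ⟨a, -, n, hn, ha⟩ := hcomp.tendsto_subseq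
    (x := fun k (q : ℚ × ℚ) => Fk k q.1 q.2) (fun k q _ => hbd k _ _)
  rw [tendsto_pi_nhds] at ha
  -- convergence at rational points spreads by equicontinuity
  have hcauchy : ∀ t z, CauchySeq fun k => Fk (n k) t z := by
    intro t z
    rw [Metric.cauchySeq_iff']
    intro ε hε
    have hpos : 0 < ε / (4 * (M + L + 1)) := by positivity
    obtain ⟨p, hp⟩ := Rat.denseRange_cast (𝕜 := ℝ) |>.exists_dist_lt t hpos
    obtain ⟨q, hq⟩ := Rat.denseRange_cast (𝕜 := ℝ) |>.exists_dist_lt z hpos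
    have hclose : ∀ k, dist (Fk k t z) (Fk k p q) ≤ ε / 4 := by
      intro k
      have h1 := ((hk k).lip_time z).dist_le_mul t p
      have h2 := ((hk k).lip_space p).dist_le_mul z q
      have h3 := dist_triangle (Fk k t z) (Fk k p z) (Fk k p q)
      have h4 : (L : ℝ) * dist t p + M * dist z q ≤ (M + L + 1) * (ε / (4 * (M + L + 1))) := by
        have := mul_le_mul_of_nonneg_left hp.le L.2
        have := mul_le_mul_of_nonneg_left hq.le M.2
        nlinarith
      have h5 : ((M : ℝ) + L + 1) * (ε / (4 * (M + L + 1))) = ε / 4 := by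
        have : (0 : ℝ) < M + L + 1 := by positivity
        field_simp
      linarith
    obtain ⟨N, hN⟩ := Metric.cauchySeq_iff'.1 (ha (p, q)).cauchySeq (ε / 2) (by linarith)
    refine ⟨N, fun k hkN => ?_⟩
    have h1 := hclose (n k)
    have h2 := hclose (n N)
    have h3 := hN k hkN
    simp only [Function.comp_def] at h3
    have h4 := dist_triangle4 (Fk (n k) t z) (Fk (n k) p q) (Fk (n N) p q) (Fk (n N) t z)
    rw [dist_comm (Fk (n N) p q)] at h4
    linarith
  choose F hF using fun t z => cauchySeq_tendsto_of_complete (hcauchy t z)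
  refine ⟨F, ⟨(hk 0).radius_nonneg, fun z => ?_, fun t => ?_, fun t z w hzw => ?_, fun t z hz => ?_,
    fun t z hz => ?_⟩, n, hn, hF⟩
  · refine LipschitzWith.of_dist_le_mul fun s t => ?_
    exact le_of_tendsto ((hF s z).dist (hF t z)) (Eventually.of_forall fun k =>
      ((hk (n k)).lip_time z).dist_le_mul s t)
  · refine LipschitzWith.of_dist_le_mul fun z w => ?_
    exact le_of_tendsto ((hF t z).dist (hF t w)) (Eventually.of_forall fun k =>
      ((hk (n k)).lip_space t).dist_le_mul z w)
  · exact le_of_tendsto_of_tendsto' (hF t z) (hF t w) fun k => (hk (n k)).mono t hzw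
  · exact tendsto_nhds_unique (hF t z) (by simp [fun k => (hk k).left t z hz])
  · exact tendsto_nhds_unique (hF t z) (by simp [fun k => (hk k).right t z hz])

/-- Weak convergence of the fluxes: for fixed `z` they are time derivatives of uniformly Lipschitz
functions. -/
lemma tendsto_integral_flux {Fk : ℕ → ℝ → ℝ → ℝ} (hk : ∀ k, IsCDFCurve M L R m (Fk k))
    (hF : IsCDFCurve M L R m F) (hlim : ∀ t z, Tendsto (fun k => Fk k t z) atTop (𝓝 (F t z)))
    {T : ℝ} (hT : 0 ≤ T) {φ : ℝ → ℝ → ℝ} (hφ : Continuous (Function.uncurry φ)) {C : ℝ}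
    (hb : ∀ t z, |φ t z| ≤ C) :
    Tendsto (fun k => ∫ t in (0)..T, ∫ z, φ t z * cdfFlux (Fk k) t z) atTop
      (𝓝 (∫ t in (0)..T, ∫ z, φ t z * cdfFlux F t z)) := by
  have hR' : -R ≤ R := by linarith [hF.radius_nonneg]
  have swap : ∀ G, IsCDFCurve M L R m G → ∫ t in (0)..T, ∫ z, φ t z * cdfFlux G t z
      = ∫ z in (-R)..R, ∫ t in (0)..T, φ t z * cdfFlux G t z := by
    intro G hG
    simp_rw [fun t => hG.integral_flux_eq t (φ t), intervalIntegral.integral_of_le hT,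
      intervalIntegral.integral_of_le hR']
    rw [integral_integral_swap]
    refine Integrable.of_bound (C := C * L) ?_ (ae_of_all _ fun p => ?_)
    · exact (hφ.measurable.mul hG.measurable_flux).aestronglyMeasurable
    · rw [Function.uncurry, norm_mul]
      exact mul_le_mul (hb _ _) (hG.norm_flux_le _ _) (norm_nonneg _)
        ((abs_nonneg _).trans (hb p.1 p.2))
  rw [swap F hF]
  simp_rw [fun k => swap (Fk k) (hk k)]
  have hC : 0 ≤ C := (abs_nonneg _).trans (hb 0 0)
  refine intervalIntegral.tendsto_integral_filter_of_dominated_convergence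
    (fun _ => C * L * T) ?_ ?_ intervalIntegrable_const ?_
  · refine Eventually.of_forall fun k => ?_
    simp_rw [intervalIntegral.integral_of_le hT]
    exact (((hφ.comp continuous_swap).measurable.mul
      ((hk k).measurable_flux.comp measurable_swap)).stronglyMeasurable.integral_prod_right
        (f := fun z t => φ t z * cdfFlux (Fk k) t z)
        (ν := volume.restrict (Ioc 0 T))).aestronglyMeasurable
  · refine Eventually.of_forall fun k => ae_of_all _ fun z _ => ?_
    have := intervalIntegral.norm_integral_le_of_norm_le_const (a := 0) (b := T) (C := C * L)
      (f := fun t => φ t z * cdfFlux (Fk k) t z) (fun t _ => by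
        rw [norm_mul]
        exact mul_le_mul (hb _ _) ((hk k).norm_flux_le _ _) (norm_nonneg _) hC)
    rwa [sub_zero, abs_of_nonneg hT] at this
  · refine ae_of_all _ fun z _ => ?_
    have := tendsto_integral_mul_deriv hT (fun k => (hk k).lip_time z) (hF.lip_time z)
      (fun t => hlim t z) (φ := fun t => φ t z)
      (hφ.comp (continuous_id.prodMk continuous_const)).continuousOn
    simpa [cdfFlux] using this.neg

/-- The difference quotient of `F t` at scale `δ`, i.e. the average of the density over
`[z, z + δ]`. -/
noncomputable def boxAverage (F : ℝ → ℝ → ℝ) (t δ z : ℝ) : ℝ := (F t (z + δ) - F t z) / δ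

lemma continuous_boxAverage (hF : IsCDFCurve M L R m F) (t δ : ℝ) :
    Continuous (boxAverage F t δ) := by
  have := (hF.lip_space t).continuous
  unfold boxAverage
  fun_prop

lemma norm_boxAverage_le (hF : IsCDFCurve M L R m F) (t : ℝ) {δ : ℝ} (hδ : 0 < δ) (z : ℝ) :
    ‖boxAverage F t δ z‖ ≤ M := by
  rw [boxAverage, norm_div, Real.norm_of_nonneg hδ.le, div_le_iff₀ hδ]
  have := (hF.lip_space t).dist_le_mul (z + δ) z
  rwa [Real.dist_eq, Real.dist_eq, add_sub_cancel_left, abs_of_pos hδ] at this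

lemma boxAverage_eq_zero (hF : IsCDFCurve M L R m F) (t : ℝ) {δ : ℝ} (hδ : 0 < δ) (hδ' : δ ≤ 1)
    {z : ℝ} (hz : z ∉ Icc (-(R + 1)) (R + 1)) : boxAverage F t δ z = 0 := by
  rw [mem_Icc, not_and_or, not_le, not_le] at hz
  rcases hz with hz | hz
  · rw [boxAverage, hF.left t _ (by linarith), hF.left t _ (by linarith), sub_self, zero_div]
  · rw [boxAverage, hF.right t _ (by linarith), hF.right t _ (by linarith), sub_self, zero_div]

/-- Dominated convergence for uniformly bounded functions with a common compact support. -/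
lemma tendsto_integral_abs_of_bounded {f : ℕ → ℝ → ℝ} {B S : ℝ}
    (hm : ∀ k, AEStronglyMeasurable (f k)) (hb : ∀ k z, |f k z| ≤ B)
    (hs : ∀ k, ∀ z ∉ Icc (-S) S, f k z = 0)
    (hlim : ∀ᵐ z, Tendsto (fun k => f k z) atTop (𝓝 0)) :
    Tendsto (fun k => ∫ z, |f k z|) atTop (𝓝 0) := by
  have h := tendsto_integral_of_dominated_convergence (μ := (volume : Measure ℝ))
    (F := fun k z => |f k z|) (f := fun _ => 0)
    ((Icc (-S) S).indicator fun _ => B) (fun k => (hm k).norm)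
    ((integrable_indicator_iff measurableSet_Icc).2 (by simp)) ?_ ?_
  · simpa using h
  · refine fun k => ae_of_all _ fun z => ?_
    rw [norm_abs_eq_norm, Real.norm_eq_abs]
    by_cases hz : z ∈ Icc (-S) S
    · rw [indicator_of_mem hz]; exact hb k z
    · rw [indicator_of_notMem hz, hs k z hz, abs_zero]
  · filter_upwards [hlim] with z hz
    simpa using hz.abs

lemma integrable_boxAverage (hF : IsCDFCurve M L R m F) (t : ℝ) {δ : ℝ} (hδ : 0 < δ)
    (hδ' : δ ≤ 1) : Integrable (boxAverage F t δ) := by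
  rw [← integrableOn_iff_integrable_of_support_subset (s := Icc (-(R + 1)) (R + 1))]
  · exact IntegrableOn.of_bound (by simp) (hF.continuous_boxAverage t δ).aestronglyMeasurable M
      (ae_of_all _ (hF.norm_boxAverage_le t hδ))
  · intro z hz
    by_contra h
    exact hz (hF.boxAverage_eq_zero t hδ hδ' h)

/-- Strong convergence of the densities: pointwise convergence of the distribution functions makes
the averages at a fixed scale converge, and the densities are uniformly close to their averages. -/
lemma tendsto_integral_abs_density_sub {Fk : ℕ → ℝ → ℝ → ℝ}
    (hk : ∀ k, IsCDFCurve M L R m (Fk k)) (hF : IsCDFCurve M L R m F) (t : ℝ)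
    (hlim : ∀ z, Tendsto (fun k => Fk k t z) atTop (𝓝 (F t z)))
    (hcomp : ∀ ε > 0, ∃ C, ∀ k, ∀ δ > 0, δ ≤ 1 →
      ∫ z, |deriv (Fk k t) z - boxAverage (Fk k) t δ z| ≤ ε + C * δ) :
    Tendsto (fun k => ∫ z, |deriv (Fk k t) z - deriv (F t) z|) atTop (𝓝 0) := by
  have hδpos : ∀ n : ℕ, (0 : ℝ) < 1 / (n + 1) := fun n => Nat.one_div_pos_of_nat
  have hδone : ∀ n : ℕ, (1 : ℝ) / (n + 1) ≤ 1 := fun n => by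
    rw [div_le_one (by positivity)]; linarith [n.cast_nonneg (α := ℝ)]
  have hδ0 := tendsto_one_div_add_atTop_nhds_zero_nat (𝕜 := ℝ)
  -- the averages of the limit density converge to it, by differentiation of a Lipschitz function
  have hF0 : Tendsto (fun n : ℕ => ∫ z, |boxAverage F t (1 / (n + 1)) z - deriv (F t) z|) atTop
      (𝓝 0) := by
    refine tendsto_integral_abs_of_bounded (B := M + M) (S := R + 1)
      (fun n => ((hF.continuous_boxAverage t _).measurable.sub
        (measurable_deriv _)).aestronglyMeasurable) (fun n z => ?_) (fun n z hz => ?_) ?_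
    · exact (abs_sub _ _).trans (add_le_add (hF.norm_boxAverage_le t (hδpos n) z)
        (hF.norm_density_le t z))
    · rw [hF.boxAverage_eq_zero t (hδpos n) (hδone n) hz, hF.density_eq_zero t, sub_zero]
      exact fun h => hz ⟨by linarith [h.1], by linarith [h.2]⟩
    · filter_upwards [(hF.lip_space t).ae_differentiableAt_real] with z hz
      have h1 : Tendsto (fun n : ℕ => (1 : ℝ) / (n + 1)) atTop (𝓝[≠] 0) :=
        tendsto_nhdsWithin_iff.2 ⟨hδ0, Eventually.of_forall fun n => (hδpos n).ne'⟩
      have h2 := hz.hasDerivAt.tendsto_slope_zero.comp h1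
      have h3 := h2.sub_const (deriv (F t) z)
      rw [sub_self] at h3
      refine h3.congr fun n => ?_
      simp [boxAverage, div_eq_inv_mul]
  rw [Metric.tendsto_nhds]
  intro ε hε
  obtain ⟨C, hC⟩ := hcomp (ε / 4) (by linarith)
  have hev : ∀ᶠ n : ℕ in atTop, C * (1 / (n + 1) : ℝ) < ε / 4 := by
    have := hδ0.const_mul C
    rw [mul_zero] at this
    exact this.eventually_lt_const (by linarith)
  obtain ⟨n, hn1, hn2⟩ := (hev.and (hF0.eventually_lt_const (show 0 < ε / 4 by linarith))).exists
  set δ : ℝ := 1 / (n + 1) with hδ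
  have hmid : Tendsto (fun k => ∫ z, |boxAverage (Fk k) t δ z - boxAverage F t δ z|) atTop
      (𝓝 0) := by
    refine tendsto_integral_abs_of_bounded (B := M + M) (S := R + 1)
      (fun k => (((hk k).continuous_boxAverage t _).sub
        (hF.continuous_boxAverage t _)).aestronglyMeasurable) (fun k z => ?_) (fun k z hz => ?_) ?_
    · exact (abs_sub _ _).trans (add_le_add ((hk k).norm_boxAverage_le t (hδpos n) z)
        (hF.norm_boxAverage_le t (hδpos n) z))
    · rw [(hk k).boxAverage_eq_zero t (hδpos n) (hδone n) hz,
        hF.boxAverage_eq_zero t (hδpos n) (hδone n) hz, sub_zero]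
    · refine ae_of_all _ fun z => ?_
      have := (((hlim (z + δ)).sub (hlim z)).div_const δ).sub_const (boxAverage F t δ z)
      rwa [boxAverage, sub_self] at this
  filter_upwards [hmid.eventually_lt_const (show 0 < ε / 4 by linarith)] with k hkmid
  rw [Real.dist_eq, sub_zero, abs_of_nonneg (integral_nonneg fun _ => abs_nonneg _)]
  have i1 := (hk k).integrable_density t
  have i2 := (hk k).integrable_boxAverage t (hδpos n) (hδone n)
  have i3 := hF.integrable_boxAverage t (hδpos n) (hδone n)
  have i4 := hF.integrable_density t
  have h1 := hC k δ (hδpos n) (hδone n)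
  have j1 : Integrable fun z => |deriv (Fk k t) z - boxAverage (Fk k) t δ z| := (i1.sub i2).abs
  have j2 : Integrable fun z => |boxAverage (Fk k) t δ z - boxAverage F t δ z| := (i2.sub i3).abs
  have j3 : Integrable fun z => |boxAverage F t δ z - deriv (F t) z| := (i3.sub i4).abs
  calc ∫ z, |deriv (Fk k t) z - deriv (F t) z|
      ≤ ∫ z, (|deriv (Fk k t) z - boxAverage (Fk k) t δ z|
          + |boxAverage (Fk k) t δ z - boxAverage F t δ z|
          + |boxAverage F t δ z - deriv (F t) z|) := by
        refine integral_mono (i1.sub i4).abs ((j1.add j2).add j3) fun z => ?_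
        have e1 := abs_sub_le (deriv (Fk k t) z) (boxAverage (Fk k) t δ z) (deriv (F t) z)
        have e2 := abs_sub_le (boxAverage (Fk k) t δ z) (boxAverage F t δ z) (deriv (F t) z)
        simp only
        linarith
    _ = (∫ z, |deriv (Fk k t) z - boxAverage (Fk k) t δ z|)
          + (∫ z, |boxAverage (Fk k) t δ z - boxAverage F t δ z|)
          + ∫ z, |boxAverage F t δ z - deriv (F t) z| := by
        rw [integral_add (f := fun z => _ + _) (j1.add j2) j3, integral_add j1 j2]
    _ < ε := by linarith

end IsCDFCurve

/-! ### Distribution functions of configurations -/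

/-- The distribution function of the piecewise constant density attached to a configuration. The
factor `min z (y (i + 1)) - min z (y i)` is the length of the part of the `i`-th cell below `z`. -/
noncomputable def configCDF (N : ℕ) (h : ℝ) (y : ℕ → ℝ) (z : ℝ) : ℝ :=
  ∑ i ∈ Finset.range N, cellDensity h y i * (min z (y (i + 1)) - min z (y i))

lemma le_of_lt_succ {N : ℕ} {y : ℕ → ℝ} (hy : ∀ i < N, y i < y (i + 1)) {i j : ℕ} (hij : i ≤ j)
    (hj : j ≤ N) : y i ≤ y j := by
  induction j, hij using Nat.le_induction with
  | base => exact le_rfl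
  | succ k hk ih => exact (ih (by omega)).trans (hy k (by omega)).le

section Config

variable {N : ℕ} {h : ℝ} {y : ℕ → ℝ}

lemma cellDensity_pos (hh : 0 < h) (hy : ∀ i < N, y i < y (i + 1)) {i : ℕ} (hi : i < N) :
    0 < cellDensity h y i := div_pos hh (sub_pos.2 (hy i hi))

lemma configCDF_mono (hh : 0 < h) (hy : ∀ i < N, y i < y (i + 1)) :
    Monotone (configCDF N h y) := by
  intro z w hzw
  refine Finset.sum_le_sum fun i hi => ?_
  have hi' := Finset.mem_range.1 hi
  refine mul_le_mul_of_nonneg_left ?_ (cellDensity_pos hh hy hi').le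
  have := hy i hi'
  rcases min_cases z (y (i + 1)) with h1 | h1 <;> rcases min_cases z (y i) with h2 | h2 <;>
  rcases min_cases w (y (i + 1)) with h3 | h3 <;> rcases min_cases w (y i) with h4 | h4 <;>
  linarith [h1.1, h1.2, h2.1, h2.2, h3.1, h3.2, h4.1, h4.2]

lemma configCDF_sub_le {M : ℝ} (hM : 0 ≤ M) (hy : ∀ i < N, y i < y (i + 1))
    (hρ : ∀ i < N, cellDensity h y i ≤ M) {z w : ℝ} (hzw : z ≤ w) :
    configCDF N h y w - configCDF N h y z ≤ M * (w - z) := by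
  have hterm : ∀ i ∈ Finset.range N,
      cellDensity h y i * (min w (y (i + 1)) - min w (y i))
        - cellDensity h y i * (min z (y (i + 1)) - min z (y i))
      ≤ M * ((min w (y (i + 1)) - min z (y (i + 1))) - (min w (y i) - min z (y i))) := by
    intro i hi
    have hi' := Finset.mem_range.1 hi
    rw [← mul_sub]
    have hd : 0 ≤ (min w (y (i + 1)) - min w (y i)) - (min z (y (i + 1)) - min z (y i)) := by
      have := hy i hi'
      rcases min_cases z (y (i + 1)) with h1 | h1 <;> rcases min_cases z (y i) with h2 | h2 <;>
      rcases min_cases w (y (i + 1)) with h3 | h3 <;> rcases min_cases w (y i) with h4 | h4 <;>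
      linarith [h1.1, h1.2, h2.1, h2.2, h3.1, h3.2, h4.1, h4.2]
    refine (mul_le_mul_of_nonneg_right (hρ i hi') hd).trans (le_of_eq ?_)
    ring
  rw [configCDF, configCDF, ← Finset.sum_sub_distrib]
  refine (Finset.sum_le_sum hterm).trans ?_
  rw [← Finset.mul_sum, Finset.sum_range_sub (fun i => min w (y i) - min z (y i))]
  refine mul_le_mul_of_nonneg_left ?_ hM
  rcases min_cases w (y N) with h1 | h1 <;> rcases min_cases w (y 0) with h2 | h2 <;>
  rcases min_cases z (y N) with h3 | h3 <;> rcases min_cases z (y 0) with h4 | h4 <;>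
  linarith [h1.1, h1.2, h2.1, h2.2, h3.1, h3.2, h4.1, h4.2, le_of_lt_succ hy (Nat.zero_le N) le_rfl]

lemma configCDF_lipschitz (hh : 0 < h) {M : ℝ≥0} (hy : ∀ i < N, y i < y (i + 1))
    (hρ : ∀ i < N, cellDensity h y i ≤ M) : LipschitzWith M (configCDF N h y) := by
  refine LipschitzWith.of_dist_le_mul fun z w => ?_
  wlog hzw : z ≤ w generalizing z w
  · rw [dist_comm, dist_comm z]; exact this w z (le_of_not_ge hzw)
  rw [dist_comm, dist_comm z, Real.dist_eq, Real.dist_eq,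
    abs_of_nonneg (sub_nonneg.2 (configCDF_mono hh hy hzw)), abs_of_nonneg (sub_nonneg.2 hzw)]
  exact configCDF_sub_le M.2 hy hρ hzw

lemma configCDF_left (hy : ∀ i < N, y i < y (i + 1)) {z : ℝ} (hz : z ≤ y 0) :
    configCDF N h y z = 0 := by
  refine Finset.sum_eq_zero fun i hi => ?_
  have hi' := Finset.mem_range.1 hi
  rw [min_eq_left (hz.trans (le_of_lt_succ hy (Nat.zero_le _) hi')),
    min_eq_left (hz.trans (le_of_lt_succ hy (Nat.zero_le _) hi'.le)), sub_self, mul_zero]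

lemma configCDF_right (hy : ∀ i < N, y i < y (i + 1)) {z : ℝ} (hz : y N ≤ z) :
    configCDF N h y z = N * h := by
  rw [configCDF, Finset.sum_congr rfl (g := fun _ => h), Finset.sum_const, Finset.card_range,
    nsmul_eq_mul]
  intro i hi
  have hi' := Finset.mem_range.1 hi
  rw [min_eq_right ((le_of_lt_succ hy hi' le_rfl).trans hz),
    min_eq_right ((le_of_lt_succ hy hi'.le le_rfl).trans hz), cellDensity,
    div_mul_cancel₀ _ (sub_pos.2 (hy i hi')).ne']

/-- If the nodes of two configurations are at distance at most `d`, their distribution functions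
are comparable up to a shift of size `d`. -/
lemma configCDF_le_shift (hh : 0 < h) {y' : ℕ → ℝ} {d : ℝ} (hy : ∀ i < N, y i < y (i + 1))
    (hy' : ∀ i < N, y' i < y' (i + 1)) (hd : ∀ i ≤ N, |y i - y' i| ≤ d) (z : ℝ) :
    configCDF N h y z ≤ configCDF N h y' (z + d) := by
  refine Finset.sum_le_sum fun i hi => ?_
  have hi' := Finset.mem_range.1 hi
  have h1 := abs_le.1 (hd i hi'.le)
  have h2 := abs_le.1 (hd (i + 1) hi')
  have h3 := hy i hi'
  have h4 := hy' i hi'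
  rw [cellDensity, cellDensity]
  rcases le_total z (y i) with hz | hz
  · rw [min_eq_left hz, min_eq_left (hz.trans h3.le), sub_self, mul_zero]
    refine mul_nonneg (div_nonneg hh.le (by linarith)) ?_
    have := min_le_min_left (z + d) h4.le
    linarith
  rcases le_total (y (i + 1)) z with hz' | hz'
  · rw [min_eq_right hz, min_eq_right hz', min_eq_right (by linarith), min_eq_right (by linarith),
      div_mul_cancel₀ _ (by linarith), div_mul_cancel₀ _ (by linarith)]
  rw [min_eq_right hz, min_eq_left hz', div_mul_eq_mul_div, div_mul_eq_mul_div,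
    mul_div_assoc, mul_div_assoc]
  refine mul_le_mul_of_nonneg_left ?_ hh.le
  set l := (z - y i) / (y (i + 1) - y i) with hl
  have hl0 : 0 ≤ l := div_nonneg (by linarith) (by linarith)
  have hl1 : l ≤ 1 := (div_le_one (by linarith)).2 (by linarith)
  have hzl : z = y i + l * (y (i + 1) - y i) := by
    rw [hl, div_mul_cancel₀ _ (by linarith)]; ring
  rw [le_div_iff₀ (by linarith)]
  have h5 : y' i + l * (y' (i + 1) - y' i) ≤ z + d := by
    rw [hzl]; nlinarith
  have h6 : y' i ≤ z + d := by nlinarith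
  rw [min_eq_right h6]
  have : y' i + l * (y' (i + 1) - y' i) ≤ min (z + d) (y' (i + 1)) :=
    le_min h5 (by nlinarith)
  linarith

lemma hasDerivAt_min_const {z b : ℝ} (hz : z ≠ b) :
    HasDerivAt (fun z => min z b) (if z < b then 1 else 0) z := by
  rcases lt_or_gt_of_ne hz with h | h
  · rw [if_pos h]
    refine (hasDerivAt_id z).congr_of_eventuallyEq ?_
    filter_upwards [Iio_mem_nhds h] with w hw using min_eq_left (le_of_lt hw)
  · rw [if_neg (not_lt.2 h.le)]
    refine (hasDerivAt_const z b).congr_of_eventuallyEq ?_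
    filter_upwards [Ioi_mem_nhds h] with w hw using min_eq_right (le_of_lt hw)

lemma deriv_configCDF (hy : ∀ i < N, y i < y (i + 1)) {z : ℝ} (hz : ∀ i ≤ N, z ≠ y i) :
    deriv (configCDF N h y) z = densityReconstruction N h y z := by
  have : HasDerivAt (configCDF N h y) (∑ i ∈ Finset.range N, cellDensity h y i *
      ((if z < y (i + 1) then 1 else 0) - (if z < y i then 1 else 0))) z := by
    have := HasDerivAt.fun_sum (u := Finset.range N) (x := z)
      (A := fun i z => cellDensity h y i * (min z (y (i + 1)) - min z (y i)))
      (A' := fun i => cellDensity h y i *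
        ((if z < y (i + 1) then 1 else 0) - (if z < y i then 1 else 0))) fun i hi =>
      ((hasDerivAt_min_const (hz (i + 1) (Finset.mem_range.1 hi))).sub
        (hasDerivAt_min_const (hz i (Finset.mem_range.1 hi).le))).const_mul (cellDensity h y i)
    exact this
  rw [this.deriv, densityReconstruction]
  refine Finset.sum_congr rfl fun i hi => ?_
  have hi' := Finset.mem_range.1 hi
  have h1 := hy i hi'
  by_cases h2 : z < y i
  · rw [if_pos h2, if_pos (h2.trans h1), indicator_of_notMem fun h => absurd h.1 (not_lt.2 h2.le)]
    ring
  · have h3 : y i < z := lt_of_le_of_ne (not_lt.1 h2) (hz i hi'.le).symm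
    by_cases h4 : z < y (i + 1)
    · rw [if_neg h2, if_pos h4, indicator_of_mem (show z ∈ Ioo _ _ from ⟨h3, h4⟩)]; ring
    · rw [if_neg h2, if_neg h4, indicator_of_notMem fun h => h4 h.2]; ring

/-- Off the nodes, the time derivative of the distribution function is minus the flux. -/
lemma hasDerivAt_configCDF_time {x : ℝ → ℕ → ℝ} {v : ℕ → ℝ} {t z : ℝ}
    (hy : ∀ i < N, x t i < x t (i + 1)) (hx : ∀ i ≤ N, HasDerivAt (fun s => x s i) (v i) t)
    (hz : ∀ i ≤ N, z ≠ x t i) :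
    HasDerivAt (fun s => configCDF N h (x s) z) (-fluxReconstruction N h (x t) v z) t := by
  rw [fluxReconstruction, ← Finset.sum_neg_distrib]
  refine HasDerivAt.fun_sum fun i hi => ?_
  have hi' := Finset.mem_range.1 hi
  have hlt := hy i hi'
  have ha := hx i hi'.le
  have hb := hx (i + 1) hi'
  have hne : x t (i + 1) - x t i ≠ 0 := by linarith
  have hab : ∀ᶠ s in 𝓝 t, x s i < x s (i + 1) :=
    ha.continuousAt.eventually_lt hb.continuousAt hlt
  rcases lt_or_gt_of_ne (hz i hi'.le) with h1 | h1
  · rw [indicator_of_notMem fun h => absurd h.1 (not_lt.2 h1.le), neg_zero]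
    refine (hasDerivAt_const t (0 : ℝ)).congr_of_eventuallyEq ?_
    filter_upwards [hab, ha.continuousAt.eventually_const_lt h1] with s hs1 hs2
    rw [min_eq_left hs2.le, min_eq_left (hs2.trans hs1).le, sub_self, mul_zero]
  rcases lt_or_gt_of_ne (hz (i + 1) hi') with h2 | h2
  · rw [indicator_of_mem (show z ∈ Ioo _ _ from ⟨h1, h2⟩)]
    have key : HasDerivAt (fun s => h / (x s (i + 1) - x s i) * (z - x s i))
        ((0 * (x t (i + 1) - x t i) - h * (v (i + 1) - v i)) / (x t (i + 1) - x t i) ^ 2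
          * (z - x t i) + h / (x t (i + 1) - x t i) * (0 - v i)) t :=
      ((hasDerivAt_const t h).div (hb.sub ha) hne).mul ((hasDerivAt_const t z).sub ha)
    refine (key.congr_of_eventuallyEq ?_).congr_deriv ?_
    · filter_upwards [ha.continuousAt.eventually_lt_const h1,
        hb.continuousAt.eventually_const_lt h2] with s hs1 hs2
      rw [min_eq_left hs2.le, min_eq_right hs1.le, cellDensity]
    · rw [cellDensity]
      field_simp
      ring
  · rw [indicator_of_notMem fun h => absurd h.2 (not_lt.2 h2.le), neg_zero]
    refine (hasDerivAt_const t h).congr_of_eventuallyEq ?_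
    filter_upwards [hab, hb.continuousAt.eventually_lt_const h2] with s hs1 hs2
    rw [min_eq_right hs2.le, min_eq_right (hs1.trans hs2).le, cellDensity,
      div_mul_cancel₀ _ (by linarith)]

lemma ae_ne_node (N : ℕ) (y : ℕ → ℝ) : ∀ᵐ z : ℝ, ∀ i ≤ N, z ≠ y i := by
  rw [ae_all_iff]
  intro i
  filter_upwards [compl_mem_ae_iff.2 (measure_singleton (y i))] with z hz _ using hz

end Config

/-! ### Trajectories as curves of distribution functions -/

/-- The distribution functions along a trajectory on `[0, T]`, frozen outside `[0, T]`. -/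
noncomputable def trajCDF (T : ℝ) (hT : 0 ≤ T) (N : ℕ) (h : ℝ) (x : ℝ → ℕ → ℝ) (t z : ℝ) : ℝ :=
  configCDF N h (x (projIcc 0 T hT t)) z

lemma isCDFCurve_trajCDF {T : ℝ} (hT : 0 ≤ T) {N : ℕ} {h : ℝ} (hh : 0 < h) {x : ℝ → ℕ → ℝ}
    {M L : ℝ≥0} {R : ℝ} (hR : 0 ≤ R)
    (hord : ∀ t ∈ Icc 0 T, ∀ i < N, x t i < x t (i + 1))
    (hρ : ∀ t ∈ Icc 0 T, ∀ i < N, cellDensity h (x t) i ≤ M)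
    (hxR : ∀ t ∈ Icc 0 T, ∀ i ≤ N, |x t i| ≤ R)
    (hxL : ∀ s ∈ Icc 0 T, ∀ t ∈ Icc 0 T, ∀ i ≤ N, |x s i - x t i| ≤ L * |s - t|) :
    IsCDFCurve M (M * L) R (N * h) (trajCDF T hT N h x) where
  radius_nonneg := hR
  lip_time z := by
    have key : ∀ s t : Icc (0 : ℝ) T, configCDF N h (x s) z - configCDF N h (x t) z
        ≤ M * (L * |(s : ℝ) - t|) := by
      intro s t
      have h1 := configCDF_le_shift hh (hord s s.2) (hord t t.2) (hxL s s.2 t t.2) z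
      have h2 := configCDF_sub_le (h := h) M.coe_nonneg (hord t t.2) (hρ t t.2)
        (show z ≤ z + L * |(s : ℝ) - t| by
          have := mul_nonneg L.2 (abs_nonneg ((s : ℝ) - t)); simpa using this)
      rw [add_sub_cancel_left] at h2
      linarith
    refine LipschitzWith.of_dist_le_mul fun s t => ?_
    have h1 := key (projIcc 0 T hT s) (projIcc 0 T hT t)
    have h2 := key (projIcc 0 T hT t) (projIcc 0 T hT s)
    rw [abs_sub_comm] at h2
    have h3 : |(projIcc 0 T hT s : ℝ) - projIcc 0 T hT t| ≤ |s - t| := by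
      have := (LipschitzWith.projIcc hT).dist_le_mul s t
      simpa [Subtype.dist_eq, Real.dist_eq] using this
    have h4 : (M : ℝ) * (L * |(projIcc 0 T hT s : ℝ) - projIcc 0 T hT t|)
        ≤ M * (L * |s - t|) := by gcongr
    rw [Real.dist_eq, Real.dist_eq, NNReal.coe_mul, mul_assoc, trajCDF, trajCDF, abs_le]
    constructor <;> linarith
  lip_space t := configCDF_lipschitz hh (hord _ (projIcc 0 T hT t).2) (hρ _ (projIcc 0 T hT t).2)
  mono t := configCDF_mono hh (hord _ (projIcc 0 T hT t).2)
  left t z hz := configCDF_left (hord _ (projIcc 0 T hT t).2)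
    (hz.trans (abs_le.1 (hxR _ (projIcc 0 T hT t).2 0 (Nat.zero_le _))).1)
  right t z hz := configCDF_right (hord _ (projIcc 0 T hT t).2)
    ((abs_le.1 (hxR _ (projIcc 0 T hT t).2 N le_rfl)).2.trans hz)

lemma deriv_trajCDF_ae {T : ℝ} (hT : 0 ≤ T) {m : ℝ} {N : ℕ} {x : ℝ → ℕ → ℝ}
    (hord : ∀ t ∈ Icc 0 T, ∀ i < N, x t i < x t (i + 1)) {t : ℝ} (ht : t ∈ Icc 0 T) :
    ∀ᵐ z, deriv (trajCDF T hT N (m / N) x t) z = rhoHat m N x t z := by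
  filter_upwards [ae_ne_node N (x t)] with z hz
  have : trajCDF T hT N (m / N) x t = configCDF N (m / N) (x t) := by
    ext w
    rw [trajCDF, projIcc_of_mem hT ht]
  rw [this, deriv_configCDF (hord t ht) hz, rhoHat]

lemma cdfFlux_trajCDF_ae {T : ℝ} (hT : 0 ≤ T) {m : ℝ} {N : ℕ} {x : ℝ → ℕ → ℝ} {v : ℝ → ℕ → ℝ}
    (hord : ∀ t ∈ Icc 0 T, ∀ i < N, x t i < x t (i + 1))
    (hode : ∀ t ∈ Icc 0 T, ∀ i ≤ N, HasDerivWithinAt (fun s => x s i) (v t i) (Icc 0 T) t)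
    {t : ℝ} (ht : t ∈ Ioo 0 T) :
    ∀ᵐ z, cdfFlux (trajCDF T hT N (m / N) x) t z = fluxHat T m N x t z := by
  filter_upwards [ae_ne_node N (x t)] with z hz
  have hnhds : Icc 0 T ∈ 𝓝 t := Icc_mem_nhds ht.1 ht.2
  have htI : t ∈ Icc 0 T := ⟨ht.1.le, ht.2.le⟩
  have hd : ∀ i ≤ N, HasDerivAt (fun s => x s i) (derivWithin (fun s => x s i) (Icc 0 T) t) t := by
    intro i hi
    have := hode t htI i hi
    rw [this.derivWithin (uniqueDiffOn_Icc (ht.1.trans ht.2) t htI)]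
    exact this.hasDerivAt hnhds
  have h1 := hasDerivAt_configCDF_time (h := m / N) (hord t htI) hd hz
  have h2 : (fun s => trajCDF T hT N (m / N) x s z) =ᶠ[𝓝 t]
      fun s => configCDF N (m / N) (x s) z := by
    filter_upwards [hnhds] with s hs
    rw [trajCDF, projIcc_of_mem hT hs]
  rw [cdfFlux, (h1.congr_of_eventuallyEq h2).deriv, neg_neg, fluxHat]

/-! ### Differential inequalities -/

lemma exists_sign_hasDerivWithinAt_abs {y : ℝ → ℝ} {y' t : ℝ}
    (hy : HasDerivWithinAt y y' (Ici t) t) :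
    ∃ s : ℝ, |s| ≤ 1 ∧ s * y t = |y t| ∧
      HasDerivWithinAt (fun t => |y t|) (s * y') (Ici t) t := by
  rcases lt_trichotomy (y t) 0 with h | h | h
  · refine ⟨-1, by simp, by rw [abs_of_neg h]; ring, ?_⟩
    have := (hasDerivAt_abs_neg h).comp_hasDerivWithinAt t hy
    simpa [Function.comp_def] using this
  · refine ⟨SignType.sign y', ?_, by simp [h], ?_⟩
    · rcases lt_trichotomy y' 0 with h' | h' | h' <;> simp [h']
    · rw [sign_mul_self]
      rw [← hasDerivWithinAt_Ioi_iff_Ici, hasDerivWithinAt_iff_tendsto_slope' (by simp)] at hy ⊢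
      refine hy.abs.congr' ?_
      filter_upwards [self_mem_nhdsWithin] with z hz
      rw [slope_def_field, slope_def_field, h, abs_div, abs_zero, sub_zero, sub_zero,
        abs_of_pos (sub_pos.2 hz)]
  · refine ⟨1, by simp, by rw [abs_of_pos h]; ring, ?_⟩
    have := (hasDerivAt_abs_pos h).comp_hasDerivWithinAt t hy
    simpa [Function.comp_def] using this

lemma gronwallBound_le {δ K E t T : ℝ} (hδ : 0 ≤ δ) (hK : 1 ≤ K) (hE : 0 ≤ E) (ht : t ≤ T) :
    gronwallBound δ K E t ≤ (δ + E) * Real.exp (K * T) := by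
  rw [gronwallBound_of_K_ne_0 (by linarith)]
  have h1 : Real.exp (K * t) ≤ Real.exp (K * T) := Real.exp_le_exp.2 (by gcongr)
  have h2 : E / K ≤ E := div_le_self hE hK
  have h3 : 0 ≤ E / K := by positivity
  have h4 := Real.exp_pos (K * T)
  nlinarith [mul_le_mul_of_nonneg_left h1 hδ, mul_le_mul_of_nonneg_left h1 h3,
    mul_le_mul_of_nonneg_right h2 h4.le]

/-- Grönwall's inequality for `∑ |y_k|`. At a zero of `y_k` the right derivative of `|y_k|` is
`|y_k'|`, so that `s` ranges over all subgradients of the absolute values. -/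
lemma sum_abs_le_of_deriv {n : ℕ} {T K E δ : ℝ} {y y' : ℕ → ℝ → ℝ}
    (hδ : 0 ≤ δ) (hK : 1 ≤ K) (hE : 0 ≤ E)
    (hy : ∀ k < n, ∀ t ∈ Icc 0 T, HasDerivWithinAt (y k) (y' k t) (Icc 0 T) t)
    (hbound : ∀ t ∈ Icc 0 T, ∀ s : ℕ → ℝ, (∀ k < n, |s k| ≤ 1 ∧ s k * y k t = |y k t|) →
      ∑ k ∈ Finset.range n, s k * y' k t ≤ K * ∑ k ∈ Finset.range n, |y k t| + E)
    (h0 : ∑ k ∈ Finset.range n, |y k 0| ≤ δ) {t : ℝ} (ht : t ∈ Icc 0 T) :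
    ∑ k ∈ Finset.range n, |y k t| ≤ (δ + E) * Real.exp (K * T) := by
  have hright : ∀ k < n, ∀ t ∈ Ico 0 T, HasDerivWithinAt (y k) (y' k t) (Ici t) t := by
    intro k hk t ht
    exact (hy k hk t (Ico_subset_Icc_self ht)).mono_of_mem_nhdsWithin
      (Icc_mem_nhdsGE_of_mem ht)
  have hex : ∀ t, ∃ s : ℕ → ℝ, t ∈ Ico 0 T → ∀ k < n, |s k| ≤ 1 ∧ s k * y k t = |y k t| ∧
      HasDerivWithinAt (fun t => |y k t|) (s k * y' k t) (Ici t) t := by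
    intro t
    by_cases ht : t ∈ Ico 0 T
    · have : ∀ k, ∃ s : ℝ, k < n → |s| ≤ 1 ∧ s * y k t = |y k t| ∧
          HasDerivWithinAt (fun t => |y k t|) (s * y' k t) (Ici t) t := by
        intro k
        by_cases hk : k < n
        · obtain ⟨s, hs⟩ := exists_sign_hasDerivWithinAt_abs (hright k hk t ht)
          exact ⟨s, fun _ => hs⟩
        · exact ⟨0, fun h => absurd h hk⟩
      choose s hs using this
      exact ⟨s, fun _ k hk => hs k hk⟩
    · exact ⟨0, fun h => absurd h ht⟩
  choose s hs using hex
  have hcont : ContinuousOn (fun t => ∑ k ∈ Finset.range n, |y k t|) (Icc 0 T) :=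
    continuousOn_finsetSum _ fun k hk t ht =>
      (hy k (Finset.mem_range.1 hk) t ht).continuousWithinAt.abs
  have := le_gronwallBound_of_liminf_deriv_right_le (δ := δ) (K := K) (ε := E)
    (f' := fun t => ∑ k ∈ Finset.range n, s t k * y' k t) hcont
    (fun t ht r hr => ?_) h0 (fun t ht => ?_) t ht
  · rw [sub_zero] at this
    exact this.trans (gronwallBound_le hδ hK hE ht.2)
  · have hd : HasDerivWithinAt (fun t => ∑ k ∈ Finset.range n, |y k t|)
        (∑ k ∈ Finset.range n, s t k * y' k t) (Ici t) t :=
      HasDerivWithinAt.fun_sum fun k hk => (hs t ht k (Finset.mem_range.1 hk)).2.2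
    have := hd.liminf_right_slope_le hr
    simpa [slope_def_field, div_eq_inv_mul] using this
  · exact hbound t (Ico_subset_Icc_self ht) (s t) fun k hk =>
      ⟨(hs t ht k hk).1, (hs t ht k hk).2.1⟩

/-- If `y' > b'` wherever `y` meets the barrier `b`, then `y` stays above `b`. -/
lemma barrier_le {T : ℝ} {b y b' y' : ℝ → ℝ}
    (hb : ∀ t ∈ Icc 0 T, HasDerivWithinAt b (b' t) (Icc 0 T) t)
    (hy : ∀ t ∈ Icc 0 T, HasDerivWithinAt y (y' t) (Icc 0 T) t) (h0 : b 0 ≤ y 0)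
    (h : ∀ t ∈ Icc 0 T, b t = y t → b' t < y' t) : ∀ t ∈ Icc 0 T, b t ≤ y t := by
  have right : ∀ {f f' : ℝ → ℝ}, (∀ t ∈ Icc 0 T, HasDerivWithinAt f (f' t) (Icc 0 T) t) →
      ∀ t ∈ Ico 0 T, HasDerivWithinAt f (f' t) (Ici t) t := fun hf t ht =>
    (hf t (Ico_subset_Icc_self ht)).mono_of_mem_nhdsWithin (Icc_mem_nhdsGE_of_mem ht)
  intro t ht
  exact image_le_of_deriv_right_lt_deriv_boundary' (fun t ht => (hb t ht).continuousWithinAt)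
    (right hb) h0 (fun t ht => (hy t ht).continuousWithinAt) (right hy)
    (fun t ht => h t (Ico_subset_Icc_self ht)) ht

/-- Global existence for a bounded field which is Lipschitz in space. -/
lemma exists_solution_of_bounded {n : ℕ} {T : ℝ} (hT : 0 ≤ T)
    {X : ℝ → (Fin n → ℝ) → (Fin n → ℝ)} {C : ℝ≥0}
    (hlip : ∀ t ∈ Icc 0 T, LipschitzWith C (X t)) (hbd : ∀ t ∈ Icc 0 T, ∀ y, ‖X t y‖ ≤ C)
    (hcont : ∀ y, ContinuousOn (fun t => X t y) (Icc 0 T)) (y₀ : Fin n → ℝ) :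
    ∃ α : ℝ → Fin n → ℝ, α 0 = y₀ ∧
      ∀ t ∈ Icc 0 T, HasDerivWithinAt α (X t (α t)) (Icc 0 T) t := by
  have hPL : IsPicardLindelof X (⟨0, by simp [hT]⟩ : Icc (0 : ℝ) T) y₀ (C * ⟨T, hT⟩) 0 C C :=
    { lipschitzOnWith := fun t ht => (hlip t ht).lipschitzOnWith
      continuousOn := fun y _ => hcont y
      norm_le := fun t ht y _ => hbd t ht y
      mul_max_le := by
        have : ((C * ⟨T, hT⟩ : ℝ≥0) : ℝ) = C * T := rfl
        simp [hT, this] }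
  exact hPL.exists_eq_forall_mem_Icc_hasDerivWithinAt₀

/-! ### The upwind operator -/

/-- The sequence `0, r 0, …, r (N - 1), 0, 0, …`: the densities of the cells, surrounded by
vacuum. -/
def pad (N : ℕ) (r : ℕ → ℝ) (k : ℕ) : ℝ := if k = 0 then 0 else if k ≤ N then r (k - 1) else 0

@[simp] lemma pad_zero (N : ℕ) (r : ℕ → ℝ) : pad N r 0 = 0 := by simp [pad]

lemma pad_succ {N : ℕ} (r : ℕ → ℝ) {i : ℕ} (hi : i < N) : pad N r (i + 1) = r i := by
  simp [pad, Nat.succ_le_of_lt hi]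

lemma pad_last (N : ℕ) (r : ℕ → ℝ) : pad N r (N + 1) = 0 := by simp [pad]

lemma pad_mem {N : ℕ} {r : ℕ → ℝ} {M : ℝ} (hM : 0 ≤ M) (hr : ∀ i < N, r i ∈ Icc 0 M) (k : ℕ) :
    pad N r k ∈ Icc 0 M := by
  unfold pad
  split_ifs with h1 h2
  · exact ⟨le_rfl, hM⟩
  · exact hr _ (by omega)
  · exact ⟨le_rfl, hM⟩

/-- Summation by parts for padded sequences. -/
lemma sum_mul_pad_sub {N : ℕ} (s φ : ℕ → ℝ) :
    ∑ k ∈ Finset.range (N + 1), s k * (pad N φ (k + 1) - pad N φ k)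
      = ∑ i ∈ Finset.range N, (s i - s (i + 1)) * φ i := by
  have h1 : ∑ k ∈ Finset.range (N + 1), s k * pad N φ (k + 1)
      = ∑ i ∈ Finset.range N, s i * φ i := by
    rw [Finset.sum_range_succ, pad_last, mul_zero, add_zero]
    exact Finset.sum_congr rfl fun i hi => by rw [pad_succ _ (Finset.mem_range.1 hi)]
  have h2 : ∑ k ∈ Finset.range (N + 1), s k * pad N φ k
      = ∑ i ∈ Finset.range N, s (i + 1) * φ i := by
    rw [Finset.sum_range_succ', pad_zero, mul_zero, add_zero]
    exact Finset.sum_congr rfl fun i hi => by rw [pad_succ _ (Finset.mem_range.1 hi)]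
  simp_rw [mul_sub, sub_mul]
  rw [Finset.sum_sub_distrib, Finset.sum_sub_distrib, h1, h2]

/-- The upwind differences in the `i`-th cell: with forces `f`, the cell length changes at the rate
`upwind - β(r_i) (f_{i+1} - f_i)`. -/
def upwind (β : ℝ → ℝ) (N : ℕ) (f r : ℕ → ℝ) (i : ℕ) : ℝ :=
  (β (pad N r (i + 2)) - β (pad N r (i + 1))) * max (-f (i + 1)) 0
    + (β (pad N r i) - β (pad N r (i + 1))) * max (f i) 0

lemma velocity_eq_pad {β V W : ℝ → ℝ} {N : ℕ} {h : ℝ} {y : ℕ → ℝ} {i : ℕ} (hi : i ≤ N) :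
    velocity β V W N h y i
      = β (pad N (cellDensity h y) (i + 1)) * max (-force V W N h y i) 0
        - β (pad N (cellDensity h y) i) * max (force V W N h y i) 0 := by
  have h1 : pad N (cellDensity h y) (i + 1) = if i = N then 0 else cellDensity h y i := by
    split_ifs with h
    · rw [h, pad_last]
    · exact pad_succ _ (lt_of_le_of_ne hi h)
  have h2 : pad N (cellDensity h y) i = if i = 0 then 0 else cellDensity h y (i - 1) := by
    simp [pad, hi]
  have h3 : min (force V W N h y i) 0 = -max (-force V W N h y i) 0 := by
    rw [← min_neg_neg, neg_neg, neg_zero]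
  rw [velocity, h1, h2, h3]
  ring

lemma velocity_sub_velocity {β V W : ℝ → ℝ} {N : ℕ} {h : ℝ} {y : ℕ → ℝ} {i : ℕ} (hi : i < N) :
    velocity β V W N h y (i + 1) - velocity β V W N h y i
      = upwind β N (force V W N h y) (cellDensity h y) i
        - β (cellDensity h y i) * (force V W N h y (i + 1) - force V W N h y i) := by
  rw [velocity_eq_pad hi, velocity_eq_pad hi.le, upwind, pad_succ _ hi]
  set a := force V W N h y i
  set b := force V W N h y (i + 1)
  have ha : max a 0 - max (-a) 0 = a := max_zero_sub_eq_self a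
  have hb : max b 0 - max (-b) 0 = b := max_zero_sub_eq_self b
  linear_combination β (cellDensity h y i) * (ha - hb)

section Upwind

variable {β : ℝ → ℝ} {N : ℕ} {f r : ℕ → ℝ}

/-- Upwinding does not increase the total variation: the upwind operator has the right sign at
local extrema. -/
lemma upwind_sign (hβ : AntitoneOn β (Ici 0)) (hr : ∀ k, 0 ≤ pad N r k) {s : ℕ → ℝ} {i : ℕ}
    (hi : i < N) (hs : ∀ k < N + 1, |s k| ≤ 1 ∧
      s k * (pad N r (k + 1) - pad N r k) = |pad N r (k + 1) - pad N r k|) :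
    0 ≤ (s i - s (i + 1)) * upwind β N f r i := by
  obtain ⟨a1, a2⟩ := hs i (by omega)
  obtain ⟨b1, b2⟩ := hs (i + 1) (by omega)
  rw [abs_le] at a1 b1
  have hp := hr i
  have hq := hr (i + 1)
  have hw := hr (i + 2)
  rw [show i + 1 + 1 = i + 2 from rfl] at b2
  have hA : 0 ≤ (s i - s (i + 1)) * (β (pad N r (i + 2)) - β (pad N r (i + 1))) := by
    rcases lt_trichotomy (pad N r (i + 1)) (pad N r (i + 2)) with h | h | h
    · rw [abs_of_pos (sub_pos.2 h)] at b2
      have : s (i + 1) = 1 := by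
        have := sub_pos.2 h
        exact mul_right_cancel₀ this.ne' (by linarith)
      have h2 := hβ hq hw h.le
      exact mul_nonneg_of_nonpos_of_nonpos (by linarith) (by linarith)
    · rw [h]; simp
    · rw [abs_of_neg (sub_neg.2 h)] at b2
      have : s (i + 1) = -1 := by
        have := sub_neg.2 h
        exact mul_right_cancel₀ this.ne (by linarith)
      have h2 := hβ hw hq h.le
      exact mul_nonneg (by linarith) (by linarith)
  have hB : 0 ≤ (s i - s (i + 1)) * (β (pad N r i) - β (pad N r (i + 1))) := by
    rcases lt_trichotomy (pad N r i) (pad N r (i + 1)) with h | h | h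
    · rw [abs_of_pos (sub_pos.2 h)] at a2
      have : s i = 1 := by
        have := sub_pos.2 h
        exact mul_right_cancel₀ this.ne' (by linarith)
      have h2 := hβ hp hq h.le
      exact mul_nonneg (by linarith) (by linarith)
    · rw [h]; simp
    · rw [abs_of_neg (sub_neg.2 h)] at a2
      have : s i = -1 := by
        have := sub_neg.2 h
        exact mul_right_cancel₀ this.ne (by linarith)
      have h2 := hβ hq hp h.le
      exact mul_nonneg_of_nonpos_of_nonpos (by linarith) (by linarith)
  have h1 := mul_nonneg hA (le_max_right (-f (i + 1)) 0)
  have h2 := mul_nonneg hB (le_max_right (f i) 0)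
  rw [upwind]
  linarith

/-- The upwind operator is an `L¹`-contraction up to the variation of the forces. -/
lemma sum_mul_upwind_sub_le {r' : ℕ → ℝ} {s : ℕ → ℝ} (hs : ∀ i < N, |s i| ≤ 1 ∧
      s i * (β (r i) - β (r' i)) = |β (r i) - β (r' i)|) :
    ∑ i ∈ Finset.range N, s i * (upwind β N f r i - upwind β N f r' i)
      ≤ ∑ i ∈ Finset.range N, |β (r i) - β (r' i)| * (f (i + 1) - f i) := by
  set E : ℕ → ℝ := fun k => |β (pad N r k) - β (pad N r' k)| with hE
  have hE0 : E 0 = 0 := by simp [hE]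
  have hEN : E (N + 1) = 0 := by simp [hE, pad_last]
  have hEnn : ∀ k, 0 ≤ E k := fun k => abs_nonneg _
  have hterm : ∀ i ∈ Finset.range N, s i * (upwind β N f r i - upwind β N f r' i)
      ≤ (E (i + 2) * max (-f (i + 1)) 0 - E (i + 1) * max (-f i) 0)
        + (E i * max (f i) 0 - E (i + 1) * max (f (i + 1)) 0)
        + E (i + 1) * (f (i + 1) - f i) := by
    intro i hi
    have hi' := Finset.mem_range.1 hi
    obtain ⟨h1, h2⟩ := hs i hi'
    have hle : ∀ a : ℝ, s i * a ≤ |a| := fun a => by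
      calc s i * a ≤ |s i * a| := le_abs_self _
        _ = |s i| * |a| := abs_mul _ _
        _ ≤ 1 * |a| := by gcongr
        _ = |a| := one_mul _
    have h3 := hle (β (pad N r (i + 2)) - β (pad N r' (i + 2)))
    have h4 := hle (β (pad N r i) - β (pad N r' i))
    have h5 : s i * (β (pad N r (i + 1)) - β (pad N r' (i + 1))) = E (i + 1) := by
      simp only [hE]
      rw [pad_succ _ hi', pad_succ _ hi', h2]
    have hb : max (f (i + 1)) 0 - max (-f (i + 1)) 0 = f (i + 1) := max_zero_sub_eq_self _
    have ha : max (f i) 0 - max (-f i) 0 = f i := max_zero_sub_eq_self _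
    have h6 := mul_le_mul_of_nonneg_right h3 (le_max_right (-f (i + 1)) 0)
    have h7 := mul_le_mul_of_nonneg_right h4 (le_max_right (f i) 0)
    have e1 : s i * (upwind β N f r i - upwind β N f r' i)
        = s i * (β (pad N r (i + 2)) - β (pad N r' (i + 2))) * max (-f (i + 1)) 0
          + s i * (β (pad N r i) - β (pad N r' i)) * max (f i) 0
          - s i * (β (pad N r (i + 1)) - β (pad N r' (i + 1)))
            * (max (-f (i + 1)) 0 + max (f i) 0) := by
      rw [upwind, upwind]; ring
    rw [e1, h5]
    have e2 : E (i + 1) * (f (i + 1) - f i) = E (i + 1) * (max (f (i + 1)) 0 - max (-f (i + 1)) 0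
        - (max (f i) 0 - max (-f i) 0)) := by rw [ha, hb]
    rw [e2]
    simp only [hE] at h6 h7 ⊢
    linarith
  refine (Finset.sum_le_sum hterm).trans ?_
  rw [Finset.sum_add_distrib, Finset.sum_add_distrib,
    Finset.sum_range_sub (fun i => E (i + 1) * max (-f i) 0),
    Finset.sum_range_sub' (fun i => E i * max (f i) 0), hEN, hE0]
  have h1 : ∑ i ∈ Finset.range N, E (i + 1) * (f (i + 1) - f i)
      = ∑ i ∈ Finset.range N, |β (r i) - β (r' i)| * (f (i + 1) - f i) :=
    Finset.sum_congr rfl fun i hi => by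
      simp only [hE]; rw [pad_succ _ (Finset.mem_range.1 hi), pad_succ _ (Finset.mem_range.1 hi)]
  rw [h1]
  have h2 := mul_nonneg (hEnn (0 + 1)) (le_max_right (-f 0) 0)
  have h3 := mul_nonneg (hEnn N) (le_max_right (f N) 0)
  linarith

/-- In a saturated cell, where the mobility vanishes, upwinding can only increase the length. -/
lemma upwind_nonneg (hβ : ∀ s, 0 ≤ s → 0 ≤ β s) (hr : ∀ k, 0 ≤ pad N r k) {i : ℕ} (hi : i < N)
    (h0 : β (r i) = 0) : 0 ≤ upwind β N f r i := by
  rw [upwind, pad_succ _ hi, h0, sub_zero, sub_zero]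
  exact add_nonneg (mul_nonneg (hβ _ (hr _)) (le_max_right _ _))
    (mul_nonneg (hβ _ (hr _)) (le_max_right _ _))

end Upwind

namespace IsMobilityFactor

variable {β : ℝ → ℝ}

lemma nonneg (hβ : IsMobilityFactor β) {s : ℝ} (hs : 0 ≤ s) : 0 ≤ β s := by
  obtain ⟨Mβ, h0, hM⟩ := hβ.vanishes
  rw [← hM (max s Mβ) (le_max_right _ _)]
  exact hβ.decreasing hs (hs.trans (le_max_left _ _)) (le_max_left _ _)

lemma le_zero (hβ : IsMobilityFactor β) {s : ℝ} (hs : 0 ≤ s) : β s ≤ β 0 :=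
  hβ.decreasing self_mem_Ici hs hs

end IsMobilityFactor

/-! ### The regularised system -/

/-- The logarithmic growth rate of the density in the `i`-th cell for the system whose forces are
`f`, except that the compression `(f_{i+1} - f_i) / |K_i|` is replaced by `γ_{i+1} + 2 c r_i`. -/
noncomputable def regRate (β : ℝ → ℝ) (N : ℕ) (h c : ℝ) (f γ r : ℕ → ℝ) (i : ℕ) : ℝ :=
  -(r i / h) * upwind β N f r i + β (r i) * γ (i + 1) + 2 * c * (r i * β (r i))

lemma hasDerivWithinAt_pad {N : ℕ} {S : Set ℝ} {r : ℝ → ℕ → ℝ} {r' : ℕ → ℝ} {t : ℝ}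
    (hr : ∀ i < N, HasDerivWithinAt (fun s => r s i) (r' i) S t) (k : ℕ) :
    HasDerivWithinAt (fun s => pad N (r s) k) (pad N r' k) S t := by
  unfold pad
  split_ifs with h1 h2
  · exact hasDerivWithinAt_const _ _ _
  · exact hr _ (by omega)
  · exact hasDerivWithinAt_const _ _ _

section Estimates

variable {β : ℝ → ℝ} {Kβ : ℝ≥0} {N : ℕ} {T h c M A : ℝ} {f γ σ : ℝ → ℕ → ℝ}

lemma abs_mul_beta_sub_le (hβ : IsMobilityFactor β) (hlip : LipschitzOnWith Kβ β (Ici 0))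
    {a b : ℝ} (ha : a ∈ Icc 0 M) (hb : b ∈ Icc 0 M) :
    |a * β a - b * β b| ≤ (β 0 + M * Kβ) * |a - b| := by
  have h1 : |β a - β b| ≤ Kβ * |a - b| := by
    simpa [Real.dist_eq] using hlip.dist_le_mul a ha.1 b hb.1
  have h2 : |β a| ≤ β 0 := by rw [abs_of_nonneg (hβ.nonneg ha.1)]; exact hβ.le_zero ha.1
  calc |a * β a - b * β b| = |(a - b) * β a + b * (β a - β b)| := by ring_nf
    _ ≤ |a - b| * |β a| + |b| * |β a - β b| := by
        rw [← abs_mul, ← abs_mul]; exact abs_add_le _ _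
    _ ≤ |a - b| * β 0 + M * (Kβ * |a - b|) := by
        have : |b| ≤ M := by rw [abs_of_nonneg hb.1]; exact hb.2
        have := hb.1.trans hb.2
        gcongr
    _ = _ := by ring

lemma abs_mul_beta_le (hβ : IsMobilityFactor β) {a : ℝ} (ha : a ∈ Icc 0 M) :
    |a * β a| ≤ M * β 0 := by
  rw [abs_of_nonneg (mul_nonneg ha.1 (hβ.nonneg ha.1))]
  exact mul_le_mul ha.2 (hβ.le_zero ha.1) (hβ.nonneg ha.1) (ha.1.trans ha.2)

lemma abs_sq_mul_beta_sub_le (hβ : IsMobilityFactor β) (hlip : LipschitzOnWith Kβ β (Ici 0))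
    {a b : ℝ} (ha : a ∈ Icc 0 M) (hb : b ∈ Icc 0 M) :
    |a * (a * β a) - b * (b * β b)| ≤ M * (2 * β 0 + M * Kβ) * |a - b| := by
  calc |a * (a * β a) - b * (b * β b)|
      = |(a - b) * (a * β a) + b * (a * β a - b * β b)| := by ring_nf
    _ ≤ |a - b| * |a * β a| + |b| * |a * β a - b * β b| := by
        rw [← abs_mul, ← abs_mul]; exact abs_add_le _ _
    _ ≤ |a - b| * (M * β 0) + M * ((β 0 + M * Kβ) * |a - b|) := by
        have h1 : |b| ≤ M := by rw [abs_of_nonneg hb.1]; exact hb.2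
        have h2 := hb.1.trans hb.2
        have h3 := abs_mul_beta_sub_le hβ hlip ha hb
        have h4 := abs_mul_beta_le hβ ha
        gcongr
    _ = _ := by ring

/-- The exponential rate in the bound of the total variation of the regularised densities. -/
noncomputable def tvRate (β : ℝ → ℝ) (Kβ : ℝ≥0) (M A c : ℝ) : ℝ :=
  1 + (β 0 + M * Kβ) * A + 2 * |c| * (M * (2 * β 0 + M * Kβ))

/-- Total variation bound for the regularised densities: upwinding does not contribute, and the
compression `γ` enters only through its supremum and its total variation. -/
lemma totalVariation_le (hβ : IsMobilityFactor β) (hlip : LipschitzOnWith Kβ β (Ici 0))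
    (hh : 0 < h) (hM : 0 ≤ M) (hA : 0 ≤ A) {TV₀ C : ℝ} (hC : 0 ≤ C)
    (hσ : ∀ t ∈ Icc 0 T, ∀ i < N, HasDerivWithinAt (fun s => σ s i)
      (σ t i * regRate β N h c (f t) (γ t) (σ t) i) (Icc 0 T) t)
    (hσM : ∀ t ∈ Icc 0 T, ∀ i < N, σ t i ∈ Icc 0 M)
    (hγ : ∀ t ∈ Icc 0 T, ∀ k, |γ t k| ≤ A)
    (hγv : ∀ t ∈ Icc 0 T, ∑ k ∈ Finset.range (N + 1), |γ t (k + 1) - γ t k| ≤ C)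
    (h0 : ∑ k ∈ Finset.range (N + 1), |pad N (σ 0) (k + 1) - pad N (σ 0) k| ≤ TV₀)
    {t : ℝ} (ht : t ∈ Icc 0 T) :
    ∑ k ∈ Finset.range (N + 1), |pad N (σ t) (k + 1) - pad N (σ t) k|
      ≤ (TV₀ + M * β 0 * C) * Real.exp (tvRate β Kβ M A c * T) := by
  have hb0 := hβ.pos_zero
  have hK := Kβ.coe_nonneg
  refine sum_abs_le_of_deriv
    (y := fun k t => pad N (σ t) (k + 1) - pad N (σ t) k)
    (y' := fun k t => pad N (fun i => σ t i * regRate β N h c (f t) (γ t) (σ t) i) (k + 1)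
      - pad N (fun i => σ t i * regRate β N h c (f t) (γ t) (σ t) i) k)
    ((Finset.sum_nonneg fun _ _ => abs_nonneg _).trans h0) ?_ (by positivity)
    (fun k _ t ht => (hasDerivWithinAt_pad (hσ t ht) _).sub (hasDerivWithinAt_pad (hσ t ht) _))
    ?_ h0 ht
  · unfold tvRate
    have : 0 ≤ (β 0 + M * Kβ) * A + 2 * |c| * (M * (2 * β 0 + M * Kβ)) := by positivity
    linarith
  intro t ht s hs
  have hpad := pad_mem hM (hσM t ht)
  rw [sum_mul_pad_sub]
  set G : ℕ → ℝ := fun i => σ t i * β (σ t i) * γ t (i + 1)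
    + 2 * c * (σ t i * (σ t i * β (σ t i))) with hG
  have h1 : ∑ i ∈ Finset.range N, (s i - s (i + 1)) *
        (σ t i * regRate β N h c (f t) (γ t) (σ t) i)
      ≤ ∑ i ∈ Finset.range N, (s i - s (i + 1)) * G i := by
    refine Finset.sum_le_sum fun i hi => ?_
    have hsign := upwind_sign (f := f t) hβ.decreasing (fun k => (hpad k).1)
      (Finset.mem_range.1 hi) hs
    have : (s i - s (i + 1)) * (σ t i * regRate β N h c (f t) (γ t) (σ t) i)
        = (s i - s (i + 1)) * G i
          - σ t i ^ 2 / h * ((s i - s (i + 1)) * upwind β N (f t) (σ t) i) := by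
      rw [regRate, hG]; field_simp; ring
    rw [this]
    have := mul_nonneg (div_nonneg (sq_nonneg (σ t i)) hh.le) hsign
    linarith
  refine h1.trans ?_
  rw [← sum_mul_pad_sub]
  have hpadG : ∀ k, k ≤ N + 1 → pad N G k = pad N (σ t) k * β (pad N (σ t) k) * γ t k
      + 2 * c * (pad N (σ t) k * (pad N (σ t) k * β (pad N (σ t) k))) := by
    intro k hk
    unfold pad
    split_ifs with h1 h2
    · simp
    · rw [hG]; simp only; rw [Nat.sub_add_cancel (by omega)]
    · simp
  rw [Finset.mul_sum]
  have h2 : ∀ k ∈ Finset.range (N + 1), s k * (pad N G (k + 1) - pad N G k)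
      ≤ tvRate β Kβ M A c * |pad N (σ t) (k + 1) - pad N (σ t) k|
        + M * β 0 * |γ t (k + 1) - γ t k| := by
    intro k hk
    have hk' := Finset.mem_range.1 hk
    have hle : s k * (pad N G (k + 1) - pad N G k) ≤ |pad N G (k + 1) - pad N G k| := by
      calc _ ≤ |s k * (pad N G (k + 1) - pad N G k)| := le_abs_self _
        _ = |s k| * |pad N G (k + 1) - pad N G k| := abs_mul _ _
        _ ≤ 1 * |pad N G (k + 1) - pad N G k| := by
            gcongr; exact (hs k hk').1
        _ = _ := one_mul _
    refine hle.trans ?_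
    rw [hpadG _ (by omega), hpadG _ (by omega)]
    set a := pad N (σ t) (k + 1)
    set b := pad N (σ t) k
    have ha : a ∈ Icc 0 M := hpad _
    have hb : b ∈ Icc 0 M := hpad _
    have e1 := abs_mul_beta_sub_le hβ hlip ha hb
    have e2 := abs_mul_beta_le hβ hb
    have e3 := abs_sq_mul_beta_sub_le hβ hlip ha hb
    have e4 := hγ t ht (k + 1)
    calc |a * β a * γ t (k + 1) + 2 * c * (a * (a * β a))
          - (b * β b * γ t k + 2 * c * (b * (b * β b)))|
        = |(a * β a - b * β b) * γ t (k + 1) + b * β b * (γ t (k + 1) - γ t k)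
            + 2 * c * (a * (a * β a) - b * (b * β b))| := by ring_nf
      _ ≤ |a * β a - b * β b| * |γ t (k + 1)| + |b * β b| * |γ t (k + 1) - γ t k|
            + 2 * |c| * |a * (a * β a) - b * (b * β b)| := by
          refine (abs_add_three _ _ _).trans (le_of_eq ?_)
          rw [abs_mul, abs_mul, abs_mul (2 * c), abs_mul 2 c, abs_two]
      _ ≤ (β 0 + M * Kβ) * |a - b| * A + M * β 0 * |γ t (k + 1) - γ t k|
            + 2 * |c| * (M * (2 * β 0 + M * Kβ) * |a - b|) := by gcongr
      _ ≤ _ := by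
          unfold tvRate
          have := abs_nonneg (a - b)
          linarith
  refine (Finset.sum_le_sum h2).trans ?_
  rw [Finset.sum_add_distrib, ← Finset.mul_sum]
  have := mul_le_mul_of_nonneg_left (hγv t ht) (show 0 ≤ M * β 0 by positivity)
  rw [← Finset.mul_sum] at *
  linarith

/-- The exponential rate in the comparison of the true with the regularised densities. -/
noncomputable def compRate (β : ℝ → ℝ) (Kβ : ℝ≥0) (M A : ℝ) : ℝ :=
  1 + (2 * Kβ * A * M + β 0 * A)

/-- The regularised system stays `L¹`-close to the true one. In the contraction estimate for the
cell lengths the singular part `2 c h` of the force differences cancels. -/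
lemma sum_abs_length_sub_le (hβ : IsMobilityFactor β) (hlip : LipschitzOnWith Kβ β (Ici 0))
    (hh : 0 < h) (hM : 0 ≤ M) (hA : 0 ≤ A) {ε : ℝ} (hε : 0 ≤ ε) {Δ a : ℝ → ℕ → ℝ}
    (hΔ : ∀ t ∈ Icc 0 T, ∀ i < N, HasDerivWithinAt (fun s => Δ s i)
      (upwind β N (f t) (fun i => h / Δ t i) i
        - β (h / Δ t i) * (f t (i + 1) - f t i)) (Icc 0 T) t)
    (hΔpos : ∀ t ∈ Icc 0 T, ∀ i < N, 0 < Δ t i)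
    (hf : ∀ t ∈ Icc 0 T, ∀ i < N, f t (i + 1) - f t i = a t i + 2 * c * h)
    (ha : ∀ t ∈ Icc 0 T, ∀ i < N, |a t i| ≤ A * Δ t i)
    (hσ : ∀ t ∈ Icc 0 T, ∀ i < N, HasDerivWithinAt (fun s => σ s i)
      (σ t i * regRate β N h c (f t) (γ t) (σ t) i) (Icc 0 T) t)
    (hσM : ∀ t ∈ Icc 0 T, ∀ i < N, 0 < σ t i ∧ σ t i ≤ M)
    (hγ : ∀ t ∈ Icc 0 T, ∀ k, |γ t k| ≤ A)
    (hclose : ∀ t ∈ Icc 0 T, ∑ i ∈ Finset.range N, |a t i - γ t (i + 1) * Δ t i| ≤ ε)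
    (h0 : ∀ i < N, σ 0 i = h / Δ 0 i) {t : ℝ} (ht : t ∈ Icc 0 T) :
    ∑ i ∈ Finset.range N, |Δ t i - h / σ t i|
      ≤ β 0 * ε * Real.exp (compRate β Kβ M A * T) := by
  have hb0 := hβ.pos_zero
  have hK := Kβ.coe_nonneg
  have h0T : (0 : ℝ) ∈ Icc 0 T := ⟨le_rfl, ht.1.trans ht.2⟩
  have key := sum_abs_le_of_deriv (n := N) (T := T) (K := compRate β Kβ M A) (E := β 0 * ε) (δ := 0)
    (y := fun i t => Δ t i - h / σ t i)
    (y' := fun i t => (upwind β N (f t) (fun i => h / Δ t i) i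
        - β (h / Δ t i) * (f t (i + 1) - f t i))
      - (upwind β N (f t) (σ t) i - β (σ t i) * (γ t (i + 1) * (h / σ t i) + 2 * c * h)))
    le_rfl ?_ (by positivity) ?_ ?_ ?_ ht
  · rwa [zero_add] at key
  · unfold compRate
    have : 0 ≤ 2 * Kβ * A * M + β 0 * A := by positivity
    linarith
  · intro i hi t ht
    have hpos := (hσM t ht i hi).1
    have hd := (hasDerivWithinAt_const t (Icc 0 T) h).div (hσ t ht i hi) hpos.ne'
    refine (hΔ t ht i hi).sub (hd.congr_deriv ?_)
    rw [regRate]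
    field_simp
    ring
  · intro t ht s hs
    -- `s` is also a subgradient for the differences of the mobilities
    have hs' : ∀ i < N, |s i| ≤ 1 ∧ s i * (β (h / Δ t i) - β (σ t i))
        = |β (h / Δ t i) - β (σ t i)| := by
      intro i hi
      obtain ⟨h1, h2⟩ := hs i hi
      refine ⟨h1, ?_⟩
      have hp := hΔpos t ht i hi
      have hq := (hσM t ht i hi).1
      rcases lt_trichotomy (Δ t i) (h / σ t i) with h3 | h3 | h3
      · have h4 : s i = -1 := by
          rw [abs_of_neg (sub_neg.2 h3)] at h2
          exact mul_right_cancel₀ (sub_neg.2 h3).ne (by linarith)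
        have h5 : σ t i ≤ h / Δ t i := by
          rw [le_div_iff₀ hp]; rw [lt_div_iff₀ hq] at h3; linarith
        have h6 := hβ.decreasing (show σ t i ∈ Ici 0 from hq.le)
          (show h / Δ t i ∈ Ici 0 from hq.le.trans h5) h5
        rw [h4, abs_of_nonpos (by linarith)]; ring
      · have : h / Δ t i = σ t i := by rw [h3]; field_simp
        rw [this]; simp
      · have h4 : s i = 1 := by
          rw [abs_of_pos (sub_pos.2 h3)] at h2
          exact mul_right_cancel₀ (sub_pos.2 h3).ne' (by linarith)
        have h5 : h / Δ t i ≤ σ t i := by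
          rw [div_le_iff₀ hp]; rw [div_lt_iff₀ hq] at h3; linarith
        have h6 := hβ.decreasing (show h / Δ t i ∈ Ici 0 from (div_pos hh hp).le)
          (show σ t i ∈ Ici 0 from hq.le) h5
        rw [h4, abs_of_nonneg (by linarith)]; ring
    have hcontr := sum_mul_upwind_sub_le (f := f t) (r := fun i => h / Δ t i) (r' := σ t) hs'
    have hterm : ∀ i ∈ Finset.range N,
        |β (h / Δ t i) - β (σ t i)| * (f t (i + 1) - f t i)
          - s i * (β (h / Δ t i) * (f t (i + 1) - f t i)
            - β (σ t i) * (γ t (i + 1) * (h / σ t i) + 2 * c * h))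
        ≤ (2 * Kβ * A * M + β 0 * A) * |Δ t i - h / σ t i|
          + β 0 * |a t i - γ t (i + 1) * Δ t i| := by
      intro i hi
      have hi' := Finset.mem_range.1 hi
      have hp := hΔpos t ht i hi'
      obtain ⟨hq, hqM⟩ := hσM t ht i hi'
      obtain ⟨h1, h2⟩ := hs' i hi'
      set b := β (h / Δ t i)
      set b' := β (σ t i)
      set D := h / σ t i with hD
      have hDpos : 0 < D := div_pos hh hq
      -- a difference of mobilities times a length is controlled by the difference of lengths
      have hbb : |b - b'| * |a t i| ≤ Kβ * A * M * |Δ t i - D| := by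
        have e1 : |b - b'| ≤ Kβ * |h / Δ t i - σ t i| := by
          simpa [Real.dist_eq] using hlip.dist_le_mul (h / Δ t i) (div_pos hh hp).le (σ t i) hq.le
        have e2 : |h / Δ t i - σ t i| * Δ t i = σ t i * |Δ t i - D| := by
          have : h / Δ t i - σ t i = -(σ t i / Δ t i * (Δ t i - D)) := by
            rw [hD]; field_simp; ring
          rw [this, abs_neg, abs_mul, abs_of_pos (div_pos hq hp)]
          field_simp
        calc |b - b'| * |a t i| ≤ (Kβ * |h / Δ t i - σ t i|) * (A * Δ t i) := by
              gcongr; exact ha t ht i hi'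
          _ = Kβ * A * (|h / Δ t i - σ t i| * Δ t i) := by ring
          _ = Kβ * A * (σ t i * |Δ t i - D|) := by rw [e2]
          _ ≤ Kβ * A * (M * |Δ t i - D|) := by gcongr
          _ = _ := by ring
      have hb'0 : 0 ≤ b' := hβ.nonneg hq.le
      have hb'1 : b' ≤ β 0 := hβ.le_zero hq.le
      have hsle : ∀ z : ℝ, -(s i * z) ≤ |z| := fun z => by
        calc -(s i * z) ≤ |s i * z| := neg_le_abs _
          _ = |s i| * |z| := abs_mul _ _
          _ ≤ 1 * |z| := by gcongr
          _ = |z| := one_mul _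
      have e3 : |b - b'| * a t i ≤ |b - b'| * |a t i| := by gcongr; exact le_abs_self _
      have e4 := hsle ((b - b') * a t i + b' * (a t i - γ t (i + 1) * Δ t i)
        + b' * γ t (i + 1) * (Δ t i - D))
      have e5 : |(b - b') * a t i + b' * (a t i - γ t (i + 1) * Δ t i)
          + b' * γ t (i + 1) * (Δ t i - D)|
          ≤ |b - b'| * |a t i| + β 0 * |a t i - γ t (i + 1) * Δ t i|
            + β 0 * A * |Δ t i - D| := by
        refine (abs_add_three _ _ _).trans ?_
        rw [abs_mul, abs_mul, abs_mul, abs_mul b' (γ t (i + 1)), abs_of_nonneg hb'0]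
        have := hγ t ht (i + 1)
        gcongr
      rw [hf t ht i hi']
      have e6 : |b - b'| * (a t i + 2 * c * h)
          - s i * (b * (a t i + 2 * c * h) - b' * (γ t (i + 1) * D + 2 * c * h))
          = |b - b'| * a t i - s i * ((b - b') * a t i + b' * (a t i - γ t (i + 1) * Δ t i)
            + b' * γ t (i + 1) * (Δ t i - D)) := by
        rw [← h2]; ring
      rw [e6]
      linarith
    have hsum : ∑ i ∈ Finset.range N, s i * ((upwind β N (f t) (fun i => h / Δ t i) i
        - β (h / Δ t i) * (f t (i + 1) - f t i))
        - (upwind β N (f t) (σ t) i - β (σ t i) * (γ t (i + 1) * (h / σ t i) + 2 * c * h)))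
        = ∑ i ∈ Finset.range N, s i * (upwind β N (f t) (fun i => h / Δ t i) i
            - upwind β N (f t) (σ t) i)
          - ∑ i ∈ Finset.range N, s i * (β (h / Δ t i) * (f t (i + 1) - f t i)
            - β (σ t i) * (γ t (i + 1) * (h / σ t i) + 2 * c * h)) := by
      rw [← Finset.sum_sub_distrib]
      exact Finset.sum_congr rfl fun i _ => by ring
    rw [hsum]
    have h3 := Finset.sum_le_sum hterm
    rw [Finset.sum_sub_distrib, Finset.sum_add_distrib, ← Finset.mul_sum, ← Finset.mul_sum] at h3
    have h4 := mul_le_mul_of_nonneg_left (hclose t ht) hb0.le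
    have h5 : 0 ≤ ∑ i ∈ Finset.range N, |Δ t i - h / σ t i| :=
      Finset.sum_nonneg fun _ _ => abs_nonneg _
    unfold compRate
    linarith
  · refine (Finset.sum_eq_zero fun i hi => ?_).le
    have hi' := Finset.mem_range.1 hi
    have := (hΔpos 0 h0T i hi').ne'
    rw [h0 i hi', abs_eq_zero]
    field_simp
    ring

end Estimates

/-! ### Existence for the regularised system -/

/-- Time dependent functions which are continuous in time, and bounded and Lipschitz in space
uniformly in time. This class is closed under products. -/
def IsBddLip {E : Type*} [PseudoMetricSpace E] (T : ℝ) (X : ℝ → E → ℝ) : Prop :=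
  (∀ y, ContinuousOn (fun t => X t y) (Icc 0 T)) ∧
  ∃ C, 0 ≤ C ∧ ∀ t ∈ Icc 0 T, (∀ y, |X t y| ≤ C) ∧ ∀ y z, |X t y - X t z| ≤ C * dist y z

namespace IsBddLip

variable {E : Type*} [PseudoMetricSpace E] {T : ℝ} {X Y : ℝ → E → ℝ}

lemma of_time {g : ℝ → ℝ} (hg : ContinuousOn g (Icc 0 T)) :
    IsBddLip T (fun t (_ : E) => g t) := by
  obtain ⟨C, hC⟩ := isCompact_Icc.exists_bound_of_continuousOn hg
  refine ⟨fun _ => hg, max C 0, le_max_right _ _, fun t ht => ⟨fun _ => ?_, fun y z => ?_⟩⟩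
  · exact (hC t ht).trans (le_max_left _ _)
  · rw [sub_self, abs_zero]
    positivity

lemma of_space {g : E → ℝ} {C : ℝ} (hC : 0 ≤ C) (hg : ∀ y, |g y| ≤ C)
    (hl : ∀ y z, |g y - g z| ≤ C * dist y z) : IsBddLip T (fun _ => g) :=
  ⟨fun _ => continuousOn_const, C, hC, fun _ _ => ⟨hg, hl⟩⟩

lemma add (hX : IsBddLip T X) (hY : IsBddLip T Y) : IsBddLip T (fun t y => X t y + Y t y) := by
  obtain ⟨hXc, C, hC, hX⟩ := hX
  obtain ⟨hYc, D, hD, hY⟩ := hY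
  refine ⟨fun y => (hXc y).add (hYc y), C + D, by positivity, fun t ht => ⟨fun y => ?_,
    fun y z => ?_⟩⟩
  · exact (abs_add_le _ _).trans (add_le_add ((hX t ht).1 y) ((hY t ht).1 y))
  · have h1 := (hX t ht).2 y z
    have h2 := (hY t ht).2 y z
    have h3 := abs_add_le (X t y - X t z) (Y t y - Y t z)
    rw [show X t y + Y t y - (X t z + Y t z) = X t y - X t z + (Y t y - Y t z) by ring]
    linarith

lemma mul (hX : IsBddLip T X) (hY : IsBddLip T Y) : IsBddLip T (fun t y => X t y * Y t y) := by
  obtain ⟨hXc, C, hC, hX⟩ := hX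
  obtain ⟨hYc, D, hD, hY⟩ := hY
  refine ⟨fun y => (hXc y).mul (hYc y), C * D + C * D, by positivity, fun t ht => ⟨fun y => ?_,
    fun y z => ?_⟩⟩
  · rw [abs_mul]
    have := mul_le_mul ((hX t ht).1 y) ((hY t ht).1 y) (abs_nonneg _) hC
    nlinarith [mul_nonneg hC hD]
  · rw [show X t y * Y t y - X t z * Y t z
      = X t y * (Y t y - Y t z) + (X t y - X t z) * Y t z by ring]
    refine (abs_add_le _ _).trans ?_
    rw [abs_mul, abs_mul]
    have h1 := mul_le_mul ((hX t ht).1 y) ((hY t ht).2 y z) (abs_nonneg _) hC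
    have h2 := mul_le_mul ((hX t ht).2 y z) ((hY t ht).1 z) (abs_nonneg _) (by positivity)
    linarith

lemma const (c : ℝ) : IsBddLip T (fun _ (_ : E) => c) := of_time continuousOn_const

lemma neg (hX : IsBddLip T X) : IsBddLip T (fun t y => -X t y) := by
  simpa using (const (-1)).mul hX

lemma sub (hX : IsBddLip T X) (hY : IsBddLip T Y) : IsBddLip T (fun t y => X t y - Y t y) := by
  simpa [sub_eq_add_neg] using hX.add hY.neg

end IsBddLip

/-- The state `y`, truncated to `[0, M]`. -/
def clampState (N : ℕ) (M : ℝ) (y : Fin N → ℝ) (i : ℕ) : ℝ :=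
  if hi : i < N then max 0 (min M (y ⟨i, hi⟩)) else 0

section Existence

variable {β : ℝ → ℝ} {Kβ : ℝ≥0} {N : ℕ} {T h c M : ℝ} {f γ : ℝ → ℕ → ℝ}

lemma clampState_mem (hM : 0 ≤ M) (y : Fin N → ℝ) (i : ℕ) : clampState N M y i ∈ Icc 0 M := by
  unfold clampState
  split_ifs with hi
  · exact ⟨le_max_left _ _, max_le hM (min_le_left _ _)⟩
  · exact ⟨le_rfl, hM⟩

lemma abs_clampState_sub_le (y z : Fin N → ℝ) (i : ℕ) :
    |clampState N M y i - clampState N M z i| ≤ dist y z := by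
  unfold clampState
  split_ifs with hi
  · have h1 := abs_max_sub_max_le_max 0 (min M (y ⟨i, hi⟩)) 0 (min M (z ⟨i, hi⟩))
    have h2 := abs_min_sub_min_le_max M (y ⟨i, hi⟩) M (z ⟨i, hi⟩)
    have h3 := dist_le_pi_dist y z ⟨i, hi⟩
    rw [Real.dist_eq] at h3
    rw [sub_self, abs_zero] at h1 h2
    have e : ∀ u : ℝ, max 0 |u| = |u| := fun u => max_eq_right (abs_nonneg u)
    rw [e] at h1 h2
    linarith
  · simp

lemma isBddLip_pad_clampState (hM : 0 ≤ M) (k : ℕ) :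
    IsBddLip T (fun _ (y : Fin N → ℝ) => pad N (clampState N M y) k) := by
  refine IsBddLip.of_space (C := M + 1) (by linarith) (fun y => ?_) fun y z => ?_
  · have := pad_mem (N := N) hM (fun i _ => clampState_mem hM y i) k
    rw [abs_of_nonneg this.1]
    linarith [this.2]
  · have : |pad N (clampState N M y) k - pad N (clampState N M z) k| ≤ dist y z := by
      unfold pad
      split_ifs
      · simp
      · exact abs_clampState_sub_le y z _
      · simp
    nlinarith [dist_nonneg (x := y) (y := z)]

lemma isBddLip_beta_pad_clampState (hβ : IsMobilityFactor β)
    (hlip : LipschitzOnWith Kβ β (Ici 0)) (hM : 0 ≤ M) (k : ℕ) :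
    IsBddLip T (fun _ (y : Fin N → ℝ) => β (pad N (clampState N M y) k)) := by
  obtain ⟨-, C, hC, h⟩ := isBddLip_pad_clampState (N := N) (T := 0) hM k
  have hmem := fun y : Fin N → ℝ => pad_mem (N := N) hM (fun i _ => clampState_mem hM y i) k
  have hb0 := hβ.pos_zero
  have hK := Kβ.coe_nonneg
  refine IsBddLip.of_space (C := β 0 + Kβ * C) (by positivity) (fun y => ?_) fun y z => ?_
  · rw [abs_of_nonneg (hβ.nonneg (hmem y).1)]
    have := hβ.le_zero (hmem y).1
    nlinarith [mul_nonneg hK hC]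
  · have h1 := hlip.dist_le_mul _ (hmem y).1 _ (hmem z).1
    rw [Real.dist_eq, Real.dist_eq] at h1
    have h2 := mul_le_mul_of_nonneg_left ((h 0 (by simp)).2 y z) hK
    nlinarith [dist_nonneg (x := y) (y := z)]

lemma isBddLip_regRate (hβ : IsMobilityFactor β) (hlip : LipschitzOnWith Kβ β (Ici 0))
    (hM : 0 ≤ M) (hf : ∀ i ≤ N, ContinuousOn (fun t => f t i) (Icc 0 T))
    (hγ : ∀ k, ContinuousOn (fun t => γ t k) (Icc 0 T)) {i : ℕ} (hi : i < N) :
    IsBddLip T (fun t (y : Fin N → ℝ) => regRate β N h c (f t) (γ t) (clampState N M y) i) := by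
  have hb := fun k => isBddLip_beta_pad_clampState (N := N) (T := T) hβ hlip hM k
  have hp : IsBddLip T (fun _ (y : Fin N → ℝ) => clampState N M y i) := by
    simpa [pad_succ _ hi] using isBddLip_pad_clampState (N := N) (T := T) hM (i + 1)
  have hb' : IsBddLip T (fun _ (y : Fin N → ℝ) => β (clampState N M y i)) := by
    simpa [pad_succ _ hi] using hb (i + 1)
  have hf1 : IsBddLip T (fun t (_ : Fin N → ℝ) => max (-f t (i + 1)) 0) :=
    .of_time ((hf (i + 1) hi).neg.sup continuousOn_const)
  have hf2 : IsBddLip T (fun t (_ : Fin N → ℝ) => max (f t i) 0) :=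
    .of_time ((hf i hi.le).sup continuousOn_const)
  have hup : IsBddLip T (fun t (y : Fin N → ℝ) => upwind β N (f t) (clampState N M y) i) :=
    (((hb (i + 2)).sub (hb (i + 1))).mul hf1).add (((hb i).sub (hb (i + 1))).mul hf2)
  have := (((hp.mul (.const h⁻¹)).neg.mul hup).add (hb'.mul (.of_time (hγ (i + 1))))).add
    ((IsBddLip.const (2 * c)).mul (hp.mul hb'))
  simpa [regRate, div_eq_mul_inv] using this

/-- The regularised system has a solution on `[0, T]` with values in `(0, M]`: the truncated system
has one by Picard–Lindelöf, and the truncation is never active. -/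
lemma exists_regularised_solution (hβ : IsMobilityFactor β) (hlip : LipschitzOnWith Kβ β (Ici 0))
    (hT : 0 ≤ T) (hh : 0 < h) (hM : 0 < M) (hMβ : β M = 0)
    (hf : ∀ i ≤ N, ContinuousOn (fun t => f t i) (Icc 0 T))
    (hγ : ∀ k, ContinuousOn (fun t => γ t k) (Icc 0 T)) {r₀ : ℕ → ℝ}
    (hr₀ : ∀ i < N, 0 < r₀ i ∧ r₀ i ≤ M) :
    ∃ σ : ℝ → ℕ → ℝ, (∀ i < N, σ 0 i = r₀ i) ∧
      (∀ t ∈ Icc 0 T, ∀ i < N, 0 < σ t i ∧ σ t i ≤ M) ∧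
      ∀ t ∈ Icc 0 T, ∀ i < N, HasDerivWithinAt (fun s => σ s i)
        (σ t i * regRate β N h c (f t) (γ t) (σ t) i) (Icc 0 T) t := by
  have hrate := fun i (hi : i < N) => isBddLip_regRate (h := h) (c := c) hβ hlip hM.le hf hγ hi
  choose! hratec Crate hCrate0 hCrate using hrate
  set X : ℝ → (Fin N → ℝ) → (Fin N → ℝ) := fun t y i =>
    clampState N M y i * regRate β N h c (f t) (γ t) (clampState N M y) i with hX
  have hXi : ∀ i : Fin N, IsBddLip T (fun t y => X t y i) := by
    intro i
    have hp : IsBddLip T (fun _ (y : Fin N → ℝ) => clampState N M y i) := by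
      simpa [pad_succ _ i.2] using isBddLip_pad_clampState (N := N) (T := T) hM.le (i + 1)
    exact hp.mul (isBddLip_regRate hβ hlip hM.le hf hγ i.2)
  choose hXc C hC0 hXb using hXi
  have hCle : ∀ i, C i ≤ ((∑ i, C i).toNNReal : ℝ) := fun i => by
    rw [Real.coe_toNNReal _ (Finset.sum_nonneg fun i _ => hC0 i)]
    exact Finset.single_le_sum (fun i _ => hC0 i) (Finset.mem_univ i)
  obtain ⟨α, hα0, hα⟩ := exists_solution_of_bounded (C := (∑ i, C i).toNNReal) (X := X) hT
    (fun t ht => LipschitzWith.of_dist_le_mul fun y z =>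
      (dist_pi_le_iff (by positivity)).2 fun i => by
        rw [Real.dist_eq]
        exact ((hXb i t ht).2 y z).trans (by gcongr; exact hCle i))
    (fun t ht y => (pi_norm_le_iff_of_nonneg (by positivity)).2 fun i =>
      ((hXb i t ht).1 y).trans (hCle i))
    (fun y => continuousOn_pi.2 fun i => hXc i y) (fun i => r₀ i)
  have hαi : ∀ t ∈ Icc 0 T, ∀ i : Fin N,
      HasDerivWithinAt (fun s => α s i) (X t (α t) i) (Icc 0 T) t := fun t ht i =>
    (hasDerivWithinAt_pi.1 (hα t ht)) i
  have hcl : ∀ t (i : Fin N), clampState N M (α t) i = max 0 (min M (α t i)) := by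
    intro t i
    simp [clampState]
  have hlower : ∀ t ∈ Icc 0 T, ∀ i : Fin N,
      r₀ i * Real.exp (-(Crate i + 1) * t) ≤ α t i := by
    intro t ht i
    have hri := (hr₀ i i.2).1
    have hexp : ∀ t : ℝ, HasDerivAt (fun t => r₀ i * Real.exp (-(Crate i + 1) * t))
        (r₀ i * (Real.exp (-(Crate i + 1) * t) * (-(Crate i + 1)))) t := fun t => by
      have h1 := ((hasDerivAt_id t).const_mul (-(Crate i + 1))).exp.const_mul (r₀ i)
      simpa using h1
    refine barrier_le (fun t _ => (hexp t).hasDerivWithinAt) (fun t ht => hαi t ht i) ?_ ?_ t ht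
    · simp [hα0]
    · intro t ht heq
      have hpos : 0 < α t i := by rw [← heq]; positivity
      have h1 := abs_le.1 ((hCrate i i.2 t ht).1 (α t))
      have h2 : 0 ≤ clampState N M (α t) i := (clampState_mem hM.le _ _).1
      have h3 : clampState N M (α t) i ≤ α t i := by
        rw [hcl]; exact max_le hpos.le (min_le_right _ _)
      have h4 : -(Crate i) * α t i ≤ X t (α t) i := by
        have := mul_le_mul_of_nonneg_left h1.1 h2
        have := mul_le_mul_of_nonneg_left h3 (hCrate0 i i.2)
        simp only [hX]
        linarith
      have h5 : r₀ i * (Real.exp (-(Crate i + 1) * t) * (-(Crate i + 1)))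
          = -(Crate i + 1) * α t i := by rw [← heq]; ring
      linarith
  have hposα : ∀ t ∈ Icc 0 T, ∀ i : Fin N, 0 < α t i := fun t ht i =>
    lt_of_lt_of_le (mul_pos (hr₀ i i.2).1 (Real.exp_pos _)) (hlower t ht i)
  have hupper : ∀ t ∈ Icc 0 T, ∀ i : Fin N, α t i ≤ M := by
    intro t ht i
    refine le_of_forall_pos_le_add fun η hη => ?_
    have hη' : 0 < η / (T + 1) := by positivity
    have := barrier_le (T := T) (b := fun s => α s i) (b' := fun s => X s (α s) i)
      (y := fun s => M + η / (T + 1) * s) (y' := fun _ => η / (T + 1))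
      (fun t ht => hαi t ht i)
      (fun t _ => by
        simpa using (((hasDerivAt_id t).const_mul (η / (T + 1))).const_add M).hasDerivWithinAt)
      (by simpa [hα0] using (hr₀ i i.2).2) (fun t ht heq => ?_) t ht
    · refine this.trans ?_
      have h1 : η / (T + 1) * t ≤ η / (T + 1) * (T + 1) := by gcongr; linarith [ht.2]
      rw [div_mul_cancel₀ _ (by positivity)] at h1
      linarith
    · have hge : M ≤ α t i := by
        rw [show α t i = M + η / (T + 1) * t from heq]
        have := mul_nonneg hη'.le ht.1
        linarith
      have hM' : clampState N M (α t) i = M := by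
        rw [hcl, min_eq_left hge, max_eq_right hM.le]
      have hup := upwind_nonneg (f := f t) (r := clampState N M (α t)) (fun s => hβ.nonneg)
        (fun k => (pad_mem hM.le (fun i _ => clampState_mem hM.le _ i) k).1) i.2
        (by rw [hM', hMβ])
      have : X t (α t) i ≤ 0 := by
        simp only [hX, regRate]
        rw [hM', hMβ]
        have := mul_nonneg (mul_nonneg hM.le (div_pos hM hh).le) hup
        linarith
      linarith
  set σ : ℝ → ℕ → ℝ := fun t i => if hi : i < N then α t ⟨i, hi⟩ else 0 with hσ
  have hσα : ∀ t i (hi : i < N), σ t i = α t ⟨i, hi⟩ := fun t i hi => by simp [hσ, hi]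
  have hclσ : ∀ t ∈ Icc 0 T, clampState N M (α t) = σ t := by
    intro t ht
    ext i
    by_cases hi : i < N
    · rw [hσα t i hi, hcl t ⟨i, hi⟩, min_eq_right (hupper t ht _),
        max_eq_right (hposα t ht _).le]
    · simp [clampState, hσ, hi]
  refine ⟨σ, fun i hi => by rw [hσα 0 i hi, hα0], fun t ht i hi => ?_, fun t ht i hi => ?_⟩
  · rw [hσα t i hi]
    exact ⟨hposα t ht _, hupper t ht _⟩
  · have h1 := hαi t ht ⟨i, hi⟩
    simp only [hX] at h1
    rw [hclσ t ht] at h1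
    simpa only [hσα _ i hi] using h1

end Existence

/-! ### Weak derivatives and Lipschitz approximation -/

lemma exists_measurable_bounded_rep {f : ℝ → ℝ} (hf : MemLp f ⊤ volume) :
    ∃ (g : ℝ → ℝ) (C : ℝ), 0 ≤ C ∧ Measurable g ∧ (∀ x, |g x| ≤ C) ∧ f =ᵐ[volume] g := by
  set C := (eLpNorm f ⊤ volume).toReal with hC
  have hC0 : 0 ≤ C := ENNReal.toReal_nonneg
  refine ⟨fun x => max (-C) (min C (hf.1.mk f x)), C, hC0,
    measurable_const.max (measurable_const.min hf.1.stronglyMeasurable_mk.measurable),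
    fun x => abs_le.2 ⟨le_max_left _ _, max_le (by linarith) (min_le_left _ _)⟩, ?_⟩
  have hb : ∀ᵐ x, ‖f x‖ ≤ C := by
    have := ae_le_eLpNormEssSup (f := f) (μ := volume)
    filter_upwards [this] with x hx
    have h2 : eLpNorm f ⊤ volume ≠ ⊤ := hf.2.ne
    rw [eLpNorm_exponent_top] at h2
    rw [hC, eLpNorm_exponent_top]
    have := ENNReal.toReal_mono h2 hx
    simpa using this
  filter_upwards [hb, hf.1.ae_eq_mk] with x h1 h2
  rw [← h2]
  have := abs_le.1 h1
  rw [min_eq_right this.2, max_eq_right this.1]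

lemma lipschitz_integral_of_bounded {q : ℝ → ℝ} {C : ℝ} (hC : 0 ≤ C) (hq : Measurable q)
    (hqC : ∀ x, |q x| ≤ C) : LipschitzWith C.toNNReal (fun x => ∫ s in (0)..x, q s) := by
  have hint : ∀ a b, IntervalIntegrable q volume a b := fun a b =>
    (intervalIntegrable_const (c := C)).mono_fun hq.aestronglyMeasurable
      (ae_of_all _ fun x => by simpa [abs_of_nonneg hC] using hqC x)
  refine LipschitzWith.of_dist_le_mul fun x y => ?_
  rw [Real.dist_eq, Real.dist_eq, intervalIntegral.integral_interval_sub_left (hint _ _) (hint _ _),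
    Real.coe_toNNReal _ hC]
  exact intervalIntegral.norm_integral_le_of_norm_le_const (f := q) (C := C)
    fun s _ => by simpa using hqC s

lemma intervalIntegrable_of_bounded {q : ℝ → ℝ} {C : ℝ} (hq : Measurable q)
    (hqC : ∀ x, |q x| ≤ C) (a b : ℝ) : IntervalIntegrable q volume a b :=
  (intervalIntegrable_const (c := C)).mono_fun hq.aestronglyMeasurable
    (ae_of_all _ fun x => by
      simpa [abs_of_nonneg ((abs_nonneg _).trans (hqC x))] using hqC x)

/-- A test function of mean zero on the half line has a primitive which is a test function. -/
lemma exists_primitive_test {g : ℝ → ℝ} (hg : ContDiff ℝ ∞ g) (hgc : HasCompactSupport g)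
    (hgs : tsupport g ⊆ Ioi 0) (hg0 : ∫ x, g x = 0) :
    ∃ φ : ℝ → ℝ, ContDiff ℝ ∞ φ ∧ HasCompactSupport φ ∧ tsupport φ ⊆ Ioi 0 ∧ deriv φ = g := by
  obtain ⟨a, b, ha, hab⟩ : ∃ a b : ℝ, 0 < a ∧ tsupport g ⊆ Icc a b := by
    rcases (tsupport g).eq_empty_or_nonempty with h | h
    · exact ⟨1, 1, one_pos, by simp [h]⟩
    · obtain ⟨a, ha, ha'⟩ := hgc.isCompact.exists_isLeast h
      obtain ⟨b, hb, hb'⟩ := hgc.isCompact.exists_isGreatest h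
      exact ⟨a, b, hgs ha, fun x hx => ⟨ha' hx, hb' hx⟩⟩
  have hz : ∀ x, x ∉ Icc a b → g x = 0 := fun x hx =>
    image_eq_zero_of_notMem_tsupport fun h => hx (hab h)
  have hd : ∀ x, HasDerivAt (fun x => ∫ t in (0)..x, g t) (g x) x := fun x =>
    intervalIntegral.integral_hasDerivAt_right (hg.continuous.intervalIntegrable _ _)
      (hg.continuous.stronglyMeasurableAtFilter _ _) hg.continuous.continuousAt
  have hderiv : deriv (fun x => ∫ t in (0)..x, g t) = g := funext fun x => (hd x).deriv
  have hsupp : Function.support (fun x => ∫ t in (0)..x, g t) ⊆ Icc a b := by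
    intro x hx
    by_contra hxab
    apply hx
    rw [mem_Icc, not_and_or, not_le, not_le] at hxab
    rcases hxab with h | h
    · refine intervalIntegral.integral_zero_ae (ae_of_all _ fun t ht => hz t fun h' => ?_)
      have := ht.2
      rcases max_cases 0 x with h2 | h2 <;> linarith [h'.1]
    · have : Function.support g ⊆ Ioc 0 x := fun t ht => by
        have := hab (subset_tsupport g ht)
        exact ⟨lt_of_lt_of_le ha this.1, this.2.trans h.le⟩
      simp only
      rw [intervalIntegral.integral_eq_integral_of_support_subset this, hg0]
  have hts : tsupport (fun x => ∫ t in (0)..x, g t) ⊆ Icc a b :=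
    closure_minimal hsupp isClosed_Icc
  refine ⟨_, ?_, HasCompactSupport.of_support_subset_isCompact isCompact_Icc hsupp,
    hts.trans fun x hx => lt_of_lt_of_le ha hx.1, hderiv⟩
  rw [contDiff_infty_iff_deriv]
  exact ⟨fun x => (hd x).differentiableAt, by rw [hderiv]; exact hg⟩

/-- The du Bois-Reymond lemma on the half line: a function with bounded weak derivative `q` is
a primitive of `q`. -/
lemma ae_eq_const_add_integral {f q : ℝ → ℝ} {C : ℝ} (hC : 0 ≤ C) (hf : LocallyIntegrable f)
    (hq : Measurable q) (hqC : ∀ x, |q x| ≤ C)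
    (hweak : ∀ φ : ℝ → ℝ, ContDiff ℝ ∞ φ → HasCompactSupport φ → tsupport φ ⊆ Ioi 0 →
      ∫ x, f x * deriv φ x = - ∫ x, q x * φ x) :
    ∃ c : ℝ, ∀ᵐ x, x ∈ Ioi (0 : ℝ) → f x = c + ∫ s in (0)..x, q s := by
  set G : ℝ → ℝ := fun x => ∫ s in (0)..x, q s with hG
  have hGl : LipschitzWith C.toNNReal G := lipschitz_integral_of_bounded hC hq hqC
  have hqi := intervalIntegrable_of_bounded hq hqC
  have hGd : ∀ᵐ x, deriv G x = q x := by
    have hq' : LocallyIntegrable q :=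
      (locallyIntegrable_const C).mono hq.aestronglyMeasurable
        (ae_of_all _ fun x => by simpa [abs_of_nonneg hC] using hqC x)
    filter_upwards [LocallyIntegrable.ae_hasDerivAt_integral hq'] with x hx using (hx 0).deriv
  -- integration by parts for the primitive
  have hGweak : ∀ φ : ℝ → ℝ, ContDiff ℝ ∞ φ → HasCompactSupport φ →
      ∫ x, G x * deriv φ x = - ∫ x, q x * φ x := by
    intro φ hφ hφc
    obtain ⟨S, hS⟩ := hφc.isCompact.isBounded.subset_closedBall 0
    rw [Real.closedBall_eq_Icc, zero_sub, zero_add] at hS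
    set a := -(|S| + 1)
    set b := |S| + 1
    have hab : a ≤ b := by simp only [a, b]; linarith [abs_nonneg S]
    have hout : ∀ x, x ∉ Ioo a b → φ x = 0 ∧ deriv φ x = 0 := by
      intro x hx
      have hx' : x ∉ tsupport φ := fun h => hx (by
        have := hS h
        simp only [a, b]
        constructor <;> linarith [this.1, this.2, le_abs_self S])
      refine ⟨image_eq_zero_of_notMem_tsupport hx', ?_⟩
      exact image_eq_zero_of_notMem_tsupport fun h => hx' (closure_minimal
        (support_deriv_subset.trans subset_rfl) (isClosed_tsupport φ) h)
    have hφac : AbsolutelyContinuousOnInterval φ a b :=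
      (hφ.of_le (by norm_cast)).contDiffOn.absolutelyContinuousOnInterval
    have hGac : AbsolutelyContinuousOnInterval G a b :=
      (hGl.lipschitzOnWith (s := uIcc a b)).absolutelyContinuousOnInterval
    have hsub : ∀ F : ℝ → ℝ, (∀ x, x ∉ Ioo a b → F x = 0) → ∫ x in a..b, F x = ∫ x, F x := by
      intro F hF
      refine intervalIntegral.integral_eq_integral_of_support_subset fun x hx => ?_
      by_contra h
      exact hx (hF x fun h' => h ⟨h'.1, h'.2.le⟩)
    rw [← hsub _ fun x hx => by rw [(hout x hx).2, mul_zero],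
      ← hsub _ fun x hx => by rw [(hout x hx).1, mul_zero],
      hGac.integral_mul_deriv_eq_deriv_mul hφac, (hout a (by simp)).1, (hout b (by simp)).1,
      mul_zero, mul_zero, sub_zero, zero_sub]
    congr 1
    refine intervalIntegral.integral_congr_ae ?_
    filter_upwards [hGd] with x hx _
    rw [hx]
  let η₀ : ContDiffBump (1 : ℝ) := ⟨1 / 4, 1 / 2, by norm_num, by norm_num⟩
  set η := η₀.normed volume with hη
  have hη1 : ∫ x, η x = 1 := η₀.integral_normed
  have hηs : tsupport η ⊆ Ioi 0 := by
    rw [hη, η₀.tsupport_normed_eq, Real.closedBall_eq_Icc]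
    intro x hx
    have := hx.1
    simp only [η₀] at this
    exact lt_of_lt_of_le (by norm_num) this
  have hηd : ContDiff ℝ ∞ η := η₀.contDiff_normed
  have hηc : HasCompactSupport η := η₀.hasCompactSupport_normed
  have hu : LocallyIntegrable (fun x => f x - G x) :=
    hf.sub hGl.continuous.locallyIntegrable
  have hint : ∀ (F ψ : ℝ → ℝ), LocallyIntegrable F → ContDiff ℝ ∞ ψ → HasCompactSupport ψ →
      Integrable fun x => F x * ψ x := fun F ψ hF hψ hψc => by
    simpa [mul_comm] using hF.integrable_smul_right_of_hasCompactSupport hψ.continuous hψc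
  set c := ∫ x, (f x - G x) * η x with hc
  refine ⟨c, ?_⟩
  have hmain := isOpen_Ioi.ae_eq_zero_of_integral_contDiff_smul_eq_zero (U := Ioi (0 : ℝ))
    (μ := volume) (f := fun x => f x - G x - c)
    ((hu.sub (locallyIntegrable_const c)).locallyIntegrableOn _) ?_
  · filter_upwards [hmain] with x hx hx0
    have := hx hx0
    linarith
  intro ψ hψ hψc hψs
  set I := ∫ x, ψ x with hI
  have hψi : Integrable ψ := hψ.continuous.integrable_of_hasCompactSupport hψc
  have hηi : Integrable η := hηd.continuous.integrable_of_hasCompactSupport hηc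
  have hgs : tsupport (fun x => ψ x - I * η x) ⊆ tsupport ψ ∪ tsupport η := by
    refine closure_minimal (fun x hx => ?_) ((isClosed_tsupport _).union (isClosed_tsupport _))
    by_contra h
    rw [mem_union, not_or] at h
    apply hx
    simp [image_eq_zero_of_notMem_tsupport h.1, image_eq_zero_of_notMem_tsupport h.2]
  obtain ⟨φ, hφ, hφc, hφs, hφd⟩ := exists_primitive_test (g := fun x => ψ x - I * η x)
    (hψ.sub (contDiff_const.mul hηd))
    (IsCompact.of_isClosed_subset (hψc.isCompact.union hηc.isCompact) (isClosed_tsupport _) hgs)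
    (hgs.trans (union_subset hψs hηs)) (by
      rw [integral_sub hψi (hηi.const_mul I), integral_const_mul, hη1, mul_one, sub_self])
  have h1 := hweak φ hφ hφc hφs
  rw [← hGweak φ hφ hφc, hφd] at h1
  have h2 : ∫ x, (f x - G x) * (ψ x - I * η x) = 0 := by
    simp_rw [sub_mul]
    rw [integral_sub, h1, sub_self]
    · exact hint _ _ hf (hψ.sub (contDiff_const.mul hηd)) (IsCompact.of_isClosed_subset
        (hψc.isCompact.union hηc.isCompact) (isClosed_tsupport _) hgs)
    · exact hint _ _ hGl.continuous.locallyIntegrable (hψ.sub (contDiff_const.mul hηd))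
        (IsCompact.of_isClosed_subset (hψc.isCompact.union hηc.isCompact) (isClosed_tsupport _) hgs)
  have h3 : ∫ x, (f x - G x) * (ψ x - I * η x) = (∫ x, (f x - G x) * ψ x) - I * c := by
    rw [hc, ← integral_const_mul, ← integral_sub (hint _ _ hu hψ hψc)
      ((hint _ _ hu hηd hηc).const_mul I)]
    exact integral_congr_ae (ae_of_all _ fun x => by ring)
  have h4 : ∫ x, ψ x • (f x - G x - c) = (∫ x, (f x - G x) * ψ x) - I * c := by
    rw [mul_comm I c, hI, ← integral_const_mul, ← integral_sub (hint _ _ hu hψ hψc)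
      (hψi.const_mul c)]
    exact integral_congr_ae (ae_of_all _ fun x => by simp only [smul_eq_mul]; ring)
  rw [h4, ← h3, h2]

/-- Away from the origin the interaction force is the sum of a jump and of a primitive of
a bounded function. -/
lemma IsMildPotential.exists_decomposition {W : ℝ → ℝ} (hW : IsMildPotential W) :
    ∃ (c C : ℝ) (q : ℝ → ℝ), 0 ≤ C ∧ Measurable q ∧ (∀ x, |q x| ≤ C) ∧
      ∀ r, r ≠ 0 → deriv W r = c * SignType.sign r + ∫ s in (0)..r, q s := by
  obtain ⟨hf, f₁, -, hf₁, -, hweak, -⟩ := hW.sobolev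
  have hres : (volume : Measure ℝ).restrict {0}ᶜ = volume := by
    rw [Measure.restrict_eq_self_of_ae_mem]
    exact compl_mem_ae_iff.2 (measure_singleton _)
  rw [hres] at hf hf₁
  obtain ⟨q₀, C, hC, hq₀, hq₀C, hfq⟩ := exists_measurable_bounded_rep hf₁
  obtain ⟨c, hc⟩ := ae_eq_const_add_integral (f := deriv W) (q := q₀) hC
    (hf.locallyIntegrable le_top) hq₀ hq₀C (fun φ hφ hφc hφs => by
      have := hweak φ hφ hφc (hφs.trans fun x hx => ne_of_gt hx)
      rw [hres] at this
      rw [this]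
      congr 1
      refine integral_congr_ae ?_
      filter_upwards [hfq] with x hx
      rw [hx])
  have hGc : Continuous fun x => c + ∫ s in (0)..x, q₀ s :=
    continuous_const.add (lipschitz_integral_of_bounded hC hq₀ hq₀C).continuous
  -- `W` is a primitive of `deriv W`, hence of its continuous version
  have hpos : ∀ r, 0 < r → deriv W r = c + ∫ s in (0)..r, q₀ s := by
    intro r hr
    have hloc : ∀ x ∈ Ioi (0 : ℝ), W x - W r = ∫ t in r..x, c + ∫ s in (0)..t, q₀ s := by
      intro x hx
      obtain ⟨K, hK⟩ := hW.locallyLipschitz.locallyLipschitzOn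
        |>.exists_lipschitzOnWith_of_compact (isCompact_uIcc (a := r) (b := x))
      rw [← hK.absolutelyContinuousOnInterval.integral_deriv_eq_sub]
      refine intervalIntegral.integral_congr_ae ?_
      filter_upwards [hc] with t ht hts
      refine ht ?_
      rcases min_cases r x with h | h
      · exact lt_trans (by rw [h.1]; exact hr) hts.1
      · exact lt_trans (by rw [h.1]; exact hx) hts.1
    have hd : HasDerivAt (fun x => W r + ∫ t in r..x, c + ∫ s in (0)..t, q₀ s)
        (c + ∫ s in (0)..r, q₀ s) r :=
      (intervalIntegral.integral_hasDerivAt_right (hGc.intervalIntegrable _ _)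
        (hGc.stronglyMeasurableAtFilter _ _) hGc.continuousAt).const_add _
    refine (hd.congr_of_eventuallyEq ?_).deriv
    filter_upwards [Ioi_mem_nhds hr] with x hx
    rw [← hloc x hx]
    ring
  have habs : ∀ r, 0 ≤ r → ∫ s in (0)..r, q₀ |s| = ∫ s in (0)..r, q₀ s := by
    intro r hr
    refine intervalIntegral.integral_congr fun s hs => ?_
    rw [uIcc_of_le hr] at hs
    simp only [abs_of_nonneg hs.1]
  refine ⟨c, C, fun s => q₀ |s|, hC, hq₀.comp continuous_abs.measurable, fun x => hq₀C _,
    fun r hr => ?_⟩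
  rcases lt_or_gt_of_ne hr with h | h
  · have h1 : deriv W r = -deriv W (-r) := by
      have : (fun x => W (-x)) = W := funext hW.symmetric
      conv_lhs => rw [← this]
      rw [deriv_comp_neg]
    rw [h1, hpos (-r) (by linarith), ← habs (-r) (by linarith)]
    have h2 : ∫ s in (0)..(-r), q₀ |s| = ∫ s in r..0, q₀ |s| := by
      have := intervalIntegral.integral_comp_neg (a := r) (b := 0) (fun s => q₀ |s|)
      rw [neg_zero] at this
      rw [← this]
      simp
    rw [h2, intervalIntegral.integral_symm, sign_neg h]
    simp
    ring
  · rw [hpos r h, habs r h.le, sign_pos h]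
    simp

/-- Bounded functions are approximated in `L¹` on bounded intervals by Lipschitz functions with the
same bound. -/
lemma exists_lipschitz_approx {q : ℝ → ℝ} {C : ℝ} (hq : Measurable q) (hqC : ∀ x, |q x| ≤ C)
    {S : ℝ} (hS : 0 ≤ S) {ε : ℝ} (hε : 0 < ε) :
    ∃ (g : ℝ → ℝ) (K : ℝ≥0), LipschitzWith K g ∧ (∀ x, |g x| ≤ C) ∧
      ∫ x in (-S)..S, |q x - g x| ≤ ε := by
  have hC : 0 ≤ C := (abs_nonneg _).trans (hqC 0)
  have hSS : -S ≤ S := by linarith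
  have hqi : Integrable ((Icc (-S) S).indicator q) := by
    rw [integrable_indicator_iff measurableSet_Icc]
    exact IntegrableOn.of_bound (by simp) hq.aestronglyMeasurable C (ae_of_all _ hqC)
  obtain ⟨g, -, hgi, hgc, hg⟩ := hqi.exists_hasCompactSupport_integral_sub_le (ε := ε / 2)
    (by linarith)
  obtain ⟨p, hp⟩ := exists_polynomial_near_of_continuousOn (-S) S g hgc.continuousOn
    (ε / (4 * (S + 1))) (by positivity)
  obtain ⟨K, hK⟩ : ∃ K, LipschitzOnWith K (fun x => p.eval x) (Icc (-S) S) := by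
    have : ContDiffOn ℝ 1 (fun x => p.eval x) (Icc (-S) S) := by
      simpa [Polynomial.coe_aeval_eq_eval] using (p.contDiff_aeval (𝕜 := ℝ) 1).contDiffOn
    exact this.exists_lipschitzOnWith (by norm_num) (convex_Icc _ _) isCompact_Icc
  set P : ℝ → ℝ := fun x => p.eval (projIcc (-S) S hSS x : ℝ) with hP
  have hPl : LipschitzWith K P := by
    refine LipschitzWith.of_dist_le_mul fun x y => ?_
    refine (hK.dist_le_mul _ (projIcc _ _ hSS x).2 _ (projIcc _ _ hSS y).2).trans ?_
    have := (LipschitzWith.projIcc hSS).dist_le_mul x y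
    rw [NNReal.coe_one, one_mul] at this
    gcongr
    exact this
  refine ⟨fun x => max (-C) (min C (P x)), K, (hPl.const_min C).const_max (-C),
    fun x => abs_le.2 ⟨le_max_left _ _, max_le (by linarith) (min_le_left _ _)⟩, ?_⟩
  have hpt : ∀ x ∈ Icc (-S) S, |q x - max (-C) (min C (P x))|
      ≤ |(Icc (-S) S).indicator q x - g x| + ε / (4 * (S + 1)) := by
    intro x hx
    have h1 : |q x - max (-C) (min C (P x))| ≤ |q x - P x| := by
      have := abs_le.1 (hqC x)
      have e1 : q x = max (-C) (min C (q x)) := by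
        rw [min_eq_right this.2, max_eq_right this.1]
      have e2 := abs_max_sub_max_le_max (-C) (min C (q x)) (-C) (min C (P x))
      have e3 := abs_min_sub_min_le_max C (q x) C (P x)
      have e : ∀ u : ℝ, max 0 |u| = |u| := fun u => max_eq_right (abs_nonneg u)
      rw [sub_self, abs_zero, e] at e2 e3
      rw [← e1] at e2
      exact e2.trans e3
    have h2 : P x = p.eval x := by rw [hP]; simp only; rw [projIcc_of_mem hSS hx]
    have h3 := hp x hx
    rw [abs_sub_comm] at h3
    rw [indicator_of_mem hx]
    rw [h2] at h1 ⊢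
    have h4 := abs_sub_le (q x) (g x) (p.eval x)
    linarith
  have hgI : Integrable fun x => |(Icc (-S) S).indicator q x - g x| :=
    (hqi.sub hg).abs
  calc ∫ x in (-S)..S, |q x - max (-C) (min C (P x))|
      ≤ ∫ x in (-S)..S, (|(Icc (-S) S).indicator q x - g x| + ε / (4 * (S + 1))) := by
        refine intervalIntegral.integral_mono_on hSS ?_ ?_ hpt
        · have hPc : Continuous fun x => max (-C) (min C (P x)) :=
            continuous_const.max (continuous_const.min hPl.continuous)
          exact ((intervalIntegrable_of_bounded hq hqC _ _).sub (hPc.intervalIntegrable _ _)).abs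
        · exact hgI.intervalIntegrable.add intervalIntegrable_const
    _ = (∫ x in (-S)..S, |(Icc (-S) S).indicator q x - g x|) + ε / (4 * (S + 1)) * (2 * S) := by
        rw [intervalIntegral.integral_add hgI.intervalIntegrable intervalIntegrable_const,
          intervalIntegral.integral_const, smul_eq_mul]
        ring
    _ ≤ ε / 2 + ε / 2 := by
        refine add_le_add ?_ ?_
        · rw [intervalIntegral.integral_of_le hSS]
          refine le_trans (setIntegral_le_integral hgI (ae_of_all _ fun _ => abs_nonneg _)) ?_
          simpa [Real.norm_eq_abs] using hgi
        · rw [div_mul_eq_mul_div, div_le_iff₀ (by positivity)]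
          nlinarith
    _ = ε := by ring

/-! ### Functions of bounded variation against Lipschitz test functions -/

/-- A function of bounded variation that vanishes outside a bounded interval, tested against the
derivative of a Lipschitz function with values in `[-1, 1]`. The derivative is approximated in
`L¹` by polynomials. -/
lemma integral_mul_deriv_le_variation {f : ℝ → ℝ} {Df : SignedMeasure ℝ} {B R : ℝ}
    (hDf : ∀ φ : ℝ → ℝ, ContDiff ℝ ∞ φ → HasCompactSupport φ →
      ∫ x, f x * deriv φ x = - ∫ᵛ x, φ x ∂•Df)
    (hf : Integrable f) (hfB : ∀ᵐ x, |f x| ≤ B) (hfR : ∀ᵐ x, R < |x| → f x = 0) (hR : 0 ≤ R)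
    {φ : ℝ → ℝ} {K : ℝ≥0} (hφ : LipschitzWith K φ) (hφ1 : ∀ x, |φ x| ≤ 1) :
    ∫ x, f x * deriv φ x ≤ Df.variation.real univ := by
  have hfin : IsFiniteMeasure Df.variation := by
    rw [← SignedMeasure.totalVariation_eq_variation]; infer_instance
  have hB : 0 ≤ B := by
    obtain ⟨x, hx⟩ := hfB.exists
    exact (abs_nonneg _).trans hx
  set S : ℝ := R + 2 with hS
  have hSS : -S ≤ S := by linarith
  -- a smooth cutoff that equals one where `f` lives
  let χ : ContDiffBump (0 : ℝ) := ⟨R + 1, S, by linarith, by linarith⟩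
  have hχ1 : ∀ x : ℝ, |x| ≤ R + 1 → χ x = 1 := fun x hx =>
    χ.one_of_mem_closedBall (by simpa [Metric.mem_closedBall, Real.dist_eq] using hx)
  have hχ0 : ∀ x : ℝ, S ≤ |x| → χ x = 0 := fun x hx =>
    χ.zero_of_le_dist (by simpa [Real.dist_eq] using hx)
  have main : ∀ ε > 0, ∫ x, f x * deriv φ x
      ≤ (1 + ε * (1 + 2 * S)) * Df.variation.real univ + B * (ε * (1 + 2 * S)) := by
    intro ε hε
    obtain ⟨g, Kg, hg, -, hgε⟩ := exists_lipschitz_approx (measurable_deriv φ)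
      (C := K) (fun x => by simpa using norm_deriv_le_of_lipschitz (x₀ := x) hφ)
      (show 0 ≤ S by linarith) hε
    obtain ⟨p, hp⟩ := exists_polynomial_near_of_continuousOn (-S) S g hg.continuous.continuousOn ε hε
    have hpc : Continuous fun x => p.eval x := by fun_prop
    have hφi : ∀ a b, IntervalIntegrable (deriv φ) volume a b := fun a b =>
      ((hφ.lipschitzOnWith (s := uIcc a b)).absolutelyContinuousOnInterval
        ).intervalIntegrable_deriv
    have hL1 : ∫ x in (-S)..S, |deriv φ x - p.eval x| ≤ ε * (1 + 2 * S) := by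
      have h1 : ∫ x in (-S)..S, |deriv φ x - p.eval x|
          ≤ ∫ x in (-S)..S, (|deriv φ x - g x| + ε) := by
        refine intervalIntegral.integral_mono_on hSS
          ((hφi _ _).sub (hpc.intervalIntegrable _ _)).abs
          ((((hφi _ _).sub (hg.continuous.intervalIntegrable _ _)).abs).add
            intervalIntegrable_const) fun x hx => ?_
        have := (hp x hx).le
        rw [abs_sub_comm] at this
        have h3 := abs_sub_le (deriv φ x) (g x) (p.eval x)
        linarith
      rw [intervalIntegral.integral_add ((hφi _ _).sub (hg.continuous.intervalIntegrable _ _)).abs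
        intervalIntegrable_const, intervalIntegral.integral_const, smul_eq_mul] at h1
      linarith
    -- the smooth primitive of the polynomial, close to `φ`
    set P : ℝ → ℝ := fun x => φ (-S) + ∫ y in (-S)..x, p.eval y with hP
    have hPd : ∀ x, HasDerivAt P (p.eval x) x := fun x =>
      (intervalIntegral.integral_hasDerivAt_right (hpc.intervalIntegrable _ _)
        (hpc.stronglyMeasurableAtFilter _ _) hpc.continuousAt).const_add _
    have hPs : ContDiff ℝ ∞ P := by
      rw [contDiff_infty_iff_deriv]
      refine ⟨fun x => (hPd x).differentiableAt, ?_⟩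
      rw [show deriv P = fun x => p.eval x from funext fun x => (hPd x).deriv]
      simpa [Polynomial.coe_aeval_eq_eval] using p.contDiff_aeval (𝕜 := ℝ) ∞
    have hPφ : ∀ x, |x| ≤ S → |P x| ≤ 1 + ε * (1 + 2 * S) := by
      intro x hx
      obtain ⟨hx1, hx2⟩ := abs_le.1 hx
      have h1 : φ x = φ (-S) + ∫ y in (-S)..x, deriv φ y := by
        rw [(hφ.lipschitzOnWith (s := uIcc (-S) x)).absolutelyContinuousOnInterval
          |>.integral_deriv_eq_sub]
        ring
      have h2 : P x - φ x = ∫ y in (-S)..x, (p.eval y - deriv φ y) := by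
        rw [intervalIntegral.integral_sub (hpc.intervalIntegrable _ _) (hφi _ _), h1, hP]
        ring
      have h3 : |P x - φ x| ≤ ε * (1 + 2 * S) := by
        rw [h2]
        refine (intervalIntegral.abs_integral_le_integral_abs hx1).trans (le_trans ?_ hL1)
        simp_rw [abs_sub_comm (p.eval _)]
        refine intervalIntegral.integral_mono_interval le_rfl hx1 hx2
          (ae_of_all _ fun y => abs_nonneg _) ((hφi _ _).sub (hpc.intervalIntegrable _ _)).abs
      have := abs_sub_abs_le_abs_sub (P x) (φ x)
      linarith [hφ1 x]
    have htest := hDf (fun x => χ x * P x) (χ.contDiff.mul hPs) χ.hasCompactSupport.mul_right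
    have hbound : |∫ᵛ x, χ x * P x ∂•Df| ≤ (1 + ε * (1 + 2 * S)) * Df.variation.real univ := by
      have := VectorMeasure.norm_integral_le_of_norm_le_const (μ := Df)
        (B := ContinuousLinearMap.lsmul ℝ ℝ) (f := fun x => χ x * P x)
        (C := 1 + ε * (1 + 2 * S)) (ae_of_all _ fun x => ?_)
      · rwa [ContinuousLinearMap.opNorm_lsmul, mul_one] at this
      · rw [norm_mul, Real.norm_eq_abs, Real.norm_eq_abs, abs_of_nonneg χ.nonneg]
        rcases le_total S |x| with h | h
        · rw [hχ0 x h, zero_mul]; positivity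
        · calc χ x * |P x| ≤ 1 * |P x| := by gcongr; exact χ.le_one
            _ ≤ _ := by rw [one_mul]; exact hPφ x h
    have hder : ∫ x, f x * deriv (fun x => χ x * P x) x = ∫ x, f x * p.eval x := by
      refine integral_congr_ae ?_
      filter_upwards [hfR] with x hx
      by_cases h : R < |x|
      · rw [hx h, zero_mul, zero_mul]
      · congr 1
        have hnear : (fun x => χ x * P x) =ᶠ[𝓝 x] P := by
          have : {y : ℝ | |y| < R + 1} ∈ 𝓝 x :=
            (isOpen_lt continuous_abs continuous_const).mem_nhds (by
              show |x| < R + 1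
              linarith)
          filter_upwards [this] with y hy
          rw [hχ1 y (le_of_lt hy), one_mul]
        rw [hnear.deriv_eq, (hPd x).deriv]
    -- only the interval `[-S, S]` matters in the integrals
    have hres : ∀ u : ℝ → ℝ, ∫ x, f x * u x = ∫ x in (-S)..S, f x * u x := by
      intro u
      rw [intervalIntegral.integral_of_le hSS, ← integral_indicator measurableSet_Ioc]
      refine integral_congr_ae ?_
      filter_upwards [hfR] with x hx
      by_cases h : x ∈ Ioc (-S) S
      · rw [indicator_of_mem h]
      · rw [indicator_of_notMem h, hx, zero_mul]
        by_contra h'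
        obtain ⟨h1, h2⟩ := abs_le.1 (not_lt.1 h')
        exact h ⟨by linarith, by linarith⟩
    have hdiff : (∫ x, f x * deriv φ x) - ∫ x, f x * p.eval x ≤ B * (ε * (1 + 2 * S)) := by
      have hint1 : IntervalIntegrable (fun x => f x * deriv φ x) volume (-S) S := by
        refine (hf.mul_bdd (c := K) (measurable_deriv φ).aestronglyMeasurable
          (ae_of_all _ fun x => norm_deriv_le_of_lipschitz hφ)).intervalIntegrable
      have hint2 : IntervalIntegrable (fun x => f x * p.eval x) volume (-S) S :=
        hf.intervalIntegrable.mul_continuousOn hpc.continuousOn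
      rw [hres, hres, ← intervalIntegral.integral_sub hint1 hint2]
      refine le_trans ?_ (mul_le_mul_of_nonneg_left hL1 hB)
      rw [← intervalIntegral.integral_const_mul]
      refine intervalIntegral.integral_mono_ae hSS (hint1.sub hint2)
        (((hφi _ _).sub (hpc.intervalIntegrable _ _)).abs.const_mul _) ?_
      filter_upwards [hfB] with x hx
      rw [← mul_sub]
      refine (le_abs_self _).trans ?_
      rw [abs_mul]
      gcongr
    rw [hder] at htest
    have := (abs_le.1 hbound).1
    linarith
  refine le_of_forall_pos_le_add fun ε hε => ?_
  have hV : 0 ≤ Df.variation.real univ := measureReal_nonneg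
  have hc : 0 < (1 + 2 * S) * (Df.variation.real univ + B + 1) := by positivity
  refine (main (ε / ((1 + 2 * S) * (Df.variation.real univ + B + 1))) (by positivity)).trans ?_
  have h1 : ε / ((1 + 2 * S) * (Df.variation.real univ + B + 1)) * (1 + 2 * S)
      = ε / (Df.variation.real univ + B + 1) := by
    have h0 : 1 + 2 * S ≠ 0 := by positivity
    rw [div_mul_eq_mul_div, mul_comm ε, mul_div_mul_left _ _ h0]
  rw [h1]
  have h2 : ε / (Df.variation.real univ + B + 1) * (Df.variation.real univ + B) ≤ ε := by
    rw [div_mul_eq_mul_div, div_le_iff₀ (by positivity)]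
    nlinarith
  linarith

/-! ### Piecewise linear interpolation -/

/-- The continuous function that equals `s i` at the node `y i`, is affine on the cells and
constant outside `[y 0, y N]`. -/
noncomputable def nodeInterpolation (y s : ℕ → ℝ) (N : ℕ) (z : ℝ) : ℝ :=
  s 0 + ∑ i ∈ Finset.range N,
    (s (i + 1) - s i) / (y (i + 1) - y i) * (min z (y (i + 1)) - min z (y i))

lemma exists_lipschitz_nodeInterpolation (y s : ℕ → ℝ) (N : ℕ) :
    ∃ K : ℝ≥0, LipschitzWith K (nodeInterpolation y s N) := by
  induction N with
  | zero =>
    refine ⟨0, ?_⟩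
    have : nodeInterpolation y s 0 = fun _ => s 0 := by ext z; simp [nodeInterpolation]
    rw [this]
    exact LipschitzWith.const _
  | succ n ih =>
    obtain ⟨K, hK⟩ := ih
    have hmin : ∀ b : ℝ, LipschitzWith 1 fun z : ℝ => min z b := fun b =>
      LipschitzWith.id.min_const b
    have hstep : nodeInterpolation y s (n + 1) = fun z => nodeInterpolation y s n z
        + ((s (n + 1) - s n) / (y (n + 1) - y n)) • (min z (y (n + 1)) - min z (y n)) := by
      ext z
      rw [nodeInterpolation, Finset.sum_range_succ, nodeInterpolation, smul_eq_mul, add_assoc]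
    rw [hstep]
    exact ⟨_, hK.add ((lipschitzWith_smul ((s (n + 1) - s n) / (y (n + 1) - y n))).comp ((hmin (y (n + 1))).sub (hmin (y n))))⟩

lemma nodeInterpolation_eq_and_abs_le {y s : ℕ → ℝ} (hs : ∀ k, |s k| ≤ 1) {N : ℕ}
    (hy : ∀ i < N, y i < y (i + 1)) (z : ℝ) :
    (y N ≤ z → nodeInterpolation y s N z = s N) ∧ |nodeInterpolation y s N z| ≤ 1 := by
  induction N with
  | zero => simp [nodeInterpolation, hs 0]
  | succ n ih =>
    obtain ⟨ih1, ih2⟩ := ih fun i hi => hy i (by omega)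
    have hlt := hy n (by omega)
    have hstep : nodeInterpolation y s (n + 1) z = nodeInterpolation y s n z
        + (s (n + 1) - s n) / (y (n + 1) - y n) * (min z (y (n + 1)) - min z (y n)) := by
      rw [nodeInterpolation, Finset.sum_range_succ, nodeInterpolation]; ring
    rcases le_total z (y n) with hz | hz
    · rw [hstep, min_eq_left hz, min_eq_left (hz.trans hlt.le)]
      refine ⟨fun h => absurd (h.trans hz) (not_le.2 hlt), by simpa using ih2⟩
    · rw [hstep, ih1 hz, min_eq_right hz]
      set θ := (min z (y (n + 1)) - y n) / (y (n + 1) - y n) with hθ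
      have hθ0 : 0 ≤ θ := div_nonneg (sub_nonneg.2 (le_min hz hlt.le)) (by linarith)
      have hθ1 : θ ≤ 1 := (div_le_one (by linarith)).2 (by linarith [min_le_right z (y (n + 1))])
      have heq : (s (n + 1) - s n) / (y (n + 1) - y n) * (min z (y (n + 1)) - y n)
          = (s (n + 1) - s n) * θ := by rw [hθ]; ring
      rw [heq]
      refine ⟨fun h => ?_, ?_⟩
      · rw [hθ, min_eq_right h, div_self (by linarith)]; ring
      · have h1 := abs_le.1 (hs n)
        have h2 := abs_le.1 (hs (n + 1))
        rw [abs_le]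
        constructor <;> nlinarith

lemma deriv_nodeInterpolation {y s : ℕ → ℝ} {N : ℕ} (hy : ∀ i < N, y i < y (i + 1)) {z : ℝ}
    (hz : ∀ i ≤ N, z ≠ y i) :
    deriv (nodeInterpolation y s N) z = ∑ i ∈ Finset.range N, (Ioc (y i) (y (i + 1))).indicator
      (fun _ => (s (i + 1) - s i) / (y (i + 1) - y i)) z := by
  have : HasDerivAt (nodeInterpolation y s N) (∑ i ∈ Finset.range N,
      (s (i + 1) - s i) / (y (i + 1) - y i) *
        ((if z < y (i + 1) then 1 else 0) - (if z < y i then 1 else 0))) z := by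
    have := (HasDerivAt.fun_sum (u := Finset.range N) (x := z)
      (A := fun i z => (s (i + 1) - s i) / (y (i + 1) - y i) * (min z (y (i + 1)) - min z (y i)))
      (A' := fun i => (s (i + 1) - s i) / (y (i + 1) - y i) *
        ((if z < y (i + 1) then 1 else 0) - (if z < y i then 1 else 0))) fun i hi =>
      ((hasDerivAt_min_const (hz (i + 1) (Finset.mem_range.1 hi))).sub
        (hasDerivAt_min_const (hz i (Finset.mem_range.1 hi).le))).const_mul _).const_add (s 0)
    exact this
  rw [this.deriv]
  refine Finset.sum_congr rfl fun i hi => ?_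
  have hi' := Finset.mem_range.1 hi
  have h1 := hy i hi'
  rcases lt_or_gt_of_ne (hz i hi'.le) with h2 | h2
  · rw [if_pos h2, if_pos (h2.trans h1), indicator_of_notMem fun h => absurd h.1 (not_lt.2 h2.le)]
    ring
  · rcases lt_or_gt_of_ne (hz (i + 1) hi') with h4 | h4
    · rw [if_neg h2.not_gt, if_pos h4, indicator_of_mem (show z ∈ Ioc _ _ from ⟨h2, h4.le⟩)]; ring
    · rw [if_neg h2.not_gt, if_neg h4.not_gt, indicator_of_notMem fun h => absurd h.2 (not_le.2 h4)]
      ring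

/-! ### The initial configuration -/

section Initial

variable {ρbar : ℝ → ℝ} {m : ℝ} {N : ℕ} {y : ℕ → ℝ}

lemma ae_eq_zero_of_notMem_essSupport (hρ : AEMeasurable ρbar) :
    ∀ᵐ x, x ∉ essSupport ρbar → ρbar x = 0 := by
  have h : (volume.withDensity fun x => ‖ρbar x‖ₑ) (essSupport ρbar)ᶜ = 0 :=
    Measure.measure_compl_support
  rw [withDensity_apply_eq_zero' hρ.enorm] at h
  filter_upwards [measure_eq_zero_iff_ae_notMem.1 h] with x hx hx'
  by_contra h0
  exact hx ⟨by simpa using h0, hx'⟩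

lemma IsInitialConfiguration.ae_eq_zero {h : ℝ} (hy : IsInitialConfiguration ρbar N h y)
    (hρ : AEMeasurable ρbar) : ∀ᵐ x, x ∉ Icc (y 0) (y N) → ρbar x = 0 := by
  filter_upwards [ae_eq_zero_of_notMem_essSupport hρ] with x hx hx'
  exact hx fun hmem => hx' ⟨hy.first.2 hmem, hy.last.2 hmem⟩

/-- Every cell of the initial configuration carries the mass `h = m / N`. -/
lemma IsInitialConfiguration.integral_cell (hρ : IsInitialDatum ρbar m)
    (hy : IsInitialConfiguration ρbar N (m / N) y) (hN : 0 < N) {i : ℕ} (hi : i < N) :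
    ∫ z in (y i)..(y (i + 1)), ρbar z = m / N := by
  have hint : ∀ a b, IntervalIntegrable ρbar volume a b := fun a b => hρ.bv.1.intervalIntegrable
  have hN' : (0 : ℝ) < N := Nat.cast_pos.2 hN
  have hh : 0 < m / N := div_pos hρ.mass_pos hN'
  -- the nodes are characterised by the values of the distribution function of `ρbar`
  set G : ℝ → ℝ := fun x => ∫ z in (y 0)..x, ρbar z with hG
  have hGc : Continuous G := intervalIntegral.continuous_primitive hint _
  have hGsub : ∀ a b, ∫ z in a..b, ρbar z = G b - G a := fun a b =>
    (intervalIntegral.integral_interval_sub_left (hint _ _) (hint _ _)).symm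
  have hGmono : Monotone G := fun a b hab => by
    have : 0 ≤ ∫ z in a..b, ρbar z :=
      intervalIntegral.integral_nonneg_of_ae hab hρ.nonneg
    rw [hGsub] at this
    linarith
  have hGN : G (y N) = m := by
    have h0N : y 0 ≤ y N := hy.last.2 hy.first.1
    rw [← hρ.mass, hG]
    show ∫ z in (y 0)..(y N), ρbar z = _
    rw [intervalIntegral.integral_of_le h0N, ← integral_Icc_eq_integral_Ioc,
      ← integral_indicator measurableSet_Icc]
    refine integral_congr_ae ?_
    filter_upwards [hy.ae_eq_zero hρ.bv.1.aestronglyMeasurable.aemeasurable] with x hx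
    by_cases h : x ∈ Icc (y 0) (y N)
    · rw [indicator_of_mem h]
    · rw [indicator_of_notMem h, hx h]
  have key : ∀ k < N, G (y k) = k * (m / N) := by
    intro k
    induction k with
    | zero => intro _; simp [hG]
    | succ n ih =>
      intro hn
      have ihn := ih (by omega)
      have hset : {x : ℝ | ∫ z in (y n)..x, ρbar z < m / N} = {x | G x < (n + 1 : ℕ) * (m / N)} := by
        ext x
        rw [mem_ofPred_eq, mem_ofPred_eq, hGsub, ihn, sub_lt_iff_lt_add]
        push_cast
        rw [show ((n : ℝ) + 1) * (m / N) = m / N + n * (m / N) by ring]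
      have hstep := hy.step (n + 1) (by omega) hn
      rw [Nat.add_sub_cancel, hset] at hstep
      have hlt : ((n + 1 : ℕ) : ℝ) * (m / N) < m := by
        have : ((n + 1 : ℕ) : ℝ) < N := Nat.cast_lt.2 hn
        calc ((n + 1 : ℕ) : ℝ) * (m / N) < N * (m / N) := by gcongr
          _ = m := by field_simp
      have hne : {x | G x < (n + 1 : ℕ) * (m / N)}.Nonempty := by
        refine ⟨y n, ?_⟩
        rw [mem_ofPred_eq, ihn]
        push_cast
        linarith
      have hbdd : BddAbove {x | G x < (n + 1 : ℕ) * (m / N)} := by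
        refine ⟨y N, fun x hx => ?_⟩
        by_contra hlt'
        have := hGmono (not_le.1 hlt').le
        rw [hGN] at this
        exact absurd (hx.trans hlt) (not_lt.2 this)
      refine le_antisymm ?_ ?_
      · have hcl := csSup_mem_closure hne hbdd
        rw [← hstep] at hcl
        have hclosed : IsClosed {x | G x ≤ (n + 1 : ℕ) * (m / N)} :=
          isClosed_le hGc continuous_const
        exact closure_minimal (fun x (hx : G x < _) => show G x ≤ _ from hx.le) hclosed hcl
      · by_contra hcon
        have hopen : IsOpen {x | G x < (n + 1 : ℕ) * (m / N)} := isOpen_lt hGc continuous_const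
        obtain ⟨ε, hε, hball⟩ := Metric.isOpen_iff.1 hopen (y (n + 1)) (not_le.1 hcon)
        have hmem : y (n + 1) + ε / 2 ∈ Metric.ball (y (n + 1)) ε := by
          rw [Metric.mem_ball, Real.dist_eq, add_sub_cancel_left, abs_of_pos (by linarith)]
          linarith
        have := le_csSup hbdd (hball hmem)
        rw [← hstep] at this
        linarith
  rw [hGsub, key i hi]
  rcases Nat.lt_or_ge (i + 1) N with h | h
  · rw [key _ h]; push_cast; ring
  · obtain rfl : i + 1 = N := by omega
    rw [hGN]
    field_simp
    push_cast
    ring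

/-- The initial cell densities are averages of `ρbar`, hence bounded by its supremum. -/
lemma IsInitialConfiguration.cellDensity_le (hρ : IsInitialDatum ρbar m)
    (hy : IsInitialConfiguration ρbar N (m / N) y) (hN : 0 < N)
    (hord : ∀ i < N, y i < y (i + 1)) {B : ℝ} (hB : ∀ᵐ x, |ρbar x| ≤ B) {i : ℕ} (hi : i < N) :
    cellDensity (m / N) y i ≤ B := by
  have hlt := hord i hi
  rw [cellDensity, div_le_iff₀ (sub_pos.2 hlt), ← hy.integral_cell hρ hN hi]
  calc ∫ z in (y i)..(y (i + 1)), ρbar z ≤ ∫ z in (y i)..(y (i + 1)), B := by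
        refine intervalIntegral.integral_mono_ae hlt.le hρ.bv.1.intervalIntegrable
          intervalIntegrable_const ?_
        filter_upwards [hB] with x hx using (le_abs_self _).trans hx
    _ = B * (y (i + 1) - y i) := by rw [intervalIntegral.integral_const, smul_eq_mul, mul_comm]

/-- The total variation of the initial cell densities is controlled independently of `N`: it equals
the integral of `ρbar` against the derivative of a piecewise linear function with values in
`[-1, 1]`, because the densities are averages of `ρbar` over the cells. -/
lemma exists_initial_variation_bound (hρ : IsInitialDatum ρbar m) :
    ∃ TV : ℝ, ∀ (N : ℕ) (y : ℕ → ℝ), 0 < N → IsInitialConfiguration ρbar N (m / N) y →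
      (∀ i < N, y i < y (i + 1)) →
      ∑ k ∈ Finset.range (N + 1), |pad N (cellDensity (m / N) y) (k + 1)
        - pad N (cellDensity (m / N) y) k| ≤ TV := by
  obtain ⟨hint, Df, hDf⟩ := hρ.bv
  refine ⟨Df.variation.real univ, fun N y hN hy hord => ?_⟩
  set r := cellDensity (m / N) y with hr
  -- test with the interpolation of the signs of the jumps
  set d : ℕ → ℝ := fun k => pad N r (k + 1) - pad N r k with hd
  set s : ℕ → ℝ := fun k => if 0 ≤ d k then 1 else -1 with hs
  have hs1 : ∀ k, |-s k| ≤ 1 := fun k => by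
    rw [hs]; dsimp only; split_ifs <;> simp
  have hsd : ∀ k, |d k| = s k * d k := fun k => by
    rw [hs]; dsimp only; split_ifs with h
    · rw [abs_of_nonneg h, one_mul]
    · rw [abs_of_neg (not_le.1 h)]; ring
  obtain ⟨K, hK⟩ := exists_lipschitz_nodeInterpolation y (fun k => -s k) N
  have hbound : ∀ᵐ x, |ρbar x| ≤ (eLpNorm ρbar ⊤ volume).toReal := by
    have := ae_le_eLpNormEssSup (f := ρbar) (μ := volume)
    filter_upwards [this] with x hx
    have h2 := hρ.bounded.2
    rw [eLpNorm_exponent_top] at h2 ⊢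
    have h3 := ENNReal.toReal_mono h2.ne hx
    simpa using h3
  have hzero : ∀ᵐ x, max |y 0| |y N| < |x| → ρbar x = 0 := by
    filter_upwards [hy.ae_eq_zero hint.aestronglyMeasurable.aemeasurable] with x hx h
    refine hx fun hmem => absurd h (not_lt.2 ?_)
    rw [abs_le]
    exact ⟨by linarith [neg_abs_le (y 0), le_max_left |y 0| |y N|, hmem.1],
      by linarith [le_abs_self (y N), le_max_right |y 0| |y N|, hmem.2]⟩
  have hmain := integral_mul_deriv_le_variation hDf hint hbound hzero (by positivity) hK
    fun x => (nodeInterpolation_eq_and_abs_le hs1 hord x).2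
  refine le_trans (le_of_eq ?_) hmain
  calc ∑ k ∈ Finset.range (N + 1), |d k|
      = ∑ i ∈ Finset.range N, (s i - s (i + 1)) * r i := by
        rw [← sum_mul_pad_sub]
        exact Finset.sum_congr rfl fun k _ => hsd k
    _ = ∑ i ∈ Finset.range N, ∫ x, (Ioc (y i) (y (i + 1))).indicator
          (fun x => ρbar x * ((-s (i + 1) - -s i) / (y (i + 1) - y i))) x := by
        refine Finset.sum_congr rfl fun i hi => ?_
        have hi' := Finset.mem_range.1 hi
        rw [integral_indicator measurableSet_Ioc, integral_mul_const,
          ← intervalIntegral.integral_of_le (hord i hi').le, hy.integral_cell hρ hN hi', hr,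
          cellDensity]
        ring
    _ = ∫ x, ρbar x * deriv (nodeInterpolation y (fun k => -s k) N) x := by
        rw [← integral_finsetSum _ fun i _ => (hint.mul_const _).indicator measurableSet_Ioc]
        refine integral_congr_ae ?_
        filter_upwards [ae_ne_node N y] with x hx
        rw [deriv_nodeInterpolation hord hx, Finset.mul_sum]
        refine Finset.sum_congr rfl fun i _ => ?_
        by_cases h : x ∈ Ioc (y i) (y (i + 1))
        · rw [indicator_of_mem h, indicator_of_mem h]
        · rw [indicator_of_notMem h, indicator_of_notMem h, mul_zero]

end Initial

/-! ### The compression of a configuration -/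

/-- The absolutely continuous part `p(z) + ∑_j h q(z - y_j)` of the spatial derivative of the force
field generated by the particles `y_0, …, y_N`. -/
noncomputable def compression (p q : ℝ → ℝ) (N : ℕ) (h : ℝ) (y : ℕ → ℝ) (z : ℝ) : ℝ :=
  p z + ∑ j ∈ Finset.range (N + 1), h * q (z - y j)

/-- The average of the compression over the `i`-th cell, where `i = k - 1` is kept between `0` and
`N - 1`, in line with the indexing of padded sequences. -/
noncomputable def cellCompression (p q : ℝ → ℝ) (N : ℕ) (h : ℝ) (y : ℕ → ℝ) (k : ℕ) : ℝ :=
  ∫ θ in (0 : ℝ)..1, compression p q N h y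
    (y (min (k - 1) (N - 1)) + θ * (y (min (k - 1) (N - 1) + 1) - y (min (k - 1) (N - 1))))

section Static

variable {p q : ℝ → ℝ} {N : ℕ} {h : ℝ} {y : ℕ → ℝ}

lemma sum_sign_sub {N : ℕ} {y : ℕ → ℝ} (hy : ∀ i < N, y i < y (i + 1)) {i : ℕ} (hi : i ≤ N) :
    ∑ j ∈ Finset.range (N + 1), (SignType.sign (y i - y j) : ℝ) = 2 * i - N := by
  have hlt : ∀ {j k : ℕ}, j < k → k ≤ N → y j < y k := fun {j k} hjk hk =>
    (hy j (by omega)).trans_le (le_of_lt_succ hy hjk hk)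
  obtain ⟨n, rfl⟩ := Nat.exists_eq_add_of_le hi
  rw [show i + n + 1 = i + (1 + n) by omega, Finset.sum_range_add, Finset.sum_range_add]
  have h1 : ∑ j ∈ Finset.range i, (SignType.sign (y i - y j) : ℝ) = i := by
    rw [Finset.sum_congr rfl (g := fun _ => (1 : ℝ))]
    · simp
    · intro j hj
      rw [sign_pos (sub_pos.2 (hlt (Finset.mem_range.1 hj) hi))]; rfl
  have h2 : ∑ j ∈ Finset.range n, (SignType.sign (y i - y (i + (1 + j))) : ℝ) = -n := by
    rw [Finset.sum_congr rfl (g := fun _ => (-1 : ℝ))]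
    · simp
    · intro j hj
      have := Finset.mem_range.1 hj
      rw [sign_neg (sub_neg.2 (hlt (by omega) (by omega)))]; rfl
  rw [h1, h2]
  simp
  ring

/-- The jump of `W'` at the origin contributes a force that depends only on the order of the
particles. -/
lemma force_eq {V W : ℝ → ℝ} {c : ℝ}
    (hW : ∀ r, r ≠ 0 → deriv W r = c * SignType.sign r + ∫ s in (0)..r, q s)
    (hy : ∀ i < N, y i < y (i + 1)) {i : ℕ} (hi : i ≤ N) :
    force V W N h y i = deriv V (y i) + c * h * (2 * i - N)
      + ∑ j ∈ Finset.range (N + 1), h * ∫ s in (0)..(y i - y j), q s := by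
  have hne : ∀ j ≤ N, j ≠ i → y i - y j ≠ 0 := by
    have hlt : ∀ {j k : ℕ}, j < k → k ≤ N → y j < y k := fun {j k} hjk hk =>
      (hy j (by omega)).trans_le (le_of_lt_succ hy hjk hk)
    intro j hj hji
    rcases lt_or_gt_of_ne hji with h | h
    · exact (sub_pos.2 (hlt h hi)).ne'
    · exact (sub_neg.2 (hlt h hj)).ne
  have hsum : ∑ j ∈ (Finset.range (N + 1)).erase i, h * deriv W (y i - y j)
      = ∑ j ∈ Finset.range (N + 1),
        (c * h * (SignType.sign (y i - y j) : ℝ) + h * ∫ s in (0)..(y i - y j), q s) := by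
    rw [← Finset.sum_erase (Finset.range (N + 1)) (a := i) (by simp)]
    refine Finset.sum_congr rfl fun j hj => ?_
    obtain ⟨h1, h2⟩ := Finset.mem_erase.1 hj
    rw [hW _ (hne j (Nat.lt_succ_iff.1 (Finset.mem_range.1 h2)) h1)]
    ring
  rw [force, hsum, Finset.sum_add_distrib, ← Finset.mul_sum, sum_sign_sub hy hi]
  ring

variable {A : ℝ}

lemma abs_compression_le {Cp Cq : ℝ} (hh : 0 ≤ h) (hp : ∀ x, |p x| ≤ Cp) (hq : ∀ x, |q x| ≤ Cq)
    (z : ℝ) : |compression p q N h y z| ≤ Cp + (N + 1) * h * Cq := by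
  refine (abs_add_le _ _).trans (add_le_add (hp z) ((Finset.abs_sum_le_sum_abs _ _).trans ?_))
  calc ∑ j ∈ Finset.range (N + 1), |h * q (z - y j)|
      ≤ ∑ _j ∈ Finset.range (N + 1), h * Cq := Finset.sum_le_sum fun _ _ => by
        rw [abs_mul, abs_of_nonneg hh]; gcongr; exact hq _
    _ = (N + 1) * h * Cq := by
        rw [Finset.sum_const, Finset.card_range, nsmul_eq_mul]; push_cast; ring

lemma measurable_compression (hp : Measurable p) (hq : Measurable q) :
    Measurable (compression p q N h y) :=
  hp.add (Finset.measurable_sum _ fun _ _ => (hq.comp (measurable_id.sub_const _)).const_mul h)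

lemma abs_compression_sub_le {Kp Kq : ℝ≥0} (hh : 0 ≤ h) (hp : LipschitzWith Kp p)
    (hq : LipschitzWith Kq q) (z w : ℝ) :
    |compression p q N h y z - compression p q N h y w| ≤ (Kp + (N + 1) * h * Kq) * |z - w| := by
  have h1 := hp.dist_le_mul z w
  rw [Real.dist_eq, Real.dist_eq] at h1
  rw [compression, compression, add_sub_add_comm, ← Finset.sum_sub_distrib]
  refine (abs_add_le _ _).trans ?_
  rw [add_mul]
  refine add_le_add h1 ((Finset.abs_sum_le_sum_abs _ _).trans ?_)
  calc ∑ j ∈ Finset.range (N + 1), |h * q (z - y j) - h * q (w - y j)|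
      ≤ ∑ _j ∈ Finset.range (N + 1), h * (Kq * |z - w|) := Finset.sum_le_sum fun j _ => by
        have h2 := hq.dist_le_mul (z - y j) (w - y j)
        rw [Real.dist_eq, Real.dist_eq, sub_sub_sub_cancel_right] at h2
        rw [← mul_sub, abs_mul, abs_of_nonneg hh]; gcongr
    _ = _ := by rw [Finset.sum_const, Finset.card_range, nsmul_eq_mul]; push_cast; ring

lemma intervalIntegrable_compression {Cp Cq : ℝ} (hh : 0 ≤ h) (hpm : Measurable p)
    (hqm : Measurable q) (hp : ∀ x, |p x| ≤ Cp) (hq : ∀ x, |q x| ≤ Cq) (a b : ℝ) :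
    IntervalIntegrable (compression p q N h y) volume a b :=
  intervalIntegrable_of_bounded (measurable_compression hpm hqm) (abs_compression_le hh hp hq) a b

/-- The force differences are the integrals of the compression over the cells, plus a contribution
of the jump of `W'`. -/
lemma force_sub_force {V W : ℝ → ℝ} {c R Cp Cq : ℝ} (hpm : Measurable p) (hqm : Measurable q)
    (hpC : ∀ x, |p x| ≤ Cp) (hqC : ∀ x, |q x| ≤ Cq)
    (hW : ∀ r, r ≠ 0 → deriv W r = c * SignType.sign r + ∫ s in (0)..r, q s)
    (hV : ∀ a ∈ Icc (-R) R, ∀ b ∈ Icc (-R) R, deriv V b - deriv V a = ∫ z in a..b, p z)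
    (hy : ∀ i < N, y i < y (i + 1)) (hR : ∀ i ≤ N, |y i| ≤ R) {i : ℕ} (hi : i < N) :
    force V W N h y (i + 1) - force V W N h y i
      = (∫ z in (y i)..(y (i + 1)), compression p q N h y z) + 2 * c * h := by
  have hqi := intervalIntegrable_of_bounded hqm hqC
  have hpi := intervalIntegrable_of_bounded hpm hpC
  have hqs : ∀ j a b, IntervalIntegrable (fun z => h * q (z - y j)) volume a b := fun j a b =>
    intervalIntegrable_of_bounded (C := |h| * Cq) ((hqm.comp (measurable_id.sub_const _)).const_mul h)
      (fun x => by rw [abs_mul]; gcongr; exact hqC _) a b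
  have hqsum : ∀ a b, IntervalIntegrable
      (fun z => ∑ j ∈ Finset.range (N + 1), h * q (z - y j)) volume a b := fun a b => by
    have := IntervalIntegrable.sum (Finset.range (N + 1)) fun j _ => hqs j a b
    rwa [Finset.sum_fn] at this
  have hint : ∫ z in (y i)..(y (i + 1)), compression p q N h y z
      = (∫ z in (y i)..(y (i + 1)), p z)
        + ∑ j ∈ Finset.range (N + 1), h * ((∫ s in (0)..(y (i + 1) - y j), q s)
          - ∫ s in (0)..(y i - y j), q s) := by
    simp only [compression]
    rw [intervalIntegral.integral_add (hpi _ _) (hqsum _ _),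
      intervalIntegral.integral_finsetSum fun j _ => hqs j _ _]
    congr 1
    refine Finset.sum_congr rfl fun j _ => ?_
    rw [intervalIntegral.integral_const_mul, intervalIntegral.integral_comp_sub_right,
      intervalIntegral.integral_interval_sub_left (hqi _ _) (hqi _ _)]
  rw [force_eq hW hy hi, force_eq hW hy hi.le, hint,
    ← hV _ (abs_le.1 (hR i hi.le)) _ (abs_le.1 (hR (i + 1) hi))]
  simp_rw [mul_sub]
  rw [Finset.sum_sub_distrib]
  push_cast
  ring

lemma abs_integral_compression_le (hA : ∀ z, |compression p q N h y z| ≤ A)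
    (hy : ∀ i < N, y i < y (i + 1)) {i : ℕ} (hi : i < N) :
    |∫ z in (y i)..(y (i + 1)), compression p q N h y z| ≤ A * (y (i + 1) - y i) := by
  have := intervalIntegral.norm_integral_le_of_norm_le_const (a := y i) (b := y (i + 1))
    (f := compression p q N h y) (C := A) fun z _ => hA z
  rwa [abs_of_pos (sub_pos.2 (hy i hi)), Real.norm_eq_abs] at this

lemma abs_cellCompression_le (hA : ∀ z, |compression p q N h y z| ≤ A) (k : ℕ) :
    |cellCompression p q N h y k| ≤ A := by
  have := intervalIntegral.norm_integral_le_of_norm_le_const (a := 0) (b := 1)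
    (f := fun θ => compression p q N h y (y (min (k - 1) (N - 1))
      + θ * (y (min (k - 1) (N - 1) + 1) - y (min (k - 1) (N - 1))))) (C := A) fun z _ => hA _
  rwa [sub_zero, abs_one, mul_one] at this

lemma cellCompression_succ_mul {i : ℕ} (hi : i < N) :
    cellCompression p q N h y (i + 1) * (y (i + 1) - y i)
      = ∫ z in (y i)..(y (i + 1)), compression p q N h y z := by
  have hmin : min (i + 1 - 1) (N - 1) = i := by omega
  have := intervalIntegral.mul_integral_comp_add_mul (a := (0 : ℝ)) (b := 1)
    (f := compression p q N h y) (c := y (i + 1) - y i) (y i)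
  rw [cellCompression, hmin, mul_comm]
  simp only [mul_zero, add_zero, mul_one, add_sub_cancel] at this
  rw [← this]
  simp_rw [mul_comm (y (i + 1) - y i)]

/-- A Lipschitz compression has averages of bounded variation. -/
lemma sum_abs_cellCompression_sub_le {R L : ℝ} (hL : 0 ≤ L) (hN : 0 < N)
    (hlip : ∀ z w, |compression p q N h y z - compression p q N h y w| ≤ L * |z - w|)
    (hy : ∀ i < N, y i < y (i + 1)) (hR : ∀ i ≤ N, |y i| ≤ R) :
    ∑ k ∈ Finset.range (N + 1),
      |cellCompression p q N h y (k + 1) - cellCompression p q N h y k| ≤ L * (4 * R) := by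
  have hcont : Continuous (compression p q N h y) := by
    have : LipschitzWith L.toNNReal (compression p q N h y) :=
      LipschitzWith.of_dist_le_mul fun z w => by
        rw [Real.dist_eq, Real.dist_eq, Real.coe_toNNReal _ hL]; exact hlip z w
    exact this.continuous
  -- the differences are controlled by increments of the monotone sequences `y (κ k)` and
  -- `y (κ k + 1)`, whose sum telescopes
  set κ : ℕ → ℕ := fun k => min (k - 1) (N - 1) with hκ
  have hterm : ∀ k ∈ Finset.range (N + 1),
      |cellCompression p q N h y (k + 1) - cellCompression p q N h y k|
        ≤ L * ((y (κ (k + 1)) - y (κ k)) + (y (κ (k + 1) + 1) - y (κ k + 1))) := by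
    intro k _
    have h1 : y (κ k) ≤ y (κ (k + 1)) := le_of_lt_succ hy (by simp only [hκ]; omega)
      (by simp only [hκ]; omega)
    have h2 : y (κ k + 1) ≤ y (κ (k + 1) + 1) := le_of_lt_succ hy (by simp only [hκ]; omega)
      (by simp only [hκ]; omega)
    have hi : ∀ i, IntervalIntegrable (fun θ => compression p q N h y
        (y i + θ * (y (i + 1) - y i))) volume 0 1 := fun i =>
      (hcont.comp (by fun_prop)).intervalIntegrable _ _
    rw [cellCompression, cellCompression, ← intervalIntegral.integral_sub (hi _) (hi _)]
    have := intervalIntegral.norm_integral_le_of_norm_le_const (a := (0 : ℝ)) (b := 1)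
      (f := fun θ => compression p q N h y (y (κ (k + 1)) + θ * (y (κ (k + 1) + 1) - y (κ (k + 1))))
        - compression p q N h y (y (κ k) + θ * (y (κ k + 1) - y (κ k))))
      (C := L * ((y (κ (k + 1)) - y (κ k)) + (y (κ (k + 1) + 1) - y (κ k + 1)))) ?_
    · simpa [hκ] using this
    · intro θ hθ
      rw [uIoc_of_le zero_le_one] at hθ
      refine (hlip _ _).trans (mul_le_mul_of_nonneg_left ?_ hL)
      have e : y (κ (k + 1)) + θ * (y (κ (k + 1) + 1) - y (κ (k + 1)))
          - (y (κ k) + θ * (y (κ k + 1) - y (κ k)))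
          = (1 - θ) * (y (κ (k + 1)) - y (κ k)) + θ * (y (κ (k + 1) + 1) - y (κ k + 1)) := by ring
      rw [e, abs_of_nonneg (add_nonneg (mul_nonneg (by linarith [hθ.2]) (by linarith))
        (mul_nonneg hθ.1.le (by linarith)))]
      nlinarith [hθ.1, hθ.2]
  refine (Finset.sum_le_sum hterm).trans ?_
  rw [← Finset.mul_sum, Finset.sum_add_distrib, Finset.sum_range_sub (fun k => y (κ k)),
    Finset.sum_range_sub (fun k => y (κ k + 1))]
  refine mul_le_mul_of_nonneg_left ?_ hL
  have h1 := abs_le.1 (hR (κ (N + 1)) (by simp only [hκ]; omega))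
  have h2 := abs_le.1 (hR (κ 0) (by simp only [hκ]; omega))
  have h3 := abs_le.1 (hR (κ (N + 1) + 1) (by simp only [hκ]; omega))
  have h4 := abs_le.1 (hR (κ 0 + 1) (by simp only [hκ]; omega))
  linarith [h1.1, h1.2, h2.1, h2.2, h3.1, h3.2, h4.1, h4.2]

/-- If `p`, `q` are replaced by functions that are `ε`-close in `L¹`, the cell averages of the
compression change little. -/
lemma sum_abs_integral_sub_cellCompression_le {p' q' : ℝ → ℝ} {R ε Cp Cq : ℝ} (hh : 0 ≤ h)
    (hpm : Measurable p) (hqm : Measurable q) (hpm' : Measurable p') (hqm' : Measurable q')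
    (hpC : ∀ x, |p x| ≤ Cp) (hqC : ∀ x, |q x| ≤ Cq) (hpC' : ∀ x, |p' x| ≤ Cp)
    (hqC' : ∀ x, |q' x| ≤ Cq) (hy : ∀ i < N, y i < y (i + 1)) (hR : ∀ i ≤ N, |y i| ≤ R)
    (hp : ∫ z in (-R)..R, |p z - p' z| ≤ ε) (hq : ∫ z in (-(2 * R))..(2 * R), |q z - q' z| ≤ ε) :
    ∑ i ∈ Finset.range N, |(∫ z in (y i)..(y (i + 1)), compression p q N h y z)
      - cellCompression p' q' N h y (i + 1) * (y (i + 1) - y i)| ≤ ε * (1 + (N + 1) * h) := by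
  have hci := intervalIntegrable_compression (N := N) (y := y) hh hpm hqm hpC hqC
  have hci' := intervalIntegrable_compression (N := N) (y := y) hh hpm' hqm' hpC' hqC'
  have hpi : ∀ a b, IntervalIntegrable (fun z => |p z - p' z|) volume a b := fun a b =>
    ((intervalIntegrable_of_bounded hpm hpC a b).sub
      (intervalIntegrable_of_bounded hpm' hpC' a b)).abs
  have hqi : ∀ a b, IntervalIntegrable (fun z => |q z - q' z|) volume a b := fun a b =>
    ((intervalIntegrable_of_bounded hqm hqC a b).sub
      (intervalIntegrable_of_bounded hqm' hqC' a b)).abs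
  have hqis : ∀ j a b, IntervalIntegrable (fun z => h * |q (z - y j) - q' (z - y j)|) volume a b :=
    fun j a b => by
      have := (hqi (a - y j) (b - y j)).comp_sub_right (y j)
      rw [sub_add_cancel, sub_add_cancel] at this
      exact this.const_mul h
  have hqsum : ∀ a b, IntervalIntegrable (fun z => ∑ j ∈ Finset.range (N + 1),
      h * |q (z - y j) - q' (z - y j)|) volume a b := fun a b => by
    have := IntervalIntegrable.sum (Finset.range (N + 1)) fun j _ => hqis j a b
    rwa [Finset.sum_fn] at this
  set D : ℝ → ℝ := fun z => |compression p q N h y z - compression p' q' N h y z| with hD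
  have hDi : ∀ a b, IntervalIntegrable D volume a b := fun a b => ((hci a b).sub (hci' a b)).abs
  have h0N : y 0 ≤ y N := le_of_lt_succ hy (Nat.zero_le _) le_rfl
  have hb0 := abs_le.1 (hR 0 (Nat.zero_le _))
  have hbN := abs_le.1 (hR N le_rfl)
  calc _ ≤ ∑ i ∈ Finset.range N, ∫ z in (y i)..(y (i + 1)), D z := by
        refine Finset.sum_le_sum fun i hi => ?_
        have hi' := Finset.mem_range.1 hi
        rw [cellCompression_succ_mul hi', ← intervalIntegral.integral_sub (hci _ _) (hci' _ _)]
        exact intervalIntegral.abs_integral_le_integral_abs (hy i hi').le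
    _ = ∫ z in (y 0)..(y N), D z :=
        intervalIntegral.sum_integral_adjacent_intervals fun i _ => hDi _ _
    _ ≤ ∫ z in (y 0)..(y N), (|p z - p' z|
          + ∑ j ∈ Finset.range (N + 1), h * |q (z - y j) - q' (z - y j)|) := by
        refine intervalIntegral.integral_mono_on h0N (hDi _ _)
          ((hpi _ _).add (hqsum _ _)) fun z _ => ?_
        rw [hD]
        dsimp only
        rw [compression, compression, add_sub_add_comm, ← Finset.sum_sub_distrib]
        refine (abs_add_le _ _).trans (add_le_add le_rfl
          ((Finset.abs_sum_le_sum_abs _ _).trans (Finset.sum_le_sum fun j _ => ?_)))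
        rw [← mul_sub, abs_mul, abs_of_nonneg hh]
    _ = (∫ z in (y 0)..(y N), |p z - p' z|) + ∑ j ∈ Finset.range (N + 1),
          h * ∫ z in (y 0 - y j)..(y N - y j), |q z - q' z| := by
        rw [intervalIntegral.integral_add (hpi _ _) (hqsum _ _),
          intervalIntegral.integral_finsetSum fun j _ => hqis j _ _]
        congr 1
        refine Finset.sum_congr rfl fun j _ => ?_
        rw [intervalIntegral.integral_const_mul,
          intervalIntegral.integral_comp_sub_right (fun z => |q z - q' z|)]
    _ ≤ ε + ∑ _j ∈ Finset.range (N + 1), h * ε := by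
        refine add_le_add (le_trans ?_ hp) (Finset.sum_le_sum fun j hj =>
          mul_le_mul_of_nonneg_left (le_trans ?_ hq) hh)
        · exact intervalIntegral.integral_mono_interval hb0.1 h0N hbN.2
            (ae_of_all _ fun z => abs_nonneg _) (hpi _ _)
        · have hbj := abs_le.1 (hR j (Nat.lt_succ_iff.1 (Finset.mem_range.1 hj)))
          exact intervalIntegral.integral_mono_interval (by linarith) (by linarith) (by linarith)
            (ae_of_all _ fun z => abs_nonneg _) (hqi _ _)
    _ = _ := by rw [Finset.sum_const, Finset.card_range, nsmul_eq_mul]; push_cast; ring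

end Static

lemma continuousOn_cellCompression {p q : ℝ → ℝ} {N : ℕ} {h : ℝ} {S : Set ℝ} {x : ℝ → ℕ → ℝ}
    (hp : Continuous p) (hq : Continuous q) (hN : 0 < N)
    (hx : ∀ i ≤ N, ContinuousOn (fun t => x t i) S) (k : ℕ) :
    ContinuousOn (fun t => cellCompression p q N h (x t) k) S := by
  have hx' : ∀ i ≤ N, Continuous fun t : S => x t i := fun i hi =>
    continuousOn_iff_continuous_domRestrict.1 (hx i hi)
  rw [continuousOn_iff_continuous_domRestrict]
  have h1 := hx' (min (k - 1) (N - 1)) (by omega)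
  have h2 := hx' (min (k - 1) (N - 1) + 1) (by omega)
  have hz : Continuous fun u : S × ℝ => x u.1 (min (k - 1) (N - 1))
      + u.2 * (x u.1 (min (k - 1) (N - 1) + 1) - x u.1 (min (k - 1) (N - 1))) :=
    (h1.comp continuous_fst).add (continuous_snd.mul
      ((h2.comp continuous_fst).sub (h1.comp continuous_fst)))
  refine intervalIntegral.continuous_parametric_intervalIntegral_of_continuous' ?_ 0 1
  refine (hp.comp hz).add (continuous_finsetSum _ fun j hj => continuous_const.mul
    (hq.comp (hz.sub ((hx' j ?_).comp continuous_fst))))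
  exact Nat.lt_succ_iff.1 (Finset.mem_range.1 hj)

/-! ### A priori bounds for the particle system -/

lemma LinearGrowth.exists_bound {g : ℝ → ℝ} (hg : LinearGrowth g) :
    ∃ k : ℝ, 0 ≤ k ∧ ∀ r, |g r| ≤ k * (1 + |r|) := by
  obtain ⟨k, hk, h⟩ := hg
  refine ⟨k + |g 0|, by positivity, fun r => ?_⟩
  rcases eq_or_ne r 0 with rfl | hr
  · simp [hk.le]
  · refine (h r (abs_pos.2 hr)).trans ?_
    gcongr
    linarith [abs_nonneg (g 0)]

/-- Grönwall's inequality for the largest coordinate of a vector field of linear growth. -/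
lemma abs_le_of_linear_growth {n : ℕ} {T k δ : ℝ} {x x' : ℝ → ℕ → ℝ} (hk : 0 ≤ k) (hδ : 0 ≤ δ)
    (hx : ∀ t ∈ Icc 0 T, ∀ i ≤ n, HasDerivWithinAt (fun s => x s i) (x' t i) (Icc 0 T) t)
    (hgrow : ∀ t ∈ Icc 0 T, ∀ S, (∀ i ≤ n, |x t i| ≤ S) → ∀ i ≤ n, |x' t i| ≤ k * (1 + S))
    (h0 : ∀ i ≤ n, |x 0 i| ≤ δ) :
    ∀ t ∈ Icc 0 T, ∀ i ≤ n, |x t i| ≤ (δ + k) * Real.exp ((k + 1) * T) := by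
  set X : ℝ → (Fin (n + 1) → ℝ) := fun t i => x t i with hX
  have hXd : ∀ t ∈ Icc 0 T, HasDerivWithinAt X (fun i : Fin (n + 1) => x' t i) (Icc 0 T) t :=
    fun t ht => hasDerivWithinAt_pi.2 fun i => hx t ht i (Nat.lt_succ_iff.1 i.2)
  have hle : ∀ t, ∀ i ≤ n, |x t i| ≤ ‖X t‖ := fun t i hi =>
    norm_le_pi_norm (X t) ⟨i, Nat.lt_succ_of_le hi⟩
  intro t ht i hi
  have hmain := norm_le_gronwallBound_of_norm_deriv_right_le (f := X) (a := 0) (b := T)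
    (f' := fun t (i : Fin (n + 1)) => x' t i) (δ := δ) (K := k + 1) (ε := k)
    (fun t ht => (hXd t ht).continuousWithinAt)
    (fun t ht => (hXd t (Ico_subset_Icc_self ht)).mono_of_mem_nhdsWithin
      (Icc_mem_nhdsGE_of_mem ht))
    ((pi_norm_le_iff_of_nonneg hδ).2 fun i => h0 i (Nat.lt_succ_iff.1 i.2))
    (fun t ht => by
      refine (pi_norm_le_iff_of_nonneg (by positivity)).2 fun i => ?_
      refine (hgrow t (Ico_subset_Icc_self ht) _ (hle t) i (Nat.lt_succ_iff.1 i.2)).trans ?_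
      nlinarith [norm_nonneg (X t)]) t ht
  exact (hle t i hi).trans (hmain.trans
    (gronwallBound_le hδ (by linarith) hk (by linarith [ht.2])))

section APriori

variable {ρbar β V W q : ℝ → ℝ} {T m h c C : ℝ} {N : ℕ}

lemma abs_integral_zero_le (hq : ∀ x, |q x| ≤ C) (r : ℝ) : |∫ s in (0)..r, q s| ≤ C * |r| := by
  have := intervalIntegral.norm_integral_le_of_norm_le_const (a := 0) (b := r) (f := q) (C := C)
    fun z _ => hq z
  rwa [sub_zero, Real.norm_eq_abs] at this

lemma abs_force_le {y : ℕ → ℝ} {k S μ : ℝ} (hh : 0 ≤ h) (hk : 0 ≤ k) (hμ : (N + 1) * h ≤ μ)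
    (hVk : ∀ r, |deriv V r| ≤ k * (1 + |r|)) (hC : 0 ≤ C) (hq : ∀ x, |q x| ≤ C)
    (hW : ∀ r, r ≠ 0 → deriv W r = c * SignType.sign r + ∫ s in (0)..r, q s)
    (hy : ∀ i < N, y i < y (i + 1)) (hS : ∀ i ≤ N, |y i| ≤ S) {i : ℕ} (hi : i ≤ N) :
    |force V W N h y i| ≤ (k + μ * (|c| + 2 * C)) * (1 + S) := by
  have hS0 : 0 ≤ S := (abs_nonneg _).trans (hS 0 (Nat.zero_le _))
  rw [force_eq hW hy hi]
  have h1 : |deriv V (y i)| ≤ k * (1 + S) := (hVk _).trans (by gcongr; exact hS i hi)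
  have h2 : |c * h * (2 * i - N)| ≤ μ * |c| := by
    have hi' : (i : ℝ) ≤ N := Nat.cast_le.2 hi
    have hi0 : (0 : ℝ) ≤ i := Nat.cast_nonneg _
    have : |2 * (i : ℝ) - N| ≤ N + 1 := by rw [abs_le]; constructor <;> linarith
    calc |c * h * (2 * i - N)| = |c| * (h * |2 * (i : ℝ) - N|) := by
          rw [abs_mul, abs_mul, abs_of_nonneg hh]; ring
      _ ≤ |c| * (h * (N + 1)) := by gcongr
      _ ≤ |c| * μ := by rw [mul_comm h]; gcongr
      _ = μ * |c| := mul_comm _ _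
  have h3 : |∑ j ∈ Finset.range (N + 1), h * ∫ s in (0)..(y i - y j), q s| ≤ μ * (2 * C * S) := by
    refine (Finset.abs_sum_le_sum_abs _ _).trans ?_
    calc ∑ j ∈ Finset.range (N + 1), |h * ∫ s in (0)..(y i - y j), q s|
        ≤ ∑ _j ∈ Finset.range (N + 1), h * (2 * C * S) := Finset.sum_le_sum fun j hj => by
          rw [abs_mul, abs_of_nonneg hh]
          refine mul_le_mul_of_nonneg_left ((abs_integral_zero_le hq _).trans ?_) hh
          have hj' := hS j (Nat.lt_succ_iff.1 (Finset.mem_range.1 hj))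
          have : |y i - y j| ≤ 2 * S := (abs_sub _ _).trans (by linarith [hS i hi])
          calc C * |y i - y j| ≤ C * (2 * S) := by gcongr
            _ = 2 * C * S := by ring
      _ = (N + 1) * h * (2 * C * S) := by
          rw [Finset.sum_const, Finset.card_range, nsmul_eq_mul]; push_cast; ring
      _ ≤ μ * (2 * C * S) := by gcongr
  have h4 : 0 ≤ μ := le_trans (by positivity) hμ
  have h5 := abs_add_le (deriv V (y i) + c * h * (2 * i - N))
    (∑ j ∈ Finset.range (N + 1), h * ∫ s in (0)..(y i - y j), q s)
  have h6 := abs_add_le (deriv V (y i)) (c * h * (2 * i - N))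
  have h7 : 0 ≤ μ * |c| * S := by positivity
  have h8 : 0 ≤ μ * C := by positivity
  nlinarith

lemma pad_cellDensity_nonneg {y : ℕ → ℝ} (hh : 0 < h) (hy : ∀ i < N, y i < y (i + 1)) (k : ℕ) :
    0 ≤ pad N (cellDensity h y) k := by
  unfold pad
  split_ifs with h1 h2
  · exact le_rfl
  · exact (cellDensity_pos hh hy (by omega)).le
  · exact le_rfl

lemma abs_velocity_le {y : ℕ → ℝ} (hβ : IsMobilityFactor β) (hh : 0 < h)
    (hy : ∀ i < N, y i < y (i + 1)) {i : ℕ} (hi : i ≤ N) :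
    |velocity β V W N h y i| ≤ β 0 * |force V W N h y i| := by
  rw [velocity_eq_pad hi]
  have h1 := hβ.nonneg (pad_cellDensity_nonneg hh hy (i + 1))
  have h2 := hβ.le_zero (pad_cellDensity_nonneg hh hy (i + 1))
  have h3 := hβ.nonneg (pad_cellDensity_nonneg hh hy i)
  have h4 := hβ.le_zero (pad_cellDensity_nonneg hh hy i)
  rcases le_total 0 (force V W N h y i) with hf | hf
  · rw [max_eq_right (by linarith), max_eq_left hf, mul_zero, zero_sub, abs_neg, abs_mul,
      abs_of_nonneg h3]
    gcongr
  · rw [max_eq_left (by linarith), max_eq_right hf, mul_zero, sub_zero, abs_mul, abs_neg,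
      abs_of_nonneg h1]
    gcongr

/-- A cell of length `h / M`, with `β(M) = 0`, cannot become shorter. -/
lemma cellDensity_le_of_ode {x : ℝ → ℕ → ℝ} {M : ℝ} (hβ : IsMobilityFactor β) (hh : 0 < h)
    (hM : 0 < M) (hβM : ∀ s, M ≤ s → β s = 0)
    (hord : ∀ t ∈ Icc 0 T, ∀ i < N, x t i < x t (i + 1))
    (hode : ∀ t ∈ Icc 0 T, ∀ i ≤ N,
      HasDerivWithinAt (fun s => x s i) (velocity β V W N h (x t) i) (Icc 0 T) t)
    (h0 : ∀ i < N, cellDensity h (x 0) i ≤ M) {t : ℝ} (ht : t ∈ Icc 0 T) {i : ℕ} (hi : i < N) :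
    cellDensity h (x t) i ≤ M := by
  have hT : (0 : ℝ) ∈ Icc 0 T := ⟨le_rfl, ht.1.trans ht.2⟩
  have hlen : h / M ≤ x t (i + 1) - x t i := by
    refine le_of_forall_pos_le_add fun ε hε => ?_
    -- the slowly decreasing barrier `h / M - η s` turns the weak inequality for the length
    -- into a strict one
    set η := ε / (t + 1) with hη
    have ht1 : 0 < t + 1 := by linarith [ht.1]
    have hη0 : 0 < η := by positivity
    have hb := barrier_le (T := T) (b := fun s => h / M - η * s) (b' := fun _ => -η)
      (y := fun s => x s (i + 1) - x s i)
      (y' := fun s => velocity β V W N h (x s) (i + 1) - velocity β V W N h (x s) i)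
      (fun s _ => by
        simpa using (((hasDerivAt_id s).const_mul η).const_sub (h / M)).hasDerivWithinAt)
      (fun s hs => (hode s hs (i + 1) hi).sub (hode s hs i hi.le)) ?_ ?_ t ht
    · have : η * t ≤ ε := by
        rw [hη, div_mul_eq_mul_div, div_le_iff₀ ht1]
        nlinarith
      linarith
    · have h1 := h0 i hi
      rw [cellDensity, div_le_iff₀ (sub_pos.2 (hord 0 hT i hi))] at h1
      rw [mul_zero, sub_zero, div_le_iff₀ hM]
      linarith
    · intro s hs heq
      have hd : M ≤ cellDensity h (x s) i := by
        rw [cellDensity, ← heq, le_div_iff₀]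
        · have h3 : M * (h / M) = h := by field_simp
          have := mul_nonneg hM.le (mul_nonneg hη0.le hs.1)
          rw [mul_sub, h3]
          linarith
        · rw [heq]; exact sub_pos.2 (hord s hs i hi)
      rw [velocity_sub_velocity hi, hβM _ hd, zero_mul, sub_zero]
      have := upwind_nonneg (f := force V W N h (x s)) (fun s hs => hβ.nonneg hs)
        (pad_cellDensity_nonneg hh (hord s hs)) hi (hβM _ hd)
      linarith
  rw [cellDensity, div_le_iff₀ (sub_pos.2 (hord t ht i hi)), ← div_le_iff₀' hM]
  exact hlen

lemma continuousOn_force {x : ℝ → ℕ → ℝ} (hV : Continuous (deriv V))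
    (hqm : Measurable q) (hq : ∀ x, |q x| ≤ C) (hC : 0 ≤ C)
    (hW : ∀ r, r ≠ 0 → deriv W r = c * SignType.sign r + ∫ s in (0)..r, q s)
    (hord : ∀ t ∈ Icc 0 T, ∀ i < N, x t i < x t (i + 1))
    (hx : ∀ i ≤ N, ContinuousOn (fun t => x t i) (Icc 0 T)) {i : ℕ} (hi : i ≤ N) :
    ContinuousOn (fun t => force V W N h (x t) i) (Icc 0 T) := by
  have hQ := (lipschitz_integral_of_bounded hC hqm hq).continuous
  refine ContinuousOn.congr (f := fun t => deriv V (x t i) + c * h * (2 * i - N)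
      + ∑ j ∈ Finset.range (N + 1), h * ∫ s in (0)..(x t i - x t j), q s) ?_
    fun t ht => force_eq hW (hord t ht) hi
  refine ((hV.comp_continuousOn (hx i hi)).add continuousOn_const).add
    (continuousOn_finsetSum _ fun j hj => continuousOn_const.mul ?_)
  exact hQ.comp_continuousOn ((hx i hi).sub (hx j (Nat.lt_succ_iff.1 (Finset.mem_range.1 hj))))

/-- Positions, velocities and densities are bounded independently of the number of particles. -/
lemma exists_apriori_bounds (hρ : IsInitialDatum ρbar m) (hβ : IsMobilityFactor β)
    (hV : IsExternalPotential V) (hT : 0 < T) (hC : 0 ≤ C) (hq : ∀ x, |q x| ≤ C)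
    (hW : ∀ r, r ≠ 0 → deriv W r = c * SignType.sign r + ∫ s in (0)..r, q s) :
    ∃ R L M : ℝ, 0 ≤ R ∧ 0 ≤ L ∧ 0 < M ∧ β M = 0 ∧
      ∀ (N : ℕ) (x : ℝ → ℕ → ℝ), m / N ∈ Ioo (0 : ℝ) 1 →
        IsParticleSolution ρbar β V W T m N x → ∀ t ∈ Icc 0 T,
          (∀ i ≤ N, |x t i| ≤ R) ∧ (∀ i ≤ N, |velocity β V W N (m / N) (x t) i| ≤ L) ∧
          ∀ i < N, cellDensity (m / N) (x t) i ≤ M := by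
  obtain ⟨kV, hkV, hVk⟩ := hV.growth.exists_bound
  obtain ⟨Mβ, hMβ, hβM⟩ := hβ.vanishes
  obtain ⟨δ, hδ⟩ := hρ.compact_support.isBounded.exists_norm_le
  obtain ⟨B, hB⟩ : ∃ B : ℝ, ∀ᵐ x, |ρbar x| ≤ B := by
    refine ⟨(eLpNorm ρbar ⊤ volume).toReal, ?_⟩
    filter_upwards [ae_le_eLpNormEssSup (f := ρbar) (μ := volume)] with x hx
    have h2 := hρ.bounded.2
    rw [eLpNorm_exponent_top] at h2 ⊢
    simpa using ENNReal.toReal_mono h2.ne hx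
  have hm := hρ.mass_pos
  have hb0 := hβ.pos_zero
  set a := β 0 * (kV + (m + 1) * (|c| + 2 * C)) with ha
  have ha0 : 0 ≤ a := by positivity
  set δ' := max δ 0 with hδ'
  set R := (δ' + a) * Real.exp ((a + 1) * T) with hR
  have hR0 : 0 ≤ R := by positivity
  refine ⟨R, a * (1 + R), max Mβ B, hR0, by positivity, hMβ.trans_le (le_max_left _ _),
    hβM _ (le_max_left _ _), fun N x hN hx => ?_⟩
  have hN0 : 0 < N := Nat.pos_of_ne_zero fun h => by simp [h] at hN
  have hN' : (0 : ℝ) < N := Nat.cast_pos.2 hN0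
  have hμ : (N + 1) * (m / N) ≤ m + 1 := by
    have : (N : ℝ) * (m / N) = m := by field_simp
    rw [add_mul, this, one_mul]
    linarith [hN.2]
  have hvel : ∀ t ∈ Icc 0 T, ∀ S, (∀ i ≤ N, |x t i| ≤ S) →
      ∀ i ≤ N, |velocity β V W N (m / N) (x t) i| ≤ a * (1 + S) := by
    intro t ht S hS i hi
    refine (abs_velocity_le hβ hN.1 (hx.ordered t ht) hi).trans ?_
    rw [ha, mul_assoc]
    gcongr
    exact abs_force_le hN.1.le hkV hμ hVk hC hq hW (hx.ordered t ht) hS hi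
  have h0T : (0 : ℝ) ∈ Icc 0 T := ⟨le_rfl, hT.le⟩
  have hord0 := hx.ordered 0 h0T
  have hinit : ∀ i ≤ N, |x 0 i| ≤ δ' := by
    intro i hi
    have h1 := abs_le.1 (hδ _ hx.initial.first.1)
    have h2 := abs_le.1 (hδ _ hx.initial.last.1)
    have h3 := le_of_lt_succ hord0 (Nat.zero_le i) hi
    have h4 := le_of_lt_succ hord0 hi le_rfl
    exact (abs_le.2 ⟨by linarith, by linarith⟩ : |x 0 i| ≤ δ).trans (le_max_left _ _)
  have hpos := abs_le_of_linear_growth ha0 (le_max_right _ _) hx.ode hvel hinit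
  intro t ht
  refine ⟨hpos t ht, hvel t ht R (hpos t ht), fun i hi => ?_⟩
  exact cellDensity_le_of_ode hβ hN.1 (hMβ.trans_le (le_max_left _ _))
    (fun s hs => hβM s ((le_max_left _ _).trans hs)) hx.ordered hx.ode
    (fun i hi => (hx.initial.cellDensity_le hρ hN0 hord0 hB hi).trans (le_max_right _ _)) ht hi

end APriori

/-! ### Translates of step functions -/

/-- The difference between the Heaviside function and its average over `[z, z + δ]`. -/
noncomputable def stepDefect (δ b z : ℝ) : ℝ :=
  (if b < z then 1 else 0) - (max (z + δ - b) 0 - max (z - b) 0) / δ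

lemma stepDefect_le {δ b z : ℝ} (hδ : 0 < δ) :
    |stepDefect δ b z| ≤ (Icc (b - δ) b).indicator (fun _ => 1) z := by
  unfold stepDefect
  by_cases h1 : z < b - δ
  · rw [indicator_of_notMem fun h => absurd h.1 (not_le.2 h1), if_neg (by linarith),
      max_eq_right (by linarith), max_eq_right (by linarith)]
    simp
  by_cases h2 : b < z
  · rw [indicator_of_notMem fun h => absurd h.2 (not_le.2 h2), if_pos h2,
      max_eq_left (by linarith), max_eq_left (by linarith)]
    rw [show z + δ - b - (z - b) = δ by ring, div_self hδ.ne']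
    simp
  · rw [indicator_of_mem (show z ∈ Icc _ _ from ⟨not_lt.1 h1, not_lt.1 h2⟩), if_neg h2,
      max_eq_left (by linarith), max_eq_right (by linarith), sub_zero, zero_sub, abs_neg, abs_div,
      abs_of_pos hδ, div_le_one hδ, abs_of_nonneg (by linarith)]
    linarith

lemma measurable_stepDefect (δ b : ℝ) : Measurable (stepDefect δ b) := by
  refine Measurable.sub (Measurable.ite measurableSet_Ioi measurable_const measurable_const) ?_
  fun_prop

lemma integrable_stepDefect {δ : ℝ} (hδ : 0 < δ) (b : ℝ) : Integrable (stepDefect δ b) := by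
  have h : Integrable ((Icc (b - δ) b).indicator (fun _ => (1 : ℝ))) :=
    (integrable_indicator_iff measurableSet_Icc).2 (by simp)
  exact h.mono' (measurable_stepDefect δ b).aestronglyMeasurable (ae_of_all _ fun z => by
    simpa using stepDefect_le (b := b) (z := z) hδ)

lemma integral_abs_stepDefect_le {δ : ℝ} (hδ : 0 < δ) (b : ℝ) :
    ∫ z, |stepDefect δ b z| ≤ δ := by
  have h : Integrable ((Icc (b - δ) b).indicator (fun _ => (1 : ℝ))) :=
    (integrable_indicator_iff measurableSet_Icc).2 (by simp)
  calc ∫ z, |stepDefect δ b z| ≤ ∫ z, (Icc (b - δ) b).indicator (fun _ => (1 : ℝ)) z :=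
        integral_mono (integrable_stepDefect hδ b).abs h fun z => stepDefect_le hδ
    _ = δ := by
        rw [integral_indicator measurableSet_Icc, setIntegral_const]
        simp [hδ.le]

/-- Averaging does not increase the `L¹` norm of the indicator of a cell. The defects of the two
nodes are translates of each other, so that their difference has integral zero. -/
lemma integral_abs_stepDefect_sub_le {δ a b : ℝ} (hδ : 0 < δ) (hab : a ≤ b) :
    ∫ z, |stepDefect δ a z - stepDefect δ b z| ≤ 2 * (b - a) := by
  have hI : Integrable ((Ioc a b).indicator (fun _ => (1 : ℝ))) :=
    (integrable_indicator_iff measurableSet_Ioc).2 (by simp)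
  have hd := (integrable_stepDefect hδ a).sub (integrable_stepDefect hδ b)
  have htrans : ∫ z, stepDefect δ b z = ∫ z, stepDefect δ a z := by
    rw [← integral_add_right_eq_self (stepDefect δ b) (b - a)]
    refine integral_congr_ae (ae_of_all _ fun z => ?_)
    have h1 : b < z + (b - a) ↔ a < z := by constructor <;> intro h <;> linarith
    simp only [stepDefect, h1]
    rw [show z + (b - a) + δ - b = z + δ - a by ring, show z + (b - a) - b = z - a by ring]
  have hpt : ∀ z, |stepDefect δ a z - stepDefect δ b z|
      ≤ 2 * (Ioc a b).indicator (fun _ => (1 : ℝ)) z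
        - (stepDefect δ a z - stepDefect δ b z) := by
    intro z
    have hmono : max (z + δ - b) 0 - max (z - b) 0 ≤ max (z + δ - a) 0 - max (z - a) 0 := by
      rcases max_cases (z + δ - b) 0 with h1 | h1 <;> rcases max_cases (z - b) 0 with h2 | h2 <;>
      rcases max_cases (z + δ - a) 0 with h3 | h3 <;> rcases max_cases (z - a) 0 with h4 | h4 <;>
      linarith [h1.1, h1.2, h2.1, h2.2, h3.1, h3.2, h4.1, h4.2]
    have hdiv := div_le_div_of_nonneg_right hmono hδ.le
    have hind : (Ioc a b).indicator (fun _ => (1 : ℝ)) z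
        = (if a < z then 1 else 0) - (if b < z then 1 else 0) := by
      by_cases h1 : a < z
      · by_cases h2 : b < z
        · rw [indicator_of_notMem fun h => absurd h.2 (not_le.2 h2), if_pos h1, if_pos h2, sub_self]
        · rw [indicator_of_mem (show z ∈ Ioc _ _ from ⟨h1, not_lt.1 h2⟩), if_pos h1, if_neg h2,
            sub_zero]
      · rw [indicator_of_notMem fun h => h1 h.1, if_neg h1, if_neg (by linarith), sub_self]
    have hnn : 0 ≤ (Ioc a b).indicator (fun _ => (1 : ℝ)) z :=
      indicator_nonneg (fun _ _ => zero_le_one) z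
    have hle : stepDefect δ a z - stepDefect δ b z ≤ (Ioc a b).indicator (fun _ => (1 : ℝ)) z := by
      rw [hind, stepDefect, stepDefect]
      linarith
    rw [abs_le]
    constructor <;> linarith
  refine (integral_mono hd.abs ((hI.const_mul 2).sub hd) hpt).trans (le_of_eq ?_)
  rw [integral_sub' (hI.const_mul 2) hd, integral_const_mul,
    integral_sub' (integrable_stepDefect hδ a) (integrable_stepDefect hδ b), htrans,
    integral_indicator measurableSet_Ioc, setIntegral_const]
  simp [hab]

section Config

variable {N : ℕ} {h : ℝ} {y : ℕ → ℝ}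

/-- Off the nodes, the density minus its box average is a combination of the defects of the nodes
that bound the cells. -/
lemma deriv_configCDF_sub_boxAverage {δ : ℝ} (hδ : 0 < δ) (hy : ∀ i < N, y i < y (i + 1)) {z : ℝ}
    (hz : ∀ i ≤ N, z ≠ y i) :
    deriv (configCDF N h y) z - (configCDF N h y (z + δ) - configCDF N h y z) / δ
      = ∑ i ∈ Finset.range N,
        (stepDefect δ (y i) z - stepDefect δ (y (i + 1)) z) * cellDensity h y i := by
  rw [deriv_configCDF hy hz, densityReconstruction, configCDF, configCDF,
    ← Finset.sum_sub_distrib, Finset.sum_div, ← Finset.sum_sub_distrib]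
  refine Finset.sum_congr rfl fun i hi => ?_
  have hi' := Finset.mem_range.1 hi
  have hlt := hy i hi'
  have hmin : ∀ w b : ℝ, min w b = w - max (w - b) 0 := fun w b => by
    rcases le_total w b with h | h
    · rw [min_eq_left h, max_eq_right (by linarith), sub_zero]
    · rw [min_eq_right h, max_eq_left (by linarith)]; ring
  have hind : (Ioo (y i) (y (i + 1))).indicator (fun _ => cellDensity h y i) z
      = ((if y i < z then 1 else 0) - (if y (i + 1) < z then 1 else 0)) * cellDensity h y i := by
    by_cases h1 : y i < z
    · rcases lt_or_gt_of_ne (hz (i + 1) hi') with h2 | h2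
      · rw [indicator_of_mem (show z ∈ Ioo _ _ from ⟨h1, h2⟩), if_pos h1, if_neg h2.not_gt]; ring
      · rw [indicator_of_notMem fun h => absurd h.2 h2.not_gt, if_pos h1, if_pos h2]; ring
    · rw [indicator_of_notMem fun h => h1 h.1, if_neg h1, if_neg (by linarith)]; ring
  rw [hind, hmin (z + δ), hmin (z + δ), hmin z, hmin z, stepDefect, stepDefect]
  field_simp
  ring

/-- If the cell densities are close to a sequence of small total variation, the density is close to
its box average. -/
lemma integral_abs_deriv_sub_boxAverage_le {δ : ℝ} (hδ : 0 < δ) (hy : ∀ i < N, y i < y (i + 1))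
    (σ : ℕ → ℝ) :
    ∫ z, |deriv (configCDF N h y) z - (configCDF N h y (z + δ) - configCDF N h y z) / δ|
      ≤ 2 * ∑ i ∈ Finset.range N, |cellDensity h y i - σ i| * (y (i + 1) - y i)
        + δ * ∑ k ∈ Finset.range (N + 1), |pad N σ (k + 1) - pad N σ k| := by
  set e : ℕ → ℝ → ℝ := fun k => stepDefect δ (y k) with he
  have hei : ∀ k, Integrable (e k) := fun k => integrable_stepDefect hδ (y k)
  have hcell : ∀ i, Integrable fun z => |cellDensity h y i - σ i| * |e i z - e (i + 1) z| := fun i =>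
    ((hei i).sub (hei (i + 1))).abs.const_mul _
  have hjump : ∀ k, Integrable fun z => |pad N σ (k + 1) - pad N σ k| * |e k z| := fun k =>
    (hei k).abs.const_mul _
  have hsum1 : Integrable fun z => ∑ i ∈ Finset.range N,
      |cellDensity h y i - σ i| * |e i z - e (i + 1) z| :=
    integrable_finsetSum _ fun i _ => hcell i
  have hsum2 : Integrable fun z => ∑ k ∈ Finset.range (N + 1),
      |pad N σ (k + 1) - pad N σ k| * |e k z| :=
    integrable_finsetSum _ fun k _ => hjump k
  calc _ ≤ ∫ z, ((∑ i ∈ Finset.range N, |cellDensity h y i - σ i| * |e i z - e (i + 1) z|)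
        + ∑ k ∈ Finset.range (N + 1), |pad N σ (k + 1) - pad N σ k| * |e k z|) := by
        refine integral_mono_of_nonneg (ae_of_all _ fun z => abs_nonneg _) (hsum1.add hsum2) ?_
        filter_upwards [ae_ne_node N y] with z hz
        rw [deriv_configCDF_sub_boxAverage hδ hy hz]
        have hsplit : ∑ i ∈ Finset.range N, (e i z - e (i + 1) z) * cellDensity h y i
            = ∑ i ∈ Finset.range N, (e i z - e (i + 1) z) * (cellDensity h y i - σ i)
              + ∑ k ∈ Finset.range (N + 1), e k z * (pad N σ (k + 1) - pad N σ k) := by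
          rw [sum_mul_pad_sub (fun k => e k z) σ, ← Finset.sum_add_distrib]
          exact Finset.sum_congr rfl fun i _ => by ring
        refine (congrArg abs hsplit).le.trans ((abs_add_le _ _).trans (add_le_add ?_ ?_))
        · refine (Finset.abs_sum_le_sum_abs _ _).trans (le_of_eq ?_)
          exact Finset.sum_congr rfl fun i _ => by rw [abs_mul, mul_comm]
        · refine (Finset.abs_sum_le_sum_abs _ _).trans (le_of_eq ?_)
          exact Finset.sum_congr rfl fun i _ => by rw [abs_mul, mul_comm]
    _ = ∑ i ∈ Finset.range N, |cellDensity h y i - σ i| * (∫ z, |e i z - e (i + 1) z|)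
        + ∑ k ∈ Finset.range (N + 1), |pad N σ (k + 1) - pad N σ k| * ∫ z, |e k z| := by
        rw [integral_add hsum1 hsum2, integral_finsetSum _ fun i _ => hcell i,
          integral_finsetSum _ fun k _ => hjump k]
        simp_rw [integral_const_mul]
    _ ≤ ∑ i ∈ Finset.range N, |cellDensity h y i - σ i| * (2 * (y (i + 1) - y i))
        + ∑ k ∈ Finset.range (N + 1), |pad N σ (k + 1) - pad N σ k| * δ := by
        refine add_le_add (Finset.sum_le_sum fun i hi => ?_) (Finset.sum_le_sum fun k _ => ?_)
        · exact mul_le_mul_of_nonneg_left (integral_abs_stepDefect_sub_le hδ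
            (hy i (Finset.mem_range.1 hi)).le) (abs_nonneg _)
        · exact mul_le_mul_of_nonneg_left (integral_abs_stepDefect_le hδ _) (abs_nonneg _)
    _ = _ := by
        rw [Finset.mul_sum, Finset.mul_sum]
        congr 1
        · exact Finset.sum_congr rfl fun i _ => by ring
        · exact Finset.sum_congr rfl fun k _ => by ring

end Config

/-! ### Compactness of the densities -/

/-- The second derivative of the potential, frozen outside `[-R, R]`. -/
lemma IsExternalPotential.exists_bounded_second_deriv {V : ℝ → ℝ} (hV : IsExternalPotential V)
    {R : ℝ} (hR : 0 ≤ R) :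
    ∃ (p : ℝ → ℝ) (Cp : ℝ), 0 ≤ Cp ∧ Continuous p ∧ (∀ x, |p x| ≤ Cp) ∧
      ∀ a ∈ Icc (-R) R, ∀ b ∈ Icc (-R) R, deriv V b - deriv V a = ∫ z in a..b, p z := by
  have hV1 : ContDiff ℝ 1 (deriv V) := by
    have h := hV.contDiff
    rw [show (2 : WithTop ℕ∞) = 1 + 1 by norm_num, contDiff_succ_iff_deriv] at h
    exact h.2.2
  have hV2 : Continuous (deriv (deriv V)) := hV1.continuous_deriv le_rfl
  have hRR : -R ≤ R := by linarith
  obtain ⟨Cp, hCp⟩ := isCompact_Icc.exists_bound_of_continuousOn (s := Icc (-R) R)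
    hV2.continuousOn
  refine ⟨fun z => deriv (deriv V) (projIcc (-R) R hRR z), Cp,
    (norm_nonneg _).trans (hCp 0 ⟨by linarith, hR⟩),
    hV2.comp (continuous_subtype_val.comp continuous_projIcc),
    fun z => hCp _ (projIcc (-R) R hRR z).2, fun a ha b hb => ?_⟩
  rw [← intervalIntegral.integral_eq_sub_of_hasDerivAt (f := deriv V) (f' := deriv (deriv V))
    (fun z _ => (hV1.differentiable one_ne_zero z).hasDerivAt) (hV2.intervalIntegrable _ _)]
  refine intervalIntegral.integral_congr fun z hz => ?_
  have hz' : z ∈ Icc (-R) R := uIcc_subset_Icc ha hb hz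
  rw [projIcc_of_mem hRR hz']

/-- The densities of the particle system are close to their box averages, uniformly in the number
of particles and in time. They are compared with the solution of the regularised system, in which
the compression is replaced by a Lipschitz approximation, and which has bounded variation. -/
theorem exists_uniform_boxAverage_bound {ρbar β V W q : ℝ → ℝ} {T m c C R M : ℝ}
    (hρ : IsInitialDatum ρbar m) (hβ : IsMobilityFactor β) (hV : IsExternalPotential V)
    (hT : 0 < T) (hR : 0 ≤ R) (hM : 0 < M) (hβM : β M = 0) (hC : 0 ≤ C) (hqm : Measurable q)
    (hq : ∀ x, |q x| ≤ C)
    (hW : ∀ r, r ≠ 0 → deriv W r = c * SignType.sign r + ∫ s in (0)..r, q s) {ε : ℝ} (hε : 0 < ε) :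
    ∃ C' : ℝ, ∀ (N : ℕ) (x : ℝ → ℕ → ℝ), m / N ∈ Ioo (0 : ℝ) 1 →
      IsParticleSolution ρbar β V W T m N x →
      (∀ t ∈ Icc 0 T, ∀ i ≤ N, |x t i| ≤ R) →
      (∀ t ∈ Icc 0 T, ∀ i < N, cellDensity (m / N) (x t) i ≤ M) →
      ∀ t ∈ Icc 0 T, ∀ δ > 0,
        ∫ z, |deriv (configCDF N (m / N) (x t)) z
          - (configCDF N (m / N) (x t) (z + δ) - configCDF N (m / N) (x t) z) / δ|
          ≤ ε + C' * δ := by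
  obtain ⟨Kβ, hlip⟩ := hβ.lipschitz
  obtain ⟨p, Cp, hCp, hpc, hp, hVp⟩ := hV.exists_bounded_second_deriv hR
  obtain ⟨TV₀, hTV₀⟩ := exists_initial_variation_bound hρ
  have hm := hρ.mass_pos
  have hb0 := hβ.pos_zero
  set A := Cp + (m + 1) * C with hA
  have hA0 : 0 ≤ A := by positivity
  set E := Real.exp (compRate β Kβ M A * T) with hE
  have hE0 : 0 < E := Real.exp_pos _
  -- an error `ε₁` in the compression costs at most `2 M β(0) (m + 2) E ε₁` in the densities
  set ε₁ := ε / (2 * M * β 0 * (m + 2) * E) with hε₁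
  have hε₁0 : 0 < ε₁ := by positivity
  obtain ⟨p', Kp, hp'l, hp'C, hpp'⟩ := exists_lipschitz_approx hpc.measurable hp hR hε₁0
  obtain ⟨q', Kq, hq'l, hq'C, hqq'⟩ := exists_lipschitz_approx hqm hq
    (show 0 ≤ 2 * R by positivity) hε₁0
  set Cγ := (Kp + (m + 1) * Kq) * (4 * R) with hCγ
  have hCγ0 : 0 ≤ Cγ := by positivity
  refine ⟨(TV₀ + M * β 0 * Cγ) * Real.exp (tvRate β Kβ M A c * T), fun N x hN hx hxR hxM => ?_⟩
  have hN0 : 0 < N := Nat.pos_of_ne_zero fun h => by simp [h] at hN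
  have hN' : (0 : ℝ) < N := Nat.cast_pos.2 hN0
  set h := m / N with hh
  have hh0 : 0 < h := hN.1
  have hμ : (N + 1) * h ≤ m + 1 := by
    have : (N : ℝ) * h = m := by rw [hh]; field_simp
    rw [add_mul, this, one_mul]
    linarith [hN.2]
  have hμ0 : 0 ≤ (N + 1) * h := by positivity
  have h0T : (0 : ℝ) ∈ Icc 0 T := ⟨le_rfl, hT.le⟩
  have hord := hx.ordered
  have hxc : ∀ i ≤ N, ContinuousOn (fun t => x t i) (Icc 0 T) := fun i hi t ht =>
    (hx.ode t ht i hi).continuousWithinAt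
  have hG : ∀ t z, |compression p q N h (x t) z| ≤ A := fun t z =>
    (abs_compression_le hh0.le hp hq z).trans (by rw [hA]; gcongr)
  have hG' : ∀ t z, |compression p' q' N h (x t) z| ≤ A := fun t z =>
    (abs_compression_le hh0.le hp'C hq'C z).trans (by rw [hA]; gcongr)
  set γ : ℝ → ℕ → ℝ := fun t k => cellCompression p' q' N h (x t) k with hγdef
  have hγ : ∀ t ∈ Icc 0 T, ∀ k, |γ t k| ≤ A := fun t _ k => abs_cellCompression_le (hG' t) k
  have hγv : ∀ t ∈ Icc 0 T, ∑ k ∈ Finset.range (N + 1), |γ t (k + 1) - γ t k| ≤ Cγ := by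
    intro t ht
    refine (sum_abs_cellCompression_sub_le (by positivity) hN0
      (abs_compression_sub_le hh0.le hp'l hq'l) (hord t ht) (hxR t ht)).trans ?_
    rw [hCγ]
    gcongr
  set f : ℝ → ℕ → ℝ := fun t => force V W N h (x t) with hf
  set a : ℝ → ℕ → ℝ := fun t i => ∫ z in (x t i)..(x t (i + 1)), compression p q N h (x t) z with ha
  have hVc : Continuous (deriv V) := hV.contDiff.continuous_deriv (by norm_num)
  obtain ⟨σ, hσ0, hσM, hσ⟩ := exists_regularised_solution (f := f) (γ := γ) (c := c) hβ hlip hT.le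
    hh0 hM hβM (fun i hi => continuousOn_force hVc hqm hq hC hW hord hxc hi)
    (fun k => continuousOn_cellCompression hp'l.continuous hq'l.continuous hN0 hxc k)
    (r₀ := cellDensity h (x 0)) fun i hi => ⟨cellDensity_pos hh0 (hord 0 h0T) hi, hxM 0 h0T i hi⟩
  intro t ht δ hδ
  refine (integral_abs_deriv_sub_boxAverage_le hδ (hord t ht) (σ t)).trans (add_le_add ?_ ?_)
  · -- the difference of the densities in a cell, times its length, is a difference of lengths
    have hclose := sum_abs_length_sub_le (T := T) (c := c) (M := M) (A := A) (f := f) (γ := γ)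
      (σ := σ) (ε := ε₁ * (m + 2)) (Δ := fun t i => x t (i + 1) - x t i) (a := a) hβ hlip hh0 hM.le
      hA0 (by positivity)
      (fun t ht i hi => by
        have := (hx.ode t ht (i + 1) hi).sub (hx.ode t ht i hi.le)
        rw [velocity_sub_velocity hi] at this
        exact this)
      (fun t ht i hi => sub_pos.2 (hord t ht i hi))
      (fun t ht i hi => force_sub_force hpc.measurable hqm hp hq hW hVp (hord t ht) (hxR t ht) hi)
      (fun t ht i hi => abs_integral_compression_le (hG t) (hord t ht) hi) hσ hσM hγ
      (fun t ht => (sum_abs_integral_sub_cellCompression_le hh0.le hpc.measurable hqm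
        hp'l.continuous.measurable hq'l.continuous.measurable hp hq hp'C hq'C (hord t ht)
        (hxR t ht) hpp' hqq').trans (mul_le_mul_of_nonneg_left (by linarith) hε₁0.le))
      hσ0 ht
    have hterm : ∀ i ∈ Finset.range N, |cellDensity h (x t) i - σ t i| * (x t (i + 1) - x t i)
        ≤ M * |x t (i + 1) - x t i - h / σ t i| := by
      intro i hi
      have hi' := Finset.mem_range.1 hi
      have hΔ := sub_pos.2 (hord t ht i hi')
      obtain ⟨h1, h2⟩ := hσM t ht i hi'
      have : |cellDensity h (x t) i - σ t i| * (x t (i + 1) - x t i)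
          = σ t i * |x t (i + 1) - x t i - h / σ t i| := by
        have e : (cellDensity h (x t) i - σ t i) * (x t (i + 1) - x t i)
            = -(σ t i * (x t (i + 1) - x t i - h / σ t i)) := by
          rw [cellDensity, sub_mul, div_mul_cancel₀ _ hΔ.ne']
          linear_combination -(mul_div_cancel₀ h h1.ne')
        have e' := congrArg abs e
        rwa [abs_neg, abs_mul, abs_mul, abs_of_pos h1, abs_of_pos hΔ] at e'
      rw [this]
      gcongr
    calc 2 * ∑ i ∈ Finset.range N, |cellDensity h (x t) i - σ t i| * (x t (i + 1) - x t i)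
        ≤ 2 * (M * ∑ i ∈ Finset.range N, |x t (i + 1) - x t i - h / σ t i|) :=
          mul_le_mul_of_nonneg_left ((Finset.sum_le_sum hterm).trans (Finset.mul_sum _ _ _).ge)
            zero_le_two
      _ ≤ 2 * (M * (β 0 * (ε₁ * (m + 2)) * E)) :=
          mul_le_mul_of_nonneg_left (mul_le_mul_of_nonneg_left hclose hM.le) zero_le_two
      _ = ε := by rw [hε₁]; field_simp
  · rw [mul_comm]
    refine mul_le_mul_of_nonneg_right ?_ hδ.le
    refine totalVariation_le hβ hlip hh0 hM.le hA0 hCγ0 hσ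
      (fun t ht i hi => ⟨(hσM t ht i hi).1.le, (hσM t ht i hi).2⟩) hγ hγv ?_ ht
    have hpad : ∀ k, pad N (σ 0) k = pad N (cellDensity h (x 0)) k := fun k => by
      unfold pad
      split_ifs with h1 h2
      · rfl
      · exact hσ0 _ (by omega)
      · rfl
    simp_rw [hpad]
    exact hTV₀ N (x 0) hN0 hx.initial (hord 0 h0T)

/-! ### Convergence on the space-time strip -/

namespace IsCDFCurve

variable {M L : ℝ≥0} {R m : ℝ} {F : ℝ → ℝ → ℝ}

lemma integrable_density_strip (hF : IsCDFCurve M L R m F) (T : ℝ) :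
    Integrable (Function.uncurry fun t z => deriv (F t) z)
      (volume.restrict (Icc 0 T ×ˢ univ)) := by
  have hsub : Icc 0 T ×ˢ Icc (-R) R ⊆ Icc 0 T ×ˢ (univ : Set ℝ) :=
    prod_mono_right (subset_univ _)
  refine IntegrableOn.of_forall_sdiff_eq_zero (s := Icc 0 T ×ˢ Icc (-R) R) ?_
    (measurableSet_Icc.prod MeasurableSet.univ) ?_
  · refine IntegrableOn.of_bound ?_ hF.measurable_density.aestronglyMeasurable M
      (ae_of_all _ fun p => hF.norm_density_le p.1 p.2)
    rw [Measure.volume_eq_prod, Measure.prod_prod]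
    exact ENNReal.mul_lt_top (by simp) (by simp)
  · intro p hp
    exact hF.density_eq_zero p.1 fun h => hp.2 ⟨hp.1.1, h⟩

lemma tendsto_lintegral_density {Fk : ℕ → ℝ → ℝ → ℝ} (hk : ∀ k, IsCDFCurve M L R m (Fk k))
    (hF : IsCDFCurve M L R m F) {T : ℝ}
    (hlim : ∀ t ∈ Icc 0 T, Tendsto (fun k => ∫ z, |deriv (Fk k t) z - deriv (F t) z|) atTop (𝓝 0)) :
    Tendsto (fun k => ∫⁻ t in Icc 0 T, ∫⁻ z, ‖deriv (Fk k t) z - deriv (F t) z‖ₑ) atTop (𝓝 0) := by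
  have hmeas : ∀ k, Measurable fun t => ∫⁻ z, ‖deriv (Fk k t) z - deriv (F t) z‖ₑ := fun k =>
    ((hk k).measurable_density.sub hF.measurable_density).enorm.lintegral_prod_right'
  have hconst : ∫⁻ _t in Icc 0 T, ENNReal.ofReal ((M + M) * (2 * R)) ≠ ⊤ := by
    rw [lintegral_const]
    exact ENNReal.mul_ne_top ENNReal.ofReal_ne_top (by simp)
  have heq : ∀ k t, ∫⁻ z, ‖deriv (Fk k t) z - deriv (F t) z‖ₑ
      = ENNReal.ofReal (∫ z, |deriv (Fk k t) z - deriv (F t) z|) := fun k t => by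
    exact (ofReal_integral_norm_eq_lintegral_enorm
      (((hk k).integrable_density t).sub (hF.integrable_density t))).symm
  have h := tendsto_lintegral_of_dominated_convergence (μ := volume.restrict (Icc 0 T))
    (F := fun k t => ∫⁻ z, ‖deriv (Fk k t) z - deriv (F t) z‖ₑ) (f := fun _ => 0)
    (fun _ => ENNReal.ofReal ((M + M) * (2 * R))) hmeas ?_ hconst ?_
  · simpa using h
  · refine fun k => ae_of_all _ fun t => ?_
    dsimp only
    rw [heq]
    refine ENNReal.ofReal_le_ofReal ?_
    have hR := hF.radius_nonneg
    calc ∫ z, |deriv (Fk k t) z - deriv (F t) z|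
        ≤ ∫ z, (Icc (-R) R).indicator (fun _ => ((M : ℝ) + M)) z := by
          refine integral_mono (((hk k).integrable_density t).sub (hF.integrable_density t)).abs
            ((integrable_indicator_iff measurableSet_Icc).2 (by simp)) fun z => ?_
          by_cases hz : z ∈ Icc (-R) R
          · rw [indicator_of_mem hz]
            exact (abs_sub _ _).trans
              (add_le_add ((hk k).norm_density_le t z) (hF.norm_density_le t z))
          · rw [indicator_of_notMem hz]
            dsimp only
            rw [(hk k).density_eq_zero t hz, hF.density_eq_zero t hz]
            simp
      _ = (M + M) * (2 * R) := by
          rw [integral_indicator measurableSet_Icc, setIntegral_const]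
          simp [hR]
          ring
  · filter_upwards [ae_restrict_mem measurableSet_Icc] with t ht
    simp_rw [heq]
    simpa using ENNReal.tendsto_ofReal (hlim t ht)

end IsCDFCurve

/-- The reconstructed density is jointly measurable on the strip. -/
lemma aemeasurable_rhoHat {T m : ℝ} (hT : 0 ≤ T) {N : ℕ} {x : ℝ → ℕ → ℝ}
    (hx : ∀ i ≤ N, ContinuousOn (fun t => x t i) (Icc 0 T)) :
    AEMeasurable (fun p : ℝ × ℝ => rhoHat m N x p.1 p.2)
      (volume.restrict (Icc 0 T ×ˢ univ)) := by
  have hx' : ∀ i ≤ N, Continuous fun t : ℝ => x (projIcc 0 T hT t) i := fun i hi =>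
    (continuousOn_iff_continuous_domRestrict.1 (hx i hi)).comp continuous_projIcc
  refine ⟨fun p => rhoHat m N (fun t => x (projIcc 0 T hT t)) p.1 p.2, ?_, ?_⟩
  · unfold rhoHat densityReconstruction
    refine Finset.measurable_sum _ fun i hi => ?_
    have hi' := Finset.mem_range.1 hi
    have h1 : Continuous fun p : ℝ × ℝ => x (projIcc 0 T hT p.1) i :=
      (hx' i hi'.le).comp continuous_fst
    have h2 : Continuous fun p : ℝ × ℝ => x (projIcc 0 T hT p.1) (i + 1) :=
      (hx' (i + 1) hi').comp continuous_fst
    have hset : MeasurableSet {p : ℝ × ℝ | x (projIcc 0 T hT p.1) i < p.2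
        ∧ p.2 < x (projIcc 0 T hT p.1) (i + 1)} :=
      (measurableSet_lt h1.measurable measurable_snd).inter
        (measurableSet_lt measurable_snd h2.measurable)
    exact (Measurable.indicator (f := fun p : ℝ × ℝ =>
      cellDensity (m / N) (x (projIcc 0 T hT p.1)) i)
      ((h2.measurable.sub h1.measurable).const_div _) hset)
  · filter_upwards [ae_restrict_mem (measurableSet_Icc.prod MeasurableSet.univ)] with p hp
    rw [rhoHat, rhoHat, projIcc_of_mem hT hp.1]

/-- Tonelli's theorem for the `L¹` distance on the strip, with the reconstructed density replaced by
the derivative of the distribution function, to which it is equal off the nodes. -/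
lemma eLpNorm_rhoHat_sub {T m : ℝ} (hT : 0 ≤ T) {N : ℕ} {x : ℝ → ℕ → ℝ}
    (hx : ∀ i ≤ N, ContinuousOn (fun t => x t i) (Icc 0 T))
    (hord : ∀ t ∈ Icc 0 T, ∀ i < N, x t i < x t (i + 1)) {r : ℝ → ℝ → ℝ}
    (hr : Measurable fun p : ℝ × ℝ => r p.1 p.2) :
    eLpNorm (fun p : ℝ × ℝ => rhoHat m N x p.1 p.2 - r p.1 p.2) 1
        (volume.restrict (Icc 0 T ×ˢ univ))
      = ∫⁻ t in Icc 0 T, ∫⁻ z, ‖deriv (trajCDF T hT N (m / N) x t) z - r t z‖ₑ := by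
  have hmeas := ((aemeasurable_rhoHat (m := m) hT hx).sub hr.aemeasurable).enorm
  have hprod : (volume : Measure (ℝ × ℝ)).restrict (Icc 0 T ×ˢ univ)
      = (volume.restrict (Icc 0 T)).prod volume := by
    rw [Measure.volume_eq_prod, ← Measure.prod_restrict, Measure.restrict_univ]
  rw [eLpNorm_one_eq_lintegral_enorm]
  rw [hprod] at hmeas ⊢
  refine (lintegral_prod _ hmeas).trans ?_
  refine setLIntegral_congr_fun measurableSet_Icc fun t ht => ?_
  refine lintegral_congr_ae ?_
  filter_upwards [deriv_trajCDF_ae (m := m) hT hord ht] with z hz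
  rw [hz]
  rfl

lemma integral_Icc_subtype {T : ℝ} (hT : 0 ≤ T) (g : ℝ → ℝ) :
    ∫ t : Icc (0 : ℝ) T, g t ∂(Measure.comap Subtype.val volume) = ∫ t in (0)..T, g t := by
  rw [integral_subtype_comap measurableSet_Icc g, intervalIntegral.integral_of_le hT,
    integral_Icc_eq_integral_Ioc]

end ParticleApprox

theorem mainTheorem5 (T m : ℝ) (hT : 0 < T) (ρbar β V W : ℝ → ℝ)
    (hρbar : ParticleApprox.IsInitialDatum ρbar m)
    (hβ : ParticleApprox.IsMobilityFactor β)
    (hV : ParticleApprox.IsExternalPotential V)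
    (hW : ParticleApprox.IsMildPotential W)
    (x : ℕ → ℝ → ℕ → ℝ)
    (hx : ∀ N : ℕ, m / N ∈ Ioo (0 : ℝ) 1 →
      ParticleApprox.IsParticleSolution ρbar β V W T m N (x N)) :
    ∃ (ρ : ℝ → FiniteMeasure ℝ) (j : ℝ → SignedMeasure ℝ),
      ParticleApprox.IsContinuityPair T ρ j ∧
      ∃ N : ℕ → ℕ, StrictMono N ∧ (∀ k, m / N k ∈ Ioo (0 : ℝ) 1) ∧
        -- strong convergence of the densities in `L¹([0,T] × ℝ)`, to the density `r` of `ρ`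
        (∃ r : ℝ → ℝ → ℝ, (∀ t z, 0 ≤ r t z) ∧
          Integrable (Function.uncurry r) (volume.restrict (Icc 0 T ×ˢ univ)) ∧
          (∀ᵐ t ∂(volume.restrict (Icc 0 T)),
            (ρ t : Measure ℝ) = volume.withDensity (fun z => ENNReal.ofReal (r t z))) ∧
          Tendsto (fun k => eLpNorm
              (fun p : ℝ × ℝ => ParticleApprox.rhoHat m (N k) (x (N k)) p.1 p.2 - r p.1 p.2)
              1 (volume.restrict (Icc 0 T ×ˢ univ)))
            atTop (𝓝 0)) ∧
        -- weak-* convergence of the densities at every time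
        (∀ t ∈ Icc 0 T, ∀ φ : C₀(ℝ, ℝ),
          Tendsto (fun k => ∫ z, φ z * ParticleApprox.rhoHat m (N k) (x (N k)) t z)
            atTop (𝓝 (∫ z, φ z ∂(ρ t : Measure ℝ)))) ∧
        -- weak-* convergence of the measures `j_t(dz) dt` on `[0,T] × ℝ`
        (∀ φ : C₀(Icc (0 : ℝ) T × ℝ, ℝ),
          Tendsto (fun k => ∫ t : Icc (0 : ℝ) T, (∫ z,
              φ (t, z) * ParticleApprox.fluxHat T m (N k) (x (N k)) t z)
                ∂(Measure.comap Subtype.val volume))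
            atTop (𝓝 (∫ t : Icc (0 : ℝ) T, (∫ᵛ z, φ (t, z) ∂•(j t))
                ∂(Measure.comap Subtype.val volume)))) := by
  open ParticleApprox in
  obtain ⟨c, C, q, hC, hqm, hq, hWq⟩ := hW.exists_decomposition
  obtain ⟨R, L, M, hR, hL, hM, hβM, hbound⟩ := exists_apriori_bounds hρbar hβ hV hT hC hq hWq
  have hm := hρbar.mass_pos
  -- the numbers of particles `k₀ + k` satisfy `m / N < 1`
  obtain ⟨k₀, hk₀⟩ := exists_nat_gt m
  have hlt : ∀ k : ℕ, m < ((k₀ + k : ℕ) : ℝ) := fun k => by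
    push_cast
    linarith [k.cast_nonneg (α := ℝ)]
  have hmN : ∀ k, m / (k₀ + k : ℕ) ∈ Ioo (0 : ℝ) 1 := fun k =>
    ⟨div_pos hm (hm.trans (hlt k)), (div_lt_one (hm.trans (hlt k))).2 (hlt k)⟩
  have hsol := fun k => hx _ (hmN k)
  have hapr := fun k => hbound _ _ (hmN k) (hsol k)
  -- the distribution functions of the particle approximations, and a convergent subsequence
  set G : ℕ → ℝ → ℝ → ℝ := fun k => trajCDF T hT.le (k₀ + k) (m / (k₀ + k : ℕ)) (x (k₀ + k)) with hG
  have hGc : ∀ k, IsCDFCurve M.toNNReal (M.toNNReal * L.toNNReal) R m (G k) := by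
    intro k
    have h := isCDFCurve_trajCDF (M := M.toNNReal) (L := L.toNNReal) hT.le (hmN k).1 hR
      (hsol k).ordered
      (fun t ht i hi => by rw [Real.coe_toNNReal _ hM.le]; exact (hapr k t ht).2.2 i hi)
      (fun t ht => (hapr k t ht).1)
      (fun s hs t ht i hi => by
        rw [Real.coe_toNNReal _ hL]
        have := Convex.norm_image_sub_le_of_norm_hasDerivWithin_le (𝕜 := ℝ)
          (fun r hr => (hsol k).ode r hr i hi) (fun r hr => (hapr k r hr).2.1 i hi)
          (convex_Icc 0 T) ht hs
        simpa using this)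
    rwa [mul_div_cancel₀ _ (hm.trans (hlt k)).ne'] at h
  obtain ⟨F, hF, n, hn, hlim⟩ := IsCDFCurve.exists_subseq_tendsto G hGc
  have hGn : ∀ k, IsCDFCurve M.toNNReal (M.toNNReal * L.toNNReal) R m (G (n k)) := fun k => hGc (n k)
  have hcont : ∀ k, ∀ i ≤ k₀ + k, ContinuousOn (fun t => x (k₀ + k) t i) (Icc 0 T) :=
    fun k i hi t ht => ((hsol k).ode t ht i hi).continuousWithinAt
  have hstrong : ∀ t ∈ Icc 0 T,
      Tendsto (fun k => ∫ z, |deriv (G (n k) t) z - deriv (F t) z|) atTop (𝓝 0) := by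
    intro t ht
    refine IsCDFCurve.tendsto_integral_abs_density_sub hGn hF t (hlim t) fun ε hε => ?_
    obtain ⟨C', hC'⟩ := exists_uniform_boxAverage_bound hρbar hβ hV hT hR hM hβM hC hqm hq hWq hε
    refine ⟨C', fun k δ hδ _ => ?_⟩
    have h := hC' _ _ (hmN (n k)) (hsol (n k)) (fun t ht => (hapr (n k) t ht).1)
      (fun t ht => (hapr (n k) t ht).2.2) t ht δ hδ
    have hGt : G (n k) t = configCDF (k₀ + n k) (m / (k₀ + n k : ℕ)) (x (k₀ + n k) t) := by
      ext z
      rw [hG]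
      dsimp only
      rw [trajCDF, projIcc_of_mem hT.le ht]
    simpa only [IsCDFCurve.boxAverage, hGt] using h
  refine ⟨hF.measureAt, IsCDFCurve.fluxAt F, hF.isContinuityPair T, fun k => k₀ + n k,
    fun a b hab => Nat.add_lt_add_left (hn hab) k₀, fun k => hmN (n k),
    ⟨fun t z => deriv (F t) z, hF.density_nonneg, hF.integrable_density_strip T,
      ae_of_all _ fun t => rfl, ?_⟩, ?_, ?_⟩
  · have hL1 := fun k => eLpNorm_rhoHat_sub (m := m) (r := fun t z => deriv (F t) z) hT.le
      (hcont (n k)) (hsol (n k)).ordered hF.measurable_density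
    exact (IsCDFCurve.tendsto_lintegral_density hGn hF hstrong).congr fun k => (hL1 k).symm
  · intro t ht φ
    rw [hF.integral_measureAt]
    have h := IsCDFCurve.tendsto_integral_density hGn hF (fun k => rfl) rfl (hlim t) φ.continuous
    refine h.congr fun k => integral_congr_ae ?_
    filter_upwards [deriv_trajCDF_ae (m := m) hT.le (hsol (n k)).ordered ht] with z hz
    rw [← hz]
    rfl
  · intro φ
    -- the test function, extended to all times by its values at `0` and `T`
    set Φ : ℝ → ℝ → ℝ := fun t z => φ (projIcc 0 T hT.le t, z) with hΦ
    have hΦc : Continuous (Function.uncurry Φ) :=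
      φ.continuous.comp ((continuous_projIcc.comp continuous_fst).prodMk continuous_snd)
    obtain ⟨K, hK⟩ : ∃ K, ∀ t z, |Φ t z| ≤ K :=
      ⟨‖φ.toBCF‖, fun t z => φ.toBCF.norm_coe_le_norm _⟩
    have hΦm : ∀ t, Measurable (Φ t) := fun t => (hΦc.comp (Continuous.prodMk_right t)).measurable
    have hleft : ∀ k, ∫ t : Icc (0 : ℝ) T, (∫ z,
        φ (t, z) * fluxHat T m (k₀ + n k) (x (k₀ + n k)) t z) ∂(Measure.comap Subtype.val volume)
        = ∫ t in (0)..T, ∫ z, Φ t z * cdfFlux (G (n k)) t z := by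
      intro k
      have h := integral_Icc_subtype hT.le fun t =>
        ∫ z, Φ t z * fluxHat T m (k₀ + n k) (x (k₀ + n k)) t z
      simp only [hΦ, projIcc_val] at h
      rw [h]
      refine intervalIntegral.integral_congr_Ioo_of_le hT.le fun t ht => ?_
      refine integral_congr_ae ?_
      filter_upwards [cdfFlux_trajCDF_ae (m := m) hT.le (hsol (n k)).ordered (hsol (n k)).ode ht]
        with z hz
      rw [← hz]
    have hright : ∫ t : Icc (0 : ℝ) T, (∫ᵛ z, φ (t, z) ∂•(IsCDFCurve.fluxAt F t))
          ∂(Measure.comap Subtype.val volume)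
        = ∫ t in (0)..T, ∫ z, Φ t z * cdfFlux F t z := by
      have h := integral_Icc_subtype hT.le fun t => ∫ᵛ z, Φ t z ∂•(IsCDFCurve.fluxAt F t)
      simp only [hΦ, projIcc_val] at h
      rw [h]
      exact intervalIntegral.integral_congr fun t _ => hF.integral_fluxAt t (hΦm t) (hK t)
    simp_rw [hleft, hright]
    exact IsCDFCurve.tendsto_integral_flux hGn hF hlim hT.le hΦc hK
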